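/- **Theorem (Approximate Lewis weight computation).** Call $A\in\mathbb R^{m\times n}$ *non-degenerate* if it has full column rank and no zero row. For a matrix $B$ of full column rank let $\sigma(B)=\mathrm{diag}(B(B^\top B)^{-1}B^\top)$, and for $p>0$ let $w_p(A)\in\mathbb R^m_{>0}$ be the $\ell_p$ Lewis weights of $A$, i.e. the unique positive vector with $w=\sigma(W^{1/2-1/p}A)$, $W=\mathrm{Diag}(w)$. Operations on vectors are coordinatewise. For $p\in(0,4)$ put $r_p=2^{-20}p^2(4-p)$. *Procedure computeApxWeight$(A,p,w^{(0)},\epsilon)$.* Let $L=\max\{4,8/p\}$, $\delta=(4-p)\epsilon/256$ and $T=\lceil 80(\tfrac p2+\tfrac2p)\log\frac{pn}{32\epsilon}\rceil$. Starting from $w=w^{(0)}$, perform $T-1$ times (not at all if $T\le 1$): find $s$ with $e^{-\delta}\sigma(W^{1/2-1/p}A)\le s\le e^{\delta}\sigma(W^{1/2-1/p}A)$ and replace $w$ by $\mathrm{median}\big((1-r_p)w^{(0)},\,w-\tfrac1L(w^{(0)}-\tfrac{w^{(0)}}{w}s),\,(1+r_p)w^{(0)}\big)$. Then find once more such an $s$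 for the last $w$ and output $(w^{2/p-1}s)^{p/2}$, which approximates $\mathrm{diag}(A(A^\top W^{1-2/p}A)^{-1}A^\top)^{p/2}$. *Cost.* Algorithms are randomized straight-line programs, depending on $m,n,p,\epsilon$ but not on $A$, with registers for vectors in $\mathbb R^m$ and $\mathbb R^n$, whose operations are multiplication by $A$ and by $A^\top$, coordinatewise arithmetic and powers, loading of constants, drawing of uniformly random sign vectors, and calls of a solver that returns $(A^\top DA)^{-1}z$ for positive diagonal $D$ and any $z$ with work $\mathcal T_w$ and depth $\mathcal T_d$. Here $\mathcal T_d\ge\lceil\log_2(k+1)\rceil$ where $k$ is the largest number of nonzeros in a row or column of $A$, as for every solver built from binary operations. A program is a sequence of *steps*, each a block of such operations. For every $c>0$ there is a constant $C$ such that for all $1\le n\le m$, $p\in(0,4)$ and $\epsilon\in(0,1)$ the following holds. 1. There is a program with at most $$C\,p^{-1}(4-p)^{-2}\epsilon^{-2}\,\log\!\Big(2+\frac n{p\epsilon}\Big)\log\!\Big(2+\frac m{p\epsilon}\Big)$$ steps, each with at most one call of the solver, at most $C(\mathrm{nnz}(A)+\mathcal T_w)$ work and at most $C\,\mathcal T_d$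 depth, such that for every non-degenerate $A\in\mathbb R^{m\times n}$ and every input $w^{(0)}\in\mathbb R^m_{>0}$ with $\|(w^{(0)})^{-1}(w_p(A)-w^{(0)})\|_\infty\le 2^{-20}p^2(4-p)$, with probability at least $1-m^{-c}$ its output $w$ is an output of computeApxWeight$(A,p,w^{(0)},\epsilon)$ and satisfies $\|w_p(A)^{-1}(w_p(A)-w)\|_\infty\le\epsilon$. 2. There is a program without input weight, with at most $$C\Big(\sqrt n\,(4-p)^{-3}p^{-3}\log\frac{em}{n}+p^{-1}(4-p)^{-2}\epsilon^{-2}\Big)\log\!\Big(2+\frac n{p\epsilon}\Big)\log\!\Big(2+\frac m{p\epsilon}\Big)$$ steps of the same cost, such that for every non-degenerate $A\in\mathbb R^{m\times n}$, with probability at least $1-m^{-c}$ its output $w$ satisfies $\|w_p(A)^{-1}(w_p(A)-w)\|_\infty\le\epsilon$ and is an output of computeApxWeight$(A,p,w^{(1)},\epsilon)$ for some $w^{(1)}\in\mathbb R^m_{>0}$ with $\|(w^{(1)})^{-1}(w_p(A)-w^{(1)})\|_\infty\le 2^{-20}p^2(4-p)$. -/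

import Mathlib

open Matrix

noncomputable section

/-! ### Leverage scores and Lewis weights -/

/-- Full column rank and no zero rows. -/
def NonDegenerate {m n : ℕ} (A : Matrix (Fin m) (Fin n) ℝ) : Prop :=
  A.rank = n ∧ ∀ i, ∃ j, A i j ≠ 0

/-- `σ(B) = diag (B (Bᵀ B)⁻¹ Bᵀ)`. -/
def leverageScores {m n : ℕ} (B : Matrix (Fin m) (Fin n) ℝ) : Fin m → ℝ :=
  fun i => (B * (Bᵀ * B)⁻¹ * Bᵀ) i i

/-- `W ^ (1/2 - 1/p) A` with `W = Diag w`. -/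
def reweight {m n : ℕ} (A : Matrix (Fin m) (Fin n) ℝ) (p : ℝ) (w : Fin m → ℝ) :
    Matrix (Fin m) (Fin n) ℝ :=
  Matrix.diagonal (fun i => w i ^ (1 / 2 - 1 / p)) * A

/-- `w` is a positive vector with `w = σ(W ^ (1/2 - 1/p) A)`. -/
def IsLewisWeight {m n : ℕ} (A : Matrix (Fin m) (Fin n) ℝ) (p : ℝ) (w : Fin m → ℝ) : Prop :=
  (∀ i, 0 < w i) ∧ w = leverageScores (reweight A p w)

/-- The `ℓ_p` Lewis weights `w_p(A)`: the vector with `IsLewisWeight A p`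
(it exists and is unique for nondegenerate `A` and `p > 0`). -/
def lewisWeight {m n : ℕ} (A : Matrix (Fin m) (Fin n) ℝ) (p : ℝ) : Fin m → ℝ :=
  Classical.epsilon (IsLewisWeight A p)

/-! ### The iteration of `computeApxWeight` -/

/-- The radius `r = 2⁻²⁰ p² (4 - p)`. -/
def apxRadius (p : ℝ) : ℝ := p ^ 2 * (4 - p) / 2 ^ 20

/-- Median of three reals. -/
def median (a b c : ℝ) : ℝ := max (min a b) (min (max a b) c)

/-- `s` approximates the leverage scores of `B` up to factors `e ^ (± δ)`. -/
def ApxLeverage {m n : ℕ} (δ : ℝ) (B : Matrix (Fin m) (Fin n) ℝ) (s : Fin m → ℝ) : Prop :=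
  ∀ i, Real.exp (-δ) * leverageScores B i ≤ s i ∧ s i ≤ Real.exp δ * leverageScores B i

/-- `T = ⌈80 (p/2 + 2/p) log (p n / (32 ε))⌉`. -/
def apxIterations (n : ℕ) (p ε : ℝ) : ℕ :=
  ⌈80 * (p / 2 + 2 / p) * Real.log (p * n / (32 * ε))⌉₊

/-- `out` is a possible result of `computeApxWeight(A, p, w₀, ε)`: starting from `w₀` there are
`T - 1` projected gradient steps, each with leverage scores known up to `e ^ (± δ)`, where
`δ = (4 - p) ε / 256`; the output is `diag (A (Aᵀ W ^ (1 - 2/p) A)⁻¹ Aᵀ) ^ (p/2)` for the last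
iterate `W`, the diagonal being `w ^ (2/p - 1) σ(W ^ (1/2 - 1/p) A)` with leverage scores of the
same accuracy. -/
def IsApxWeightRun {m n : ℕ} (A : Matrix (Fin m) (Fin n) ℝ) (p : ℝ) (w₀ : Fin m → ℝ) (ε : ℝ)
    (out : Fin m → ℝ) : Prop :=
  ∃ w : ℕ → Fin m → ℝ,
    w 0 = w₀ ∧
    (∀ j < apxIterations n p ε - 1,
      ∃ s, ApxLeverage ((4 - p) * ε / 256) (reweight A p (w j)) s ∧
        ∀ i, w (j + 1) i =
          median ((1 - apxRadius p) * w₀ i)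
            (w j i - 1 / max 4 (8 / p) * (w₀ i - w₀ i / w j i * s i))
            ((1 + apxRadius p) * w₀ i)) ∧
    ∃ s, ApxLeverage ((4 - p) * ε / 256)
          (reweight A p (w (apxIterations n p ε - 1))) s ∧
      ∀ i, out i = (w (apxIterations n p ε - 1) i ^ (2 / p - 1) * s i) ^ (p / 2)

/-! ### Machine model

A randomized parallel real-number machine. It has row registers (vectors in `ℝ^m`) and column
registers (vectors in `ℝ^n`), and it can use the matrix `A` only by multiplying with `A` or `Aᵀ`
and by calling a solver for `Aᵀ D A` with `D` positive diagonal. A program does not depend on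
`A`. -/

structure MachineState (m n : ℕ) where
  row : ℕ → Fin m → ℝ
  col : ℕ → Fin n → ℝ

/-- Coordinatewise scalar operations. -/
inductive ScalarOp where
  | add | sub | mul | div | max | min

def ScalarOp.eval : ScalarOp → ℝ → ℝ → ℝ
  | .add, x, y => x + y
  | .sub, x, y => x - y
  | .mul, x, y => x * y
  | .div, x, y => x / y
  | .max, x, y => Max.max x y
  | .min, x, y => Min.min x y

/-- Instructions; the first argument is always the index of the register that is written. -/
inductive Instr (m n : ℕ) where
  /-- `row[dst] := A col[x]` -/
  | mulVec (dst x : ℕ)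
  /-- `col[dst] := Aᵀ row[y]` -/
  | transMulVec (dst y : ℕ)
  /-- `col[dst] := (Aᵀ Diag(row[d]) A)⁻¹ col[z]` -/
  | solve (dst d z : ℕ)
  /-- `row[dst] :=` fresh uniformly random vector of signs -/
  | signs (dst : ℕ)
  | rowConst (dst : ℕ) (v : Fin m → ℝ)
  | colConst (dst : ℕ) (v : Fin n → ℝ)
  | rowOp (op : ScalarOp) (dst x y : ℕ)
  | colOp (op : ScalarOp) (dst x y : ℕ)
  /-- `row[dst] := row[x] ^ a`, coordinatewise -/
  | rowPow (dst x : ℕ) (a : ℝ)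

def MachineState.setRow {m n : ℕ} (S : MachineState m n) (k : ℕ) (v : Fin m → ℝ) :
    MachineState m n :=
  { S with row := Function.update S.row k v }

def MachineState.setCol {m n : ℕ} (S : MachineState m n) (k : ℕ) (v : Fin n → ℝ) :
    MachineState m n :=
  { S with col := Function.update S.col k v }

open Classical in
/-- The solver; it only answers queries with positive `D = Diag d`. -/
def solveSystem {m n : ℕ} (A : Matrix (Fin m) (Fin n) ℝ) (d : Fin m → ℝ) (z : Fin n → ℝ) :
    Fin n → ℝ :=
  if ∀ i, 0 < d i then (Aᵀ * Matrix.diagonal d * A)⁻¹ *ᵥ z else 0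

/-- The distribution of the state after one instruction. -/
def Instr.run {m n : ℕ} (A : Matrix (Fin m) (Fin n) ℝ) (S : MachineState m n) :
    Instr m n → PMF (MachineState m n)
  | .mulVec dst x => PMF.pure (S.setRow dst (A *ᵥ S.col x))
  | .transMulVec dst y => PMF.pure (S.setCol dst (Aᵀ *ᵥ S.row y))
  | .solve dst d z => PMF.pure (S.setCol dst (solveSystem A (S.row d) (S.col z)))
  | .signs dst =>
      (PMF.uniformOfFintype (Fin m → Bool)).map
        fun b => S.setRow dst fun i => if b i then 1 else -1
  | .rowConst dst v => PMF.pure (S.setRow dst v)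
  | .colConst dst v => PMF.pure (S.setCol dst v)
  | .rowOp op dst x y => PMF.pure (S.setRow dst fun i => op.eval (S.row x i) (S.row y i))
  | .colOp op dst x y => PMF.pure (S.setCol dst fun i => op.eval (S.col x i) (S.col y i))
  | .rowPow dst x a => PMF.pure (S.setRow dst fun i => S.row x i ^ a)

/-- Number of nonzero entries. -/
def nnz {m n : ℕ} (A : Matrix (Fin m) (Fin n) ℝ) : ℕ :=
  {ij : Fin m × Fin n | A ij.1 ij.2 ≠ 0}.ncard

/-- Largest number of nonzero entries in a row. -/
def maxRowNnz {m n : ℕ} (A : Matrix (Fin m) (Fin n) ℝ) : ℕ :=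
  Finset.univ.sup fun i => {j | A i j ≠ 0}.ncard

/-- Largest number of nonzero entries in a column. -/
def maxColNnz {m n : ℕ} (A : Matrix (Fin m) (Fin n) ℝ) : ℕ :=
  maxRowNnz Aᵀ

/-- Number of scalar operations; `Tw` is the work of the solver. -/
def Instr.work {m n : ℕ} (A : Matrix (Fin m) (Fin n) ℝ) (Tw : ℕ) : Instr m n → ℕ
  | .mulVec _ _ => 2 * nnz A
  | .transMulVec _ _ => 2 * nnz A
  | .solve _ _ _ => Tw
  | .signs _ => m
  | .rowConst _ _ => m
  | .colConst _ _ => n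
  | .rowOp _ _ _ _ => m
  | .colOp _ _ _ _ => n
  | .rowPow _ _ _ => m

/-- Parallel depth with binary operations (sums are balanced binary trees); `Td` is the depth of
the solver. -/
def Instr.depth {m n : ℕ} (A : Matrix (Fin m) (Fin n) ℝ) (Td : ℕ) : Instr m n → ℕ
  | .mulVec _ _ => 1 + Nat.clog 2 (maxRowNnz A)
  | .transMulVec _ _ => 1 + Nat.clog 2 (maxColNnz A)
  | .solve _ _ _ => Td
  | _ => 1

def Instr.solves {m n : ℕ} : Instr m n → ℕ
  | .solve _ _ _ => 1
  | _ => 0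

/-- A step is a block of instructions, executed one after the other. -/
abbrev Step (m n : ℕ) := List (Instr m n)

def Step.work {m n : ℕ} (A : Matrix (Fin m) (Fin n) ℝ) (Tw : ℕ) (s : Step m n) : ℕ :=
  (s.map (Instr.work A Tw)).sum

def Step.depth {m n : ℕ} (A : Matrix (Fin m) (Fin n) ℝ) (Td : ℕ) (s : Step m n) : ℕ :=
  (s.map (Instr.depth A Td)).sum

def Step.solves {m n : ℕ} (s : Step m n) : ℕ := (s.map Instr.solves).sum

/-- A program is a list of steps. -/
abbrev Program (m n : ℕ) := List (Step m n)

/-- Distribution of the final content of row register `0`, when row register `0` holds `input` at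
the start and all other registers are zero. -/
def Program.output {m n : ℕ} (P : Program m n) (A : Matrix (Fin m) (Fin n) ℝ)
    (input : Fin m → ℝ) : PMF (Fin m → ℝ) :=
  (List.foldlM (fun S c => Instr.run A S c)
    (MachineState.setRow ⟨fun _ => 0, fun _ => 0⟩ 0 input) P.flatten).map fun S => S.row 0

/-- Probability that the output of `P` lies in `E`. -/
def Program.prob {m n : ℕ} (P : Program m n) (A : Matrix (Fin m) (Fin n) ℝ)
    (input : Fin m → ℝ) (E : Set (Fin m → ℝ)) : ℝ :=
  ((P.output A input).toOuterMeasure E).toReal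

/-- Every step of `P` contains at most one call of the solver and takes `O(nnz(A) + Tw)` work and
`O(Td)` depth, with constant `C`, on every nondegenerate `A`, for a solver with work `Tw` and depth
`Td`. The lower bound on `Td` holds for every solver built from binary operations: if a row or a
column of `A` has `k` nonzero entries, some coordinate of `(Aᵀ D A)⁻¹ z` depends on more than `k` of
the numbers in `D` and `z`. -/
def Program.CheapSteps {m n : ℕ} (P : Program m n) (C : ℝ) : Prop :=
  ∀ s ∈ P, Step.solves s ≤ 1 ∧
    ∀ (A : Matrix (Fin m) (Fin n) ℝ) (Tw Td : ℕ), NonDegenerate A →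
      Nat.clog 2 (max (maxRowNnz A) (maxColNnz A) + 1) ≤ Td →
      (Step.work A Tw s : ℝ) ≤ C * (nnz A + Tw) ∧ (Step.depth A Td s : ℝ) ≤ C * Td

/-! ### Step bounds -/

/-- `p⁻¹ (4 - p)⁻² ε⁻² log(n/(pε)) log(m/(pε))`, with `2 +` inside the logarithms to keep them
away from `0`. -/
def apxSteps (m n : ℕ) (p ε : ℝ) : ℝ :=
  p⁻¹ * ((4 - p) ^ 2)⁻¹ * (ε ^ 2)⁻¹ * Real.log (2 + n / (p * ε)) * Real.log (2 + m / (p * ε))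

/-- `√n (4 - p)⁻³ p⁻³ log(e m/n) log(n/(pε)) log(m/(pε))`, likewise. -/
def homotopySteps (m n : ℕ) (p ε : ℝ) : ℝ :=
  Real.sqrt n * ((4 - p) ^ 3)⁻¹ * (p ^ 3)⁻¹ * Real.log (Real.exp 1 * m / n) *
    Real.log (2 + n / (p * ε)) * Real.log (2 + m / (p * ε))

end

/-! Put `d = w ^ (1 - 2/p)`, let `G = A (Aᵀ D A)⁻¹ Aᵀ` and let `τ(w)` be the diagonal of `G`. The
leverage scores of the reweighted matrix are `σ = d τ`, and `w` is a Lewis weight iff `log w = (p/2)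
log τ(w)`. As `G_ii` is the maximum of `(A x)_i² / (xᵀ Aᵀ D A x)`, it is antitone in `D`, so `log w
↦ (p/2) log τ(w)` has Lipschitz constant `|1 - p/2| < 1` in the maximum norm. This gives existence
of Lewis weights and a globally convergent reweighting iteration that tolerates inexact leverage
scores.

Near the Lewis weights `v`, a gradient step contracts the relative maximum norm by `1 - (9/10) κ /
L`, where `κ = 2/p - |1 - 2/p|` (`IsLewisWeight.abs_gradStep_sub_le`). For `p ≤ 2` this suffices,
since `κ = 1`. As `p → 4` the rate `κ` vanishes while the number `T` of iterations stays bounded, so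
two norms are combined. With `a = 2/p`, the exact step linearised at `v` is `(1 - a/4) I - ((1 -
a)/4) N`, where `N` averages with the weights `d_j G_ij² / G_ii`. On `ℓ²(v)` the operator `N` is
self-adjoint, positive semidefinite (Schur product) and a contraction (Jensen), so the exact step
contracts that norm by `9/10` (`IsLewisWeight.sum_sq_gradStep_le`). The noise is measured against
the exact run in the maximum norm, where it accumulates to `O(δ/κ)`; this is `O(ε)` because `δ`
carries the factor `4 - p`. The output `τ ^ (p/2)` turns `ℓ²(v)` closeness into coordinatewise
closeness: a change of density that is small in `ℓ²(v)` changes the whole quadratic form, hence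
every `τ_i`, by a factor near `1` (`IsLewisWeight.abs_log_lewisDiag_le_of_sum_sq_le`).

For the randomized part, `σ_i` is the squared length of the `i`-th row of an orthogonal projection
`P`, so averages of `(P b)_i²` over random sign vectors `b` concentrate around `σ_i`. The tails come
from exponential moments, packed into a potential whose expectation does not grow along the program.
Hoare triples with failure probabilities add the errors up (`hoare_sketchBlock`, `Hoare.seq`).

Without an input weight, reweighting starts at the all-ones vector. One step lands within `2 log m`
of `log v`, up to noise, and the contraction reaches the required radius `r` after `O((p (4 - p))⁻¹
log (m / r))` steps (`hoare_startProgram`). Each needs leverage scores of accuracy of order `p² (4 -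
p)²`, obtained from `k` sign vectors or exactly by `n` solves. The cheaper choice costs `min(n, k) ≤
√(n k)`, which is the source of the factor `√n`. -/

/-! ### The kernel `A (Aᵀ D A)⁻¹ Aᵀ` -/

section Kernel

variable {m n : ℕ} {A : Matrix (Fin m) (Fin n) ℝ} {d d' : Fin m → ℝ}

/-- `A (Aᵀ D A)⁻¹ Aᵀ` with `D = Diag d`. -/
noncomputable def levKernel (A : Matrix (Fin m) (Fin n) ℝ) (d : Fin m → ℝ) :
    Matrix (Fin m) (Fin m) ℝ :=
  A * (Aᵀ * Matrix.diagonal d * A)⁻¹ * Aᵀ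

/-- `xᵀ Aᵀ D A x`. -/
noncomputable def energy (A : Matrix (Fin m) (Fin n) ℝ) (d : Fin m → ℝ) (x : Fin n → ℝ) : ℝ :=
  ∑ j, d j * (A *ᵥ x) j ^ 2

theorem NonDegenerate.mulVec_eq_zero (hA : NonDegenerate A) {x : Fin n → ℝ} (hx : A *ᵥ x = 0) :
    x = 0 := by
  have h1 := LinearMap.finrank_range_add_finrank_ker A.mulVecLin
  have h2 : Module.finrank ℝ (LinearMap.range A.mulVecLin) = n := hA.1
  rw [h2, Module.finrank_fin_fun] at h1
  have h3 : LinearMap.ker A.mulVecLin = ⊥ := Submodule.finrank_eq_zero.mp (by omega)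
  have : x ∈ LinearMap.ker A.mulVecLin := by simpa using hx
  rw [h3] at this
  simpa using this

theorem energy_eq_dotProduct (A : Matrix (Fin m) (Fin n) ℝ) (d : Fin m → ℝ) (x : Fin n → ℝ) :
    energy A d x = x ⬝ᵥ ((Aᵀ * Matrix.diagonal d * A) *ᵥ x) := by
  rw [← Matrix.mulVec_mulVec, ← Matrix.mulVec_mulVec, Matrix.dotProduct_mulVec,
    Matrix.vecMul_transpose, energy, dotProduct]
  refine Finset.sum_congr rfl fun j _ => ?_
  rw [Matrix.mulVec_diagonal]
  ring

theorem NonDegenerate.isUnit_gram (hA : NonDegenerate A) (hd : ∀ i, 0 < d i) :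
    IsUnit (Aᵀ * Matrix.diagonal d * A) := by
  rw [← Matrix.mulVec_injective_iff_isUnit]
  intro x y hxy
  have h0 : (Aᵀ * Matrix.diagonal d * A) *ᵥ (x - y) = 0 := by
    rw [Matrix.mulVec_sub, sub_eq_zero]; exact hxy
  have h1 := energy_eq_dotProduct A d (x - y)
  rw [h0, dotProduct_zero, energy,
    Finset.sum_eq_zero_iff_of_nonneg fun j _ => mul_nonneg (hd j).le (sq_nonneg _)] at h1
  refine sub_eq_zero.mp (hA.mulVec_eq_zero ?_)
  funext j
  have := h1 j (Finset.mem_univ j)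
  simpa [(hd j).ne'] using this

theorem levKernel_symm (A : Matrix (Fin m) (Fin n) ℝ) (d : Fin m → ℝ) (i j : Fin m) :
    levKernel A d i j = levKernel A d j i := by
  have : (levKernel A d)ᵀ = levKernel A d := by
    simp only [levKernel, Matrix.transpose_mul, Matrix.transpose_transpose,
      Matrix.transpose_nonsing_inv, Matrix.diagonal_transpose, Matrix.mul_assoc]
  exact (congrFun (congrFun this i) j).symm

theorem levKernel_apply (A : Matrix (Fin m) (Fin n) ℝ) (d : Fin m → ℝ) (i j : Fin m) :
    levKernel A d i j = (A *ᵥ ((Aᵀ * Matrix.diagonal d * A)⁻¹ *ᵥ A j)) i := by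
  rw [Matrix.mulVec_mulVec]
  simp [levKernel, Matrix.mul_apply, Matrix.mulVec, dotProduct]

/-- The reproducing property of the kernel. -/
theorem NonDegenerate.sum_levKernel_mulVec (hA : NonDegenerate A) (hd : ∀ i, 0 < d i)
    (x : Fin n → ℝ) (i : Fin m) :
    ∑ j, d j * levKernel A d i j * (A *ᵥ x) j = (A *ᵥ x) i := by
  have h : levKernel A d * Matrix.diagonal d * A = A := by
    have hu := (Matrix.isUnit_iff_isUnit_det _).mp (hA.isUnit_gram hd)
    calc levKernel A d * Matrix.diagonal d * A
        = A * ((Aᵀ * Matrix.diagonal d * A)⁻¹ * (Aᵀ * Matrix.diagonal d * A)) := by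
          simp only [levKernel, Matrix.mul_assoc]
      _ = A := by rw [Matrix.nonsing_inv_mul _ hu, Matrix.mul_one]
  conv_rhs => rw [← h, ← Matrix.mulVec_mulVec]
  simp only [Matrix.mulVec, dotProduct, Matrix.mul_diagonal]
  exact Finset.sum_congr rfl fun j _ => by ring

theorem NonDegenerate.sum_levKernel_mul (hA : NonDegenerate A) (hd : ∀ i, 0 < d i)
    (i k : Fin m) :
    ∑ j, d j * levKernel A d i j * levKernel A d j k = levKernel A d i k := by
  simp only [levKernel_apply A d _ k]
  exact hA.sum_levKernel_mulVec hd _ i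

theorem NonDegenerate.sum_levKernel_sq (hA : NonDegenerate A) (hd : ∀ i, 0 < d i) (i : Fin m) :
    ∑ j, d j * levKernel A d i j ^ 2 = levKernel A d i i := by
  rw [← hA.sum_levKernel_mul hd i i]
  refine Finset.sum_congr rfl fun j _ => ?_
  rw [levKernel_symm A d j i]; ring

/-- Cauchy–Schwarz in the `D`-weighted inner product, applied to the reproducing property. Equality
holds at `levVector A d i`, so the diagonal of the kernel is a maximum of Rayleigh type quotients;
all comparisons of kernels below test one kernel with the extremal vector of another. -/
theorem NonDegenerate.mulVec_sq_le (hA : NonDegenerate A) (hd : ∀ i, 0 < d i)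
    (x : Fin n → ℝ) (i : Fin m) :
    (A *ᵥ x) i ^ 2 ≤ levKernel A d i i * energy A d x := by
  rw [← hA.sum_levKernel_mulVec hd x i, ← hA.sum_levKernel_sq hd i, energy]
  have := Finset.sum_mul_sq_le_sq_mul_sq Finset.univ
    (fun j => Real.sqrt (d j) * levKernel A d i j) (fun j => Real.sqrt (d j) * (A *ᵥ x) j)
  simp only [mul_pow, Real.sq_sqrt (hd _).le] at this
  refine le_trans (le_of_eq ?_) this
  congr 1
  refine Finset.sum_congr rfl fun j _ => ?_
  have := Real.mul_self_sqrt (hd j).le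
  linear_combination (-(levKernel A d i j * (A *ᵥ x) j)) * this

theorem NonDegenerate.levKernel_pos (hA : NonDegenerate A) (hd : ∀ i, 0 < d i) (i : Fin m) :
    0 < levKernel A d i i := by
  have h0 : 0 ≤ levKernel A d i i := by
    rw [← hA.sum_levKernel_sq hd i]
    exact Finset.sum_nonneg fun j _ => mul_nonneg (hd j).le (sq_nonneg _)
  refine lt_of_le_of_ne h0 fun h => ?_
  obtain ⟨j, hj⟩ := hA.2 i
  have := hA.mulVec_sq_le hd (Pi.single j 1) i
  rw [← h, zero_mul, Matrix.mulVec_single_one] at this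
  exact hj (pow_eq_zero_iff two_ne_zero |>.mp (le_antisymm this (sq_nonneg _)))

/-- The test vector `(Aᵀ D A)⁻¹ aᵢ`. -/
noncomputable def levVector (A : Matrix (Fin m) (Fin n) ℝ) (d : Fin m → ℝ) (i : Fin m) :
    Fin n → ℝ :=
  (Aᵀ * Matrix.diagonal d * A)⁻¹ *ᵥ A i

theorem mulVec_levVector (A : Matrix (Fin m) (Fin n) ℝ) (d : Fin m → ℝ) (i j : Fin m) :
    (A *ᵥ levVector A d i) j = levKernel A d i j := by
  rw [levKernel_symm, levKernel_apply, levVector]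

theorem NonDegenerate.energy_levVector (hA : NonDegenerate A) (hd : ∀ i, 0 < d i) (i : Fin m) :
    energy A d (levVector A d i) = levKernel A d i i := by
  simp only [energy, mulVec_levVector, hA.sum_levKernel_sq hd i]

theorem energy_nonneg (hd : ∀ i, 0 < d i) (x : Fin n → ℝ) : 0 ≤ energy A d x :=
  Finset.sum_nonneg fun j _ => mul_nonneg (hd j).le (sq_nonneg _)

/-- The diagonal of the kernel is antitone in the quadratic form. -/
theorem NonDegenerate.levKernel_le_of_energy_le (hA : NonDegenerate A) (hd : ∀ i, 0 < d i)
    (hd' : ∀ i, 0 < d' i) {c : ℝ} (h : ∀ x, energy A d x ≤ c * energy A d' x) (i : Fin m) :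
    levKernel A d' i i ≤ c * levKernel A d i i := by
  -- The extremal vector of `d'` serves as a competitor for `d`.
  have h1 := hA.mulVec_sq_le hd (levVector A d' i) i
  rw [mulVec_levVector] at h1
  have h2 := h (levVector A d' i)
  rw [hA.energy_levVector hd'] at h2
  have h3 := hA.levKernel_pos hd i
  have h4 := hA.levKernel_pos hd' i
  have : levKernel A d' i i * levKernel A d' i i
      ≤ (c * levKernel A d i i) * levKernel A d' i i := by nlinarith
  exact le_of_mul_le_mul_right this h4

theorem energy_le_of_le {c : ℝ} (h : ∀ i, d i ≤ c * d' i) (x : Fin n → ℝ) :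
    energy A d x ≤ c * energy A d' x := by
  rw [energy, energy, Finset.mul_sum]
  refine Finset.sum_le_sum fun j _ => ?_
  rw [← mul_assoc]
  exact mul_le_mul_of_nonneg_right (h j) (sq_nonneg _)

theorem NonDegenerate.levKernel_le (hA : NonDegenerate A) (hd : ∀ i, 0 < d i)
    (hd' : ∀ i, 0 < d' i) {c : ℝ} (h : ∀ i, d i ≤ c * d' i) (i : Fin m) :
    levKernel A d' i i ≤ c * levKernel A d i i :=
  hA.levKernel_le_of_energy_le hd hd' (energy_le_of_le h) i

theorem NonDegenerate.mul_levKernel_le_one (hA : NonDegenerate A) (hd : ∀ i, 0 < d i)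
    (i : Fin m) : d i * levKernel A d i i ≤ 1 := by
  have h1 : d i * levKernel A d i i ^ 2 ≤ levKernel A d i i := by
    conv_rhs => rw [← hA.sum_levKernel_sq hd i]
    exact Finset.single_le_sum (f := fun j => d j * levKernel A d i j ^ 2)
      (fun j _ => mul_nonneg (hd j).le (sq_nonneg _)) (Finset.mem_univ i)
  have h2 := hA.levKernel_pos hd i
  have : (d i * levKernel A d i i) * levKernel A d i i ≤ 1 * levKernel A d i i := by
    linarith [h1, sq (levKernel A d i i), mul_assoc (d i) (levKernel A d i i) (levKernel A d i i)]
  exact le_of_mul_le_mul_right this h2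

theorem NonDegenerate.sum_mul_levKernel (hA : NonDegenerate A) (hd : ∀ i, 0 < d i) :
    ∑ i, d i * levKernel A d i i = n := by
  have hu := (Matrix.isUnit_iff_isUnit_det _).mp (hA.isUnit_gram hd)
  have h : Matrix.trace (Matrix.diagonal d * levKernel A d) = n := by
    rw [levKernel, ← Matrix.mul_assoc, Matrix.trace_mul_comm, ← Matrix.mul_assoc,
      ← Matrix.mul_assoc, Matrix.mul_nonsing_inv _ hu, Matrix.trace_one, Fintype.card_fin]
  rw [← h]
  simp [Matrix.trace, Matrix.diagonal_mul]

/-- First-order lower bound for the diagonal of the kernel. -/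
theorem NonDegenerate.levKernel_sub_le (hA : NonDegenerate A) (hd : ∀ i, 0 < d i)
    (hd' : ∀ i, 0 < d' i) (i : Fin m) :
    levKernel A d i i - ∑ j, (d' j - d j) * levKernel A d i j ^ 2 ≤ levKernel A d' i i := by
  -- The extremal vector of `d`, tested against `d'`, gives `τ² ≤ τ' (τ + S)`; the claim `τ - S ≤
  -- τ'` follows from `(τ - S)(τ + S) ≤ τ²`.
  have h1 := hA.mulVec_sq_le hd' (levVector A d i) i
  have h2 : energy A d' (levVector A d i)
      = levKernel A d i i + ∑ j, (d' j - d j) * levKernel A d i j ^ 2 := by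
    rw [← hA.energy_levVector hd i, energy, energy, ← Finset.sum_add_distrib]
    simp only [mulVec_levVector]
    exact Finset.sum_congr rfl fun j _ => by ring
  rw [mulVec_levVector] at h1
  have h3 := energy_nonneg (A := A) hd' (levVector A d i)
  rw [h2] at h1 h3
  have h4 := hA.levKernel_pos hd i
  have h5 := hA.levKernel_pos hd' i
  set S := ∑ j, (d' j - d j) * levKernel A d i j ^ 2
  set τ := levKernel A d i i
  set τ' := levKernel A d' i i
  have h6 : 0 < τ + S := by
    rcases h3.lt_or_eq with h | h
    · exact h
    · rw [← h] at h1; nlinarith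
  by_contra! hcon
  nlinarith [mul_lt_mul_of_pos_right hcon h6, sq_nonneg S]

/-- Second-order upper bound for the diagonal of the kernel. -/
theorem NonDegenerate.levKernel_le_sub_add (hA : NonDegenerate A) (hd : ∀ i, 0 < d i)
    (hd' : ∀ i, 0 < d' i) (i : Fin m) :
    levKernel A d' i i ≤ levKernel A d i i - ∑ j, (d' j - d j) * levKernel A d i j ^ 2
      + ∑ j, (d' j - d j) ^ 2 / d' j * levKernel A d i j ^ 2 := by
  have h1 := hA.sum_levKernel_sq hd' i
  have h2 := hA.sum_levKernel_sq hd i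
  have h3 := hA.sum_levKernel_mulVec hd (levVector A d' i) i
  simp only [mulVec_levVector] at h3
  -- Summed over `j`, the left side is `2 G'_ii - G'_ii` by the reproducing property of both
  -- kernels. The gap between the two sides is a square divided by `d'_j`.
  have key : ∀ j, 2 * (d j * levKernel A d i j * levKernel A d' i j)
      - d' j * levKernel A d' i j ^ 2 ≤ d j * levKernel A d i j ^ 2
        - (d' j - d j) * levKernel A d i j ^ 2
        + (d' j - d j) ^ 2 / d' j * levKernel A d i j ^ 2 := by
    intro j
    have hj := hd' j
    have : d j * levKernel A d i j ^ 2 - (d' j - d j) * levKernel A d i j ^ 2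
        + (d' j - d j) ^ 2 / d' j * levKernel A d i j ^ 2
        - (2 * (d j * levKernel A d i j * levKernel A d' i j) - d' j * levKernel A d' i j ^ 2)
        = (d j * levKernel A d i j - d' j * levKernel A d' i j) ^ 2 / d' j := by
      field_simp
      ring
    have h0 : 0 ≤ (d j * levKernel A d i j - d' j * levKernel A d' i j) ^ 2 / d' j := by positivity
    linarith
  have := Finset.sum_le_sum fun j (_ : j ∈ Finset.univ) => key j
  simp only [Finset.sum_add_distrib, Finset.sum_sub_distrib, ← Finset.mul_sum, h1, h2, h3] at this
  linarith

/-- If the relative change `e` of the weights is small in the norm given by the leverage scores,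
the quadratic form changes little. -/
theorem NonDegenerate.abs_energy_sub_le (hA : NonDegenerate A) (hd : ∀ i, 0 < d i)
    {e : Fin m → ℝ} {η : ℝ} (hη : 0 ≤ η)
    (he : ∑ j, d j * levKernel A d j j * e j ^ 2 ≤ η ^ 2) (x : Fin n → ℝ) :
    |∑ j, d j * e j * (A *ᵥ x) j ^ 2| ≤ η * energy A d x := by
  have hE := energy_nonneg (A := A) hd x
  refine abs_le_of_sq_le_sq ?_ (mul_nonneg hη hE)
  have h1 := Finset.sum_mul_sq_le_sq_mul_sq Finset.univ
    (fun j => Real.sqrt (d j) * e j * (A *ᵥ x) j) (fun j => Real.sqrt (d j) * (A *ᵥ x) j)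
  simp only [mul_pow, Real.sq_sqrt (hd _).le] at h1
  -- In one Cauchy–Schwarz factor `(A x)_j²` is bounded by `G_jj` times the energy, which produces
  -- the leverage scores as weights.
  have h2 : ∑ j, d j * e j ^ 2 * (A *ᵥ x) j ^ 2 ≤ η ^ 2 * energy A d x := by
    calc ∑ j, d j * e j ^ 2 * (A *ᵥ x) j ^ 2
        ≤ ∑ j, d j * levKernel A d j j * e j ^ 2 * energy A d x := by
          refine Finset.sum_le_sum fun j _ => ?_
          have := mul_le_mul_of_nonneg_left (hA.mulVec_sq_le hd x j)
            (mul_nonneg (hd j).le (sq_nonneg (e j)))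
          linarith
      _ ≤ η ^ 2 * energy A d x := by
          rw [← Finset.sum_mul]
          exact mul_le_mul_of_nonneg_right he hE
  have h3 : ∑ j, Real.sqrt (d j) * e j * (A *ᵥ x) j * (Real.sqrt (d j) * (A *ᵥ x) j)
      = ∑ j, d j * e j * (A *ᵥ x) j ^ 2 := by
    refine Finset.sum_congr rfl fun j _ => ?_
    have := Real.mul_self_sqrt (hd j).le
    linear_combination (e j * (A *ᵥ x) j ^ 2) * this
  rw [h3] at h1
  calc _ ≤ _ := h1
    _ ≤ (η ^ 2 * energy A d x) * energy A d x := mul_le_mul_of_nonneg_right h2 hE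
    _ = _ := by ring

/-- The Hadamard square of the kernel is positive semidefinite. -/
theorem NonDegenerate.sum_levKernel_sq_mul_nonneg (hA : NonDegenerate A) (hd : ∀ i, 0 < d i)
    (c : Fin m → ℝ) : 0 ≤ ∑ i, ∑ j, c i * c j * levKernel A d i j ^ 2 := by
  -- Schur product argument: expanding both factors `G_ij = ∑ₖ d_k G_ik G_kj` exhibits the form as a
  -- sum of squares over pairs `(k, l)`.
  have h : ∑ i, ∑ j, c i * c j * levKernel A d i j ^ 2
      = ∑ k, ∑ l, d k * d l * (∑ i, c i * levKernel A d i k * levKernel A d i l) ^ 2 := by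
    have h1 : ∀ i j, c i * c j * levKernel A d i j ^ 2 = ∑ k, ∑ l, d k * d l *
        ((c i * levKernel A d i k * levKernel A d i l)
          * (c j * levKernel A d j k * levKernel A d j l)) := by
      intro i j
      conv_lhs => rw [sq, ← hA.sum_levKernel_mul hd i j, Finset.sum_mul_sum, Finset.mul_sum]
      refine Finset.sum_congr rfl fun k _ => ?_
      rw [Finset.mul_sum]
      refine Finset.sum_congr rfl fun l _ => ?_
      rw [levKernel_symm A d k j, levKernel_symm A d l j]; ring
    have h2 : ∀ k l, d k * d l * (∑ i, c i * levKernel A d i k * levKernel A d i l) ^ 2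
        = ∑ i, ∑ j, d k * d l * ((c i * levKernel A d i k * levKernel A d i l)
          * (c j * levKernel A d j k * levKernel A d j l)) := by
      intro k l
      rw [sq, Finset.sum_mul_sum, Finset.mul_sum]
      exact Finset.sum_congr rfl fun i _ => Finset.mul_sum _ _ _
    simp only [h1, h2]
    calc _ = ∑ i, ∑ k, ∑ j, ∑ l, d k * d l * ((c i * levKernel A d i k * levKernel A d i l)
          * (c j * levKernel A d j k * levKernel A d j l)) :=
          Finset.sum_congr rfl fun i _ => Finset.sum_comm
      _ = _ := Finset.sum_comm
      _ = ∑ k, ∑ i, ∑ l, ∑ j, d k * d l * ((c i * levKernel A d i k * levKernel A d i l)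
          * (c j * levKernel A d j k * levKernel A d j l)) :=
        Finset.sum_congr rfl fun k _ => Finset.sum_congr rfl fun i _ => Finset.sum_comm
      _ = _ := Finset.sum_congr rfl fun k _ => Finset.sum_comm
  rw [h]
  exact Finset.sum_nonneg fun k _ => Finset.sum_nonneg fun l _ =>
    mul_nonneg (mul_nonneg (hd k).le (hd l).le) (sq_nonneg _)

/-- Leverage scores of a rescaled matrix through the kernel. -/
theorem leverageScores_diagonal_mul (A : Matrix (Fin m) (Fin n) ℝ) (b : Fin m → ℝ) (i : Fin m) :
    leverageScores (Matrix.diagonal b * A) i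
      = b i ^ 2 * levKernel A (fun j => b j ^ 2) i i := by
  have h : (Matrix.diagonal b * A)ᵀ * (Matrix.diagonal b * A)
      = Aᵀ * Matrix.diagonal (fun j => b j ^ 2) * A := by
    rw [Matrix.transpose_mul, Matrix.diagonal_transpose, Matrix.mul_assoc,
      ← Matrix.mul_assoc (Matrix.diagonal b), Matrix.diagonal_mul_diagonal, Matrix.mul_assoc]
    simp only [sq]
  rw [leverageScores, h, Matrix.transpose_mul, Matrix.diagonal_transpose]
  have : Matrix.diagonal b * A * (Aᵀ * Matrix.diagonal (fun j => b j ^ 2) * A)⁻¹ *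
      (Aᵀ * Matrix.diagonal b)
      = Matrix.diagonal b * levKernel A (fun j => b j ^ 2) * Matrix.diagonal b := by
    simp only [levKernel, Matrix.mul_assoc]
  rw [this, Matrix.mul_diagonal, Matrix.diagonal_mul]
  ring

end Kernel

/-! ### Lewis weights -/

section Lewis

variable {m n : ℕ} {A : Matrix (Fin m) (Fin n) ℝ} {p : ℝ} {w v : Fin m → ℝ}

/-- `w ^ (1 - 2/p)`, coordinatewise. -/
noncomputable def lewisDensity (p : ℝ) (w : Fin m → ℝ) : Fin m → ℝ :=
  fun j => w j ^ (1 - 2 / p)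

/-- `diag (A (Aᵀ W ^ (1 - 2/p) A)⁻¹ Aᵀ)`. -/
noncomputable def lewisDiag (A : Matrix (Fin m) (Fin n) ℝ) (p : ℝ) (w : Fin m → ℝ) : Fin m → ℝ :=
  fun i => levKernel A (lewisDensity p w) i i

theorem lewisDensity_pos (hw : ∀ i, 0 < w i) (i : Fin m) : 0 < lewisDensity p w i :=
  Real.rpow_pos_of_pos (hw i) _

theorem NonDegenerate.lewisDiag_pos (hA : NonDegenerate A) (hw : ∀ i, 0 < w i) (i : Fin m) :
    0 < lewisDiag A p w i :=
  hA.levKernel_pos (lewisDensity_pos hw) i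

theorem sq_rpow_half_sub (hw : ∀ i, 0 < w i) (i : Fin m) :
    (w i ^ (1 / 2 - 1 / p)) ^ 2 = lewisDensity p w i := by
  rw [← Real.rpow_natCast, ← Real.rpow_mul (hw i).le, lewisDensity]
  congr 1
  push_cast
  ring

theorem leverageScores_reweight (hw : ∀ i, 0 < w i) (i : Fin m) :
    leverageScores (reweight A p w) i = lewisDensity p w i * lewisDiag A p w i := by
  rw [reweight, leverageScores_diagonal_mul]
  simp only [sq_rpow_half_sub hw]
  rfl

theorem NonDegenerate.leverageScores_reweight_pos (hA : NonDegenerate A) (hw : ∀ i, 0 < w i)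
    (i : Fin m) : 0 < leverageScores (reweight A p w) i := by
  rw [leverageScores_reweight hw]
  exact mul_pos (lewisDensity_pos hw i) (hA.lewisDiag_pos hw i)

/-- Coordinatewise closeness of the logarithms. -/
def LogClose (t : ℝ) (w v : Fin m → ℝ) : Prop :=
  ∀ i, |Real.log (w i) - Real.log (v i)| ≤ t

theorem LogClose.symm {t : ℝ} (h : LogClose t w v) : LogClose t v w := fun i => by
  rw [abs_sub_comm]; exact h i

theorem LogClose.mono {s t : ℝ} (h : LogClose s w v) (hst : s ≤ t) : LogClose t w v :=
  fun i => (h i).trans hst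

/-- The densities differ by at most the factor `exp (|1 - 2/p| t)`, and the kernel diagonal is
antitone and homogeneous of degree `-1` in the density. -/
theorem NonDegenerate.log_lewisDiag_sub_le (hA : NonDegenerate A) (hw : ∀ i, 0 < w i)
    (hv : ∀ i, 0 < v i) {t : ℝ} (h : LogClose t w v) (i : Fin m) :
    Real.log (lewisDiag A p w i) - Real.log (lewisDiag A p v i) ≤ |1 - 2 / p| * t := by
  have h1 : ∀ j, lewisDensity p v j ≤ Real.exp (|1 - 2 / p| * t) * lewisDensity p w j := by
    intro j
    rw [lewisDensity, lewisDensity, Real.rpow_def_of_pos (hv j), Real.rpow_def_of_pos (hw j),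
      ← Real.exp_add, Real.exp_le_exp]
    have h2 : (Real.log (v j) - Real.log (w j)) * (1 - 2 / p) ≤ |1 - 2 / p| * t := by
      refine (le_abs_self _).trans ?_
      rw [abs_mul, mul_comm]
      exact mul_le_mul_of_nonneg_left (h.symm j) (abs_nonneg _)
    linarith
  have h3 := hA.levKernel_le (lewisDensity_pos hv) (lewisDensity_pos hw) h1 i
  have h4 := Real.log_le_log (hA.lewisDiag_pos hw i) h3
  rw [Real.log_mul (Real.exp_pos _).ne' (hA.levKernel_pos (lewisDensity_pos hv) i).ne',
    Real.log_exp] at h4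
  have : Real.log (lewisDiag A p v i) = Real.log (levKernel A (lewisDensity p v) i i) := rfl
  linarith

theorem NonDegenerate.abs_log_lewisDiag_sub_le (hA : NonDegenerate A) (hw : ∀ i, 0 < w i)
    (hv : ∀ i, 0 < v i) {t : ℝ} (h : LogClose t w v) (i : Fin m) :
    |Real.log (lewisDiag A p w i) - Real.log (lewisDiag A p v i)| ≤ |1 - 2 / p| * t := by
  have h1 := hA.log_lewisDiag_sub_le (p := p) hw hv h i
  have h2 := hA.log_lewisDiag_sub_le (p := p) hv hw h.symm i
  rw [abs_le]
  constructor <;> linarith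

theorem half_mul_abs_one_sub (hp : 0 < p) : p / 2 * |1 - 2 / p| = |1 - p / 2| := by
  rw [← abs_of_pos (half_pos hp), ← abs_mul, abs_of_pos (half_pos hp), abs_sub_comm]
  congr 1
  field_simp

/-- In logarithmic coordinates the defining equation becomes a fixed point equation whose right side
depends on `w` only through `τ`. -/
theorem isLewisWeight_iff (hA : NonDegenerate A) (hp : 0 < p) (hw : ∀ i, 0 < w i) :
    IsLewisWeight A p w ↔ ∀ i, Real.log (w i) = p / 2 * Real.log (lewisDiag A p w i) := by
  have key : ∀ i, w i = leverageScores (reweight A p w) i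
      ↔ Real.log (w i) = p / 2 * Real.log (lewisDiag A p w i) := by
    intro i
    have h1 := hA.lewisDiag_pos (p := p) hw i
    have h2 := lewisDensity_pos (p := p) hw i
    rw [leverageScores_reweight hw, ← Real.log_injOn_pos.eq_iff (hw i) (mul_pos h2 h1),
      Real.log_mul h2.ne' h1.ne', lewisDensity, Real.log_rpow (hw i)]
    constructor
    · intro h
      field_simp at h
      linarith
    · intro h
      rw [h]
      field_simp
      ring
  constructor
  · rintro ⟨-, h⟩ i
    exact (key i).mp (congrFun h i)
  · intro h
    exact ⟨hw, funext fun i => (key i).mpr (h i)⟩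

theorem abs_one_sub_half_lt_one (hp : 0 < p) (hp4 : p < 4) : |1 - p / 2| < 1 := by
  rw [abs_lt]
  constructor <;> linarith

/-- Lewis weights exist: they are the fixed point of a contraction in logarithmic coordinates. -/
theorem NonDegenerate.exists_isLewisWeight (hA : NonDegenerate A) (hp : 0 < p) (hp4 : p < 4) :
    ∃ w, IsLewisWeight A p w := by
  let F : (Fin m → ℝ) → (Fin m → ℝ) := fun l i =>
    p / 2 * Real.log (lewisDiag A p (fun j => Real.exp (l j)) i)
  -- The constant is `(p/2) |1 - 2/p| = |1 - p/2|`, below `1` precisely for `0 < p < 4`.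
  have hF : ContractingWith ⟨|1 - p / 2|, abs_nonneg _⟩ F := by
    refine ⟨abs_one_sub_half_lt_one hp hp4, LipschitzWith.of_dist_le_mul fun x y => ?_⟩
    refine (dist_pi_le_iff (mul_nonneg (NNReal.coe_nonneg _) dist_nonneg)).mpr fun i => ?_
    have h := hA.abs_log_lewisDiag_sub_le (p := p) (t := dist x y)
      (w := fun j => Real.exp (x j)) (v := fun j => Real.exp (y j))
      (fun j => Real.exp_pos _) (fun j => Real.exp_pos _)
      (fun j => by simpa [Real.dist_eq] using dist_le_pi_dist x y j) i
    simp only [F, Real.dist_eq, ← mul_sub, abs_mul, abs_of_pos (half_pos hp)]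
    refine (mul_le_mul_of_nonneg_left h (half_pos hp).le).trans (le_of_eq ?_)
    rw [← mul_assoc, half_mul_abs_one_sub hp]
    rfl
  refine ⟨fun j => Real.exp (hF.fixedPoint F j), ?_⟩
  rw [isLewisWeight_iff hA hp fun j => Real.exp_pos _]
  intro i
  rw [Real.log_exp]
  conv_lhs => rw [← hF.fixedPoint_isFixedPt]

/-- Existence is all that is needed: the estimates below hold for an arbitrary Lewis weight `v`, so
uniqueness never enters. -/
theorem NonDegenerate.isLewisWeight_lewisWeight (hA : NonDegenerate A) (hp : 0 < p) (hp4 : p < 4) :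
    IsLewisWeight A p (lewisWeight A p) :=
  Classical.epsilon_spec (hA.exists_isLewisWeight hp hp4)

theorem IsLewisWeight.density_mul_diag (h : IsLewisWeight A p w) (i : Fin m) :
    lewisDensity p w i * lewisDiag A p w i = w i := by
  rw [← leverageScores_reweight h.1 i]
  exact (congrFun h.2 i).symm

theorem IsLewisWeight.le_one (h : IsLewisWeight A p w) (hA : NonDegenerate A) (i : Fin m) :
    w i ≤ 1 := by
  rw [← h.density_mul_diag i]
  exact hA.mul_levKernel_le_one (lewisDensity_pos h.1) i

theorem IsLewisWeight.sum_eq (h : IsLewisWeight A p w) (hA : NonDegenerate A) :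
    ∑ i, w i = n := by
  rw [← hA.sum_mul_levKernel (lewisDensity_pos (p := p) h.1)]
  exact Finset.sum_congr rfl fun i _ => (h.density_mul_diag i).symm

/-- The reweighting step `w ↦ (w ^ (2/p - 1) s) ^ (p/2)`. -/
noncomputable def lewisUpdate (p : ℝ) (w s : Fin m → ℝ) : Fin m → ℝ :=
  fun i => (w i ^ (2 / p - 1) * s i) ^ (p / 2)

theorem ApxLeverage.pos {δ : ℝ} {s : Fin m → ℝ} (hs : ApxLeverage δ (reweight A p w) s)
    (hA : NonDegenerate A) (hw : ∀ i, 0 < w i) (i : Fin m) : 0 < s i :=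
  lt_of_lt_of_le (mul_pos (Real.exp_pos _) (hA.leverageScores_reweight_pos hw i)) (hs i).1

theorem ApxLeverage.abs_log_sub_le {δ : ℝ} {s : Fin m → ℝ}
    (hs : ApxLeverage δ (reweight A p w) s) (hA : NonDegenerate A) (hw : ∀ i, 0 < w i)
    (i : Fin m) :
    |Real.log (s i) - Real.log (leverageScores (reweight A p w) i)| ≤ δ := by
  have h0 := hA.leverageScores_reweight_pos (p := p) hw i
  have h1 := Real.log_le_log (mul_pos (Real.exp_pos _) h0) (hs i).1
  have h2 := Real.log_le_log (hs.pos hA hw i) (hs i).2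
  rw [Real.log_mul (Real.exp_pos _).ne' h0.ne', Real.log_exp] at h1 h2
  rw [abs_le]
  constructor <;> linarith

theorem lewisUpdate_pos {s : Fin m → ℝ} (hw : ∀ i, 0 < w i) (hs : ∀ i, 0 < s i) (i : Fin m) :
    0 < lewisUpdate p w s i :=
  Real.rpow_pos_of_pos (mul_pos (Real.rpow_pos_of_pos (hw i) _) (hs i)) _

theorem ApxLeverage.abs_log_lewisUpdate_sub_le {δ : ℝ} {s : Fin m → ℝ}
    (hs : ApxLeverage δ (reweight A p w) s) (hA : NonDegenerate A) (hp : 0 < p)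
    (hw : ∀ i, 0 < w i) (i : Fin m) :
    |Real.log (lewisUpdate p w s i) - p / 2 * Real.log (lewisDiag A p w i)| ≤ p / 2 * δ := by
  have h1 := hs.abs_log_sub_le hA hw i
  have h2 : Real.log (lewisUpdate p w s i) - p / 2 * Real.log (lewisDiag A p w i)
      = p / 2 * (Real.log (s i) - Real.log (leverageScores (reweight A p w) i)) := by
    have h3 := lewisDensity_pos (p := p) hw i
    rw [lewisUpdate, Real.log_rpow (mul_pos (Real.rpow_pos_of_pos (hw i) _) (hs.pos hA hw i)),
      Real.log_mul (Real.rpow_pos_of_pos (hw i) _).ne' (hs.pos hA hw i).ne',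
      Real.log_rpow (hw i), leverageScores_reweight hw,
      Real.log_mul h3.ne' (hA.lewisDiag_pos hw i).ne', lewisDensity, Real.log_rpow (hw i)]
    ring
  rw [h2, abs_mul, abs_of_pos (half_pos hp)]
  exact mul_le_mul_of_nonneg_left h1 (half_pos hp).le

/-- A reweighting step with approximate leverage scores contracts the distance to the Lewis
weights, up to the error of the leverage scores. -/
theorem IsLewisWeight.logClose_lewisUpdate (h : IsLewisWeight A p v) (hA : NonDegenerate A)
    (hp : 0 < p) (hw : ∀ i, 0 < w i) {δ t : ℝ} {s : Fin m → ℝ}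
    (hs : ApxLeverage δ (reweight A p w) s) (hwv : LogClose t w v) :
    LogClose (|1 - p / 2| * t + p / 2 * δ) (lewisUpdate p w s) v := by
  intro i
  have h1 := hs.abs_log_lewisUpdate_sub_le hA hp hw i
  have h2 := mul_le_mul_of_nonneg_left (hA.abs_log_lewisDiag_sub_le (p := p) hw h.1 hwv i)
    (half_pos hp).le
  rw [← mul_assoc, half_mul_abs_one_sub hp, ← abs_of_pos (half_pos hp), ← abs_mul,
    abs_of_pos (half_pos hp), mul_sub, ← (isLewisWeight_iff hA hp h.1).mp h i] at h2
  have := abs_sub_le (Real.log (lewisUpdate p w s i)) (p / 2 * Real.log (lewisDiag A p w i))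
    (Real.log (v i))
  linarith

theorem IsLewisWeight.lewisDiag_eq (h : IsLewisWeight A p v) (i : Fin m) :
    lewisDiag A p v i = v i ^ (2 / p) := by
  have h1 := h.density_mul_diag i
  have h2 : lewisDensity p v i * v i ^ (2 / p) = v i := by
    rw [lewisDensity, ← Real.rpow_add (h.1 i)]
    simp
  exact mul_left_cancel₀ (lewisDensity_pos (p := p) h.1 i).ne' (h1.trans h2.symm)

/-- At Lewis weights the kernel diagonal is `v ^ (2/p) ≤ 1`, so each `(A x)_j²` is at most the Lewis
energy; there are `m` of them. -/
theorem IsLewisWeight.energy_one_le (h : IsLewisWeight A p v) (hA : NonDegenerate A)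
    (hp : 0 < p) (x : Fin n → ℝ) :
    energy A (fun _ => 1) x ≤ m * energy A (lewisDensity p v) x := by
  have h1 : ∀ j, 1 * (A *ᵥ x) j ^ 2 ≤ energy A (lewisDensity p v) x := by
    intro j
    have h2 := hA.mulVec_sq_le (lewisDensity_pos (p := p) h.1) x j
    have h3 : levKernel A (lewisDensity p v) j j ≤ 1 := by
      rw [show levKernel A (lewisDensity p v) j j = _ from h.lewisDiag_eq j]
      exact Real.rpow_le_one (h.1 j).le (h.le_one hA j) (by positivity)
    have h4 := energy_nonneg (A := A) (lewisDensity_pos (p := p) h.1) x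
    nlinarith
  refine (Finset.sum_le_sum fun j _ => h1 j).trans ?_
  simp

/-- Some coordinate carries at least `1/m` of the Lewis energy. There `v_j` cannot be small, and
hence `(A x)_j²` alone is a polynomial fraction of that energy. -/
theorem IsLewisWeight.energy_le (h : IsLewisWeight A p v) (hA : NonDegenerate A)
    (hm : 0 < m) (x : Fin n → ℝ) :
    energy A (lewisDensity p v) x ≤ (m : ℝ) ^ max 1 (2 / p) * energy A (fun _ => 1) x := by
  set E := energy A (lewisDensity p v) x with hE
  set K := max 1 (2 / p) with hK
  have hE0 : 0 ≤ E := energy_nonneg (lewisDensity_pos (p := p) h.1) x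
  have hm' : (0 : ℝ) < m := by exact_mod_cast hm
  have h1 : 0 ≤ energy A (fun _ => 1) x := energy_nonneg (fun _ => one_pos) x
  rcases hE0.eq_or_lt with h0 | h0
  · rw [← h0]; positivity
  have : Nonempty (Fin m) := ⟨⟨0, hm⟩⟩
  obtain ⟨j, -, hj⟩ := Finset.exists_max_image Finset.univ
    (fun j => lewisDensity p v j * (A *ᵥ x) j ^ 2) Finset.univ_nonempty
  have h2 : E ≤ m * (lewisDensity p v j * (A *ᵥ x) j ^ 2) := by
    rw [hE, energy]
    refine (Finset.sum_le_sum fun k hk => hj k hk).trans ?_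
    simp
  have hv := h.1 j
  have hz := hA.mulVec_sq_le (lewisDensity_pos (p := p) h.1) x j
  rw [show levKernel A (lewisDensity p v) j j = _ from h.lewisDiag_eq j] at hz
  have hτ : 0 < v j ^ (2 / p) := Real.rpow_pos_of_pos hv _
  have hd : lewisDensity p v j * v j ^ (2 / p) = v j := by
    rw [← h.lewisDiag_eq j]; exact h.density_mul_diag j
  -- The ratio `y ∈ [0, 1]` measures how sharp the kernel bound is at `j`. The choice of `j` gives
  -- `1 ≤ m v_j y`; raising this to the power `K ≥ 1, 2/p` replaces `v_j` by `v_j ^ (2/p)` and keeps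
  -- one `y`.
  set y := (A *ᵥ x) j ^ 2 / (v j ^ (2 / p) * E) with hy
  have hz' : (A *ᵥ x) j ^ 2 = v j ^ (2 / p) * E * y := by
    rw [hy]; field_simp
  have hy0 : 0 ≤ y := by positivity
  have hy1 : y ≤ 1 := by
    rw [hy, div_le_one (by positivity)]; exact hz
  have h3 : 1 ≤ m * (v j * y) := by
    rw [hz'] at h2
    have : E * 1 ≤ E * (m * (v j * y)) := by
      calc E * 1 = E := mul_one _
        _ ≤ _ := h2
        _ = E * (m * ((lewisDensity p v j * v j ^ (2 / p)) * y)) := by ring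
        _ = _ := by rw [hd]
    exact le_of_mul_le_mul_left this h0
  have hK1 : 1 ≤ K := le_max_left _ _
  have h4 : 1 ≤ (m : ℝ) ^ K * (v j ^ (2 / p) * y) := by
    have h5 : 1 ≤ (m * (v j * y)) ^ K := Real.one_le_rpow h3 (by linarith)
    rw [Real.mul_rpow hm'.le (by positivity), Real.mul_rpow hv.le hy0] at h5
    refine h5.trans (mul_le_mul_of_nonneg_left ?_ (by positivity))
    refine mul_le_mul ?_ ?_ (by positivity) (by positivity)
    · exact Real.rpow_le_rpow_of_exponent_ge hv (h.le_one hA j) (le_max_right _ _)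
    · rcases hy0.eq_or_lt with hh | hh
      · rw [← hh, Real.zero_rpow (by linarith)]
      · simpa using Real.rpow_le_rpow_of_exponent_ge hh hy1 hK1
  have h6 : (A *ᵥ x) j ^ 2 ≤ energy A (fun _ => 1) x := by
    have := Finset.single_le_sum (f := fun j => 1 * (A *ᵥ x) j ^ 2)
      (fun k _ => by positivity) (Finset.mem_univ j)
    simpa [energy] using this
  calc E = E * 1 := (mul_one _).symm
    _ ≤ E * ((m : ℝ) ^ K * (v j ^ (2 / p) * y)) := mul_le_mul_of_nonneg_left h4 hE0
    _ = (m : ℝ) ^ K * (A *ᵥ x) j ^ 2 := by rw [hz']; ring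
    _ ≤ _ := mul_le_mul_of_nonneg_left h6 (by positivity)

/-- The leverage scores of `A` itself determine the Lewis weights up to a polynomial factor. -/
theorem IsLewisWeight.abs_log_lewisDiag_one_sub_le (h : IsLewisWeight A p v)
    (hA : NonDegenerate A) (hp : 0 < p) (hp4 : p < 4) (hm : 0 < m) (i : Fin m) :
    |p / 2 * Real.log (lewisDiag A p (fun _ => 1) i) - Real.log (v i)| ≤ 2 * Real.log m := by
  have hm' : (0 : ℝ) < m := by exact_mod_cast hm
  have hm1 : (1 : ℝ) ≤ m := by exact_mod_cast hm
  have hd1 : lewisDensity p (fun _ : Fin m => (1 : ℝ)) = fun _ => 1 := by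
    funext j; simp [lewisDensity]
  have ht : 0 < levKernel A (fun _ => 1) i i := hA.levKernel_pos (fun _ => one_pos) i
  have ht' := hA.lewisDiag_pos (p := p) h.1 i
  have h1 : Real.log (lewisDiag A p v i)
      ≤ Real.log m + Real.log (levKernel A (fun _ => 1) i i) := by
    rw [← Real.log_mul hm'.ne' ht.ne']
    exact Real.log_le_log ht' (hA.levKernel_le_of_energy_le (fun _ => one_pos)
      (lewisDensity_pos (p := p) h.1) (h.energy_one_le hA hp) i)
  have h2 : Real.log (levKernel A (fun _ => 1) i i)
      ≤ max 1 (2 / p) * Real.log m + Real.log (lewisDiag A p v i) := by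
    rw [← Real.log_rpow hm', ← Real.log_mul (Real.rpow_pos_of_pos hm' _).ne' ht'.ne']
    exact Real.log_le_log ht (hA.levKernel_le_of_energy_le (lewisDensity_pos (p := p) h.1)
      (fun _ => one_pos) (h.energy_le hA hm) i)
  have hl : 0 ≤ Real.log m := Real.log_nonneg hm1
  -- The left side is `max (p/2) 1`, so the logarithmic error is bounded uniformly in `p`.
  have hK : p / 2 * max 1 (2 / p) ≤ 2 := by
    rw [mul_max_of_nonneg _ _ (half_pos hp).le, max_le_iff]
    constructor
    · linarith
    · rw [show p / 2 * (2 / p) = 1 by field_simp]; norm_num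
  rw [(isLewisWeight_iff hA hp h.1).mp h i, ← mul_sub, abs_mul, abs_of_pos (half_pos hp),
    lewisDiag, hd1]
  have h3 : |Real.log (levKernel A (fun _ => 1) i i) - Real.log (lewisDiag A p v i)|
      ≤ max 1 (2 / p) * Real.log m := by
    rw [abs_le]
    constructor
    · nlinarith [le_max_left 1 (2 / p)]
    · linarith
  calc _ ≤ p / 2 * (max 1 (2 / p) * Real.log m) := mul_le_mul_of_nonneg_left h3 (half_pos hp).le
    _ = (p / 2 * max 1 (2 / p)) * Real.log m := by ring
    _ ≤ _ := mul_le_mul_of_nonneg_right hK hl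

theorem IsLewisWeight.logClose_lewisUpdate_one (h : IsLewisWeight A p v)
    (hA : NonDegenerate A) (hp : 0 < p) (hp4 : p < 4) (hm : 0 < m) {δ : ℝ} {s : Fin m → ℝ}
    (hs : ApxLeverage δ (reweight A p fun _ => 1) s) :
    LogClose (2 * Real.log m + p / 2 * δ) (lewisUpdate p (fun _ => 1) s) v := by
  intro i
  have h1 := hs.abs_log_lewisUpdate_sub_le hA hp (fun _ => one_pos) i
  have h2 := h.abs_log_lewisDiag_one_sub_le hA hp hp4 hm i
  have := abs_sub_le (Real.log (lewisUpdate p (fun _ => 1) s i))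
    (p / 2 * Real.log (lewisDiag A p (fun _ => 1) i)) (Real.log (v i))
  linarith

end Lewis

/-! ### Scalar estimates -/

theorem median_eq_max_min {a b c : ℝ} (h : a ≤ c) : median a b c = max a (min b c) := by
  rw [median]
  rcases le_total a b with h1 | h1
  · rw [min_eq_left h1, max_eq_right h1]
  · rw [min_eq_right h1, max_eq_left h1, min_eq_left h, max_eq_right h1,
      min_eq_left (h1.trans h), max_eq_left h1]

theorem median_mem {a b c : ℝ} (h : a ≤ c) : a ≤ median a b c ∧ median a b c ≤ c := by
  rw [median_eq_max_min h]
  exact ⟨le_max_left _ _, max_le h (min_le_right _ _)⟩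

theorem median_eq_self {a b c : ℝ} (h1 : a ≤ b) (h2 : b ≤ c) : median a b c = b := by
  rw [median_eq_max_min (h1.trans h2), min_eq_left h2, max_eq_right h1]

theorem abs_median_sub_median_le {a c : ℝ} (h : a ≤ c) (x y : ℝ) :
    |median a x c - median a y c| ≤ |x - y| := by
  rw [median_eq_max_min h, median_eq_max_min h]
  refine (abs_max_sub_max_le_max _ _ _ _).trans ?_
  rw [sub_self, abs_zero, max_eq_right (abs_nonneg _)]
  refine (abs_min_sub_min_le_max _ _ _ _).trans ?_
  rw [sub_self, abs_zero, max_eq_left (abs_nonneg _)]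

/-- The logarithmic mean lies between its arguments. -/
theorem exists_sub_eq_mul_log_sub {a b x y : ℝ} (ha : 0 < a) (hxa : a ≤ x) (hxb : x ≤ b)
    (hya : a ≤ y) (hyb : y ≤ b) :
    ∃ θ, a ≤ θ ∧ θ ≤ b ∧ x - y = θ * (Real.log x - Real.log y) := by
  wlog hxy : y ≤ x generalizing x y
  · obtain ⟨θ, h1, h2, h3⟩ := this hya hyb hxa hxb (le_of_not_ge hxy)
    exact ⟨θ, h1, h2, by linarith⟩
  rcases hxy.eq_or_lt with rfl | hlt
  · exact ⟨a, le_rfl, hxa.trans hxb, by simp⟩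
  have hx : 0 < x := ha.trans_le hxa
  have hy : 0 < y := ha.trans_le hya
  have hl : 0 < Real.log x - Real.log y := sub_pos.mpr (Real.log_lt_log hy hlt)
  have h1 : Real.log x - Real.log y ≤ (x - y) / y := by
    rw [← Real.log_div hx.ne' hy.ne']
    refine (Real.log_le_sub_one_of_pos (div_pos hx hy)).trans (le_of_eq ?_)
    field_simp
  have h2 : (x - y) / x ≤ Real.log x - Real.log y := by
    have := Real.log_le_sub_one_of_pos (div_pos hy hx)
    rw [Real.log_div hy.ne' hx.ne'] at this
    have h3 : (x - y) / x = 1 - y / x := by field_simp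
    linarith
  rw [le_div_iff₀ hy] at h1
  rw [div_le_iff₀ hx] at h2
  refine ⟨(x - y) / (Real.log x - Real.log y), ?_, ?_, by field_simp⟩
  · rw [le_div_iff₀ hl]
    nlinarith
  · rw [div_le_iff₀ hl]
    nlinarith

theorem abs_log_sub_log_le {a x y : ℝ} (ha : 0 < a) (hx : a ≤ x) (hy : a ≤ y) :
    |Real.log x - Real.log y| ≤ |x - y| / a := by
  obtain ⟨θ, h1, -, h3⟩ := exists_sub_eq_mul_log_sub ha hx (le_max_left x y) hy (le_max_right x y)
  rw [h3, abs_mul, abs_of_pos (ha.trans_le h1), le_div_iff₀ ha, mul_comm]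
  exact mul_le_mul_of_nonneg_right h1 (abs_nonneg _)

/-- Expand `exp (c log (1 + x))`: the remainder of the exponential is at most `(25/16) x²` and that
of the logarithm at most `(10/9) x²`. -/
theorem abs_one_add_rpow_sub_le {x c : ℝ} (hx : |x| ≤ 1 / 10) (hc : |c| ≤ 1) :
    |(1 + x) ^ c - 1 - c * x| ≤ 3 * x ^ 2 := by
  have hx' := abs_le.mp hx
  have h1 : 0 < 1 + x := by linarith
  have hl1 : Real.log (1 + x) ≤ x := by
    have := Real.log_le_sub_one_of_pos h1; linarith
  have hl2 : x - 10 / 9 * x ^ 2 ≤ Real.log (1 + x) := by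
    have h2 := Real.log_le_sub_one_of_pos (inv_pos.mpr h1)
    rw [Real.log_inv] at h2
    have h3 : (1 + x)⁻¹ - 1 ≤ -(x - 10 / 9 * x ^ 2) := by
      rw [sub_le_iff_le_add, inv_le_iff_one_le_mul₀ h1]
      nlinarith [sq_nonneg x, mul_nonneg (sq_nonneg x) (by linarith : 0 ≤ x + 1 / 10)]
    linarith
  have hc2 : c ^ 2 ≤ 1 := by
    rw [← sq_abs]; exact pow_le_one₀ (abs_nonneg _) hc
  have hl3 : |Real.log (1 + x) - x| ≤ 10 / 9 * x ^ 2 := by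
    rw [abs_le]
    constructor <;> nlinarith [sq_nonneg x]
  have hl4 : Real.log (1 + x) ^ 2 ≤ 25 / 16 * x ^ 2 := by
    have : |Real.log (1 + x)| ≤ 5 / 4 * |x| := by
      have h5 : |Real.log (1 + x)| ≤ |Real.log (1 + x) - x| + |x| := by
        have := abs_add_le (Real.log (1 + x) - x) x
        simpa using this
      have h6 : x ^ 2 ≤ 1 / 10 * |x| := by
        rw [← sq_abs, sq]; exact mul_le_mul_of_nonneg_right hx (abs_nonneg _)
      linarith [abs_nonneg x]
    have := pow_le_pow_left₀ (abs_nonneg _) this 2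
    rw [mul_pow, sq_abs, sq_abs] at this
    linarith
  rw [Real.rpow_def_of_pos h1]
  set l := Real.log (1 + x)
  have h7 : |l * c| ≤ 1 := by
    refine abs_le_one_iff_mul_self_le_one.mpr ?_
    nlinarith [sq_nonneg x, sq_nonneg l, mul_nonneg (sq_nonneg l) (sub_nonneg.mpr hc2)]
  have h8 := Real.abs_exp_sub_one_sub_id_le h7
  have h9 : (l * c) ^ 2 ≤ 25 / 16 * x ^ 2 := by
    rw [mul_pow]
    nlinarith [sq_nonneg l]
  have h10 : |c * (l - x)| ≤ 10 / 9 * x ^ 2 := by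
    rw [abs_mul]
    nlinarith [abs_nonneg c, abs_nonneg (l - x)]
  have : Real.exp (l * c) - 1 - c * x = (Real.exp (l * c) - 1 - l * c) + c * (l - x) := by ring
  rw [this]
  refine (abs_add_le _ _).trans ?_
  nlinarith [sq_nonneg x]

theorem mul_four_sub_le (p : ℝ) : p * (4 - p) ≤ 4 := by nlinarith [sq_nonneg (p - 2)]

theorem apxRadius_pos {p : ℝ} (hp : 0 < p) (hp4 : p < 4) : 0 < apxRadius p := by
  rw [apxRadius]
  have : 0 < 4 - p := by linarith
  positivity

theorem apxRadius_le_mul {p : ℝ} (hp : 0 < p) : apxRadius p ≤ p / 2 ^ 18 := by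
  rw [apxRadius, div_le_div_iff₀ (by positivity) (by positivity)]
  nlinarith [mul_le_mul_of_nonneg_left (mul_four_sub_le p) hp.le]

theorem apxRadius_le {p : ℝ} (hp : 0 < p) (hp4 : p < 4) : apxRadius p ≤ 1 / 2 ^ 16 := by
  refine (apxRadius_le_mul hp).trans ?_
  rw [div_le_div_iff₀ (by positivity) (by positivity)]
  linarith

/-- The contraction coefficient `2/p - |1 - 2/p|` of the iteration in the maximum norm. -/
noncomputable def supRate (p : ℝ) : ℝ := 2 / p - |1 - 2 / p|

theorem supRate_of_le_two {p : ℝ} (hp : 0 < p) (h : p ≤ 2) : supRate p = 1 := by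
  have : 1 ≤ 2 / p := by rw [le_div_iff₀ hp]; linarith
  rw [supRate, abs_of_nonpos (by linarith)]
  ring

theorem supRate_of_two_le {p : ℝ} (hp : 0 < p) (h : 2 ≤ p) : supRate p = (4 - p) / p := by
  have : 2 / p ≤ 1 := by rw [div_le_iff₀ hp]; linarith
  rw [supRate, abs_of_nonneg (by linarith)]
  field_simp
  ring

theorem supRate_ge {p : ℝ} (hp : 0 < p) (hp4 : p < 4) : (4 - p) / 4 ≤ supRate p := by
  rcases le_total p 2 with h | h
  · rw [supRate_of_le_two hp h]; linarith
  · rw [supRate_of_two_le hp h]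
    exact div_le_div_of_nonneg_left (by linarith) hp hp4.le

theorem supRate_pos {p : ℝ} (hp : 0 < p) (hp4 : p < 4) : 0 < supRate p :=
  lt_of_lt_of_le (by linarith) (supRate_ge hp hp4)

/-- This dictates the shape of the radius. Inside the box the coefficients `2/p` and `|1 - 2/p|` are
perturbed by relative errors of order `r`, and the total must stay a small fraction of the rate: for
`p ≤ 2` this needs `r` of order `p`, for `p ≥ 2` of order `4 - p`. -/
theorem apxRadius_mul_le_supRate {p : ℝ} (hp : 0 < p) (hp4 : p < 4) :
    2 * apxRadius p * (2 / p + |1 - 2 / p|) ≤ supRate p / 20 := by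
  rcases le_total p 2 with h | h
  · have h1 : 1 ≤ 2 / p := by rw [le_div_iff₀ hp]; linarith
    rw [supRate_of_le_two hp h, abs_of_nonpos (by linarith)]
    have h2 := apxRadius_le_mul hp
    have h3 : 2 / p + -(1 - 2 / p) ≤ 4 / p := by
      have : 4 / p = 2 / p + 2 / p := by ring
      linarith
    calc _ ≤ 2 * (p / 2 ^ 18) * (4 / p) := by
          have := apxRadius_pos hp hp4
          gcongr
          linarith
      _ ≤ _ := by field_simp; norm_num
  · have h1 : 2 / p ≤ 1 := by rw [div_le_iff₀ hp]; linarith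
    rw [supRate_of_two_le hp h, abs_of_nonneg (by linarith), apxRadius,
      show 2 / p + (1 - 2 / p) = 1 by ring, div_div, le_div_iff₀ (by positivity)]
    have h4 : p ^ 3 ≤ 4 ^ 3 := pow_le_pow_left₀ hp.le hp4.le 3
    have : 2 * (p ^ 2 * (4 - p) / 2 ^ 20) * 1 * (p * 20) = (4 - p) * (40 * p ^ 3 / 2 ^ 20) := by
      ring
    rw [this]
    have h5 : 40 * p ^ 3 / 2 ^ 20 ≤ 1 := by rw [div_le_one (by positivity)]; linarith
    nlinarith

/-! ### Convergence of the projected gradient iteration -/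

section Convergence

variable {m n : ℕ} {A : Matrix (Fin m) (Fin n) ℝ} {p : ℝ} {w₀ w u v : Fin m → ℝ}

/-- The coordinates of `w` lie within a factor `1 ± r` of those of `w₀`. -/
def InBox (r : ℝ) (w₀ w : Fin m → ℝ) : Prop :=
  ∀ i, (1 - r) * w₀ i ≤ w i ∧ w i ≤ (1 + r) * w₀ i

/-- The gradient step before projection. -/
noncomputable def gradStep (p : ℝ) (w₀ w s : Fin m → ℝ) : Fin m → ℝ :=
  fun i => w i - 1 / max 4 (8 / p) * (w₀ i - w₀ i / w i * s i)

/-- The projected gradient step. -/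
noncomputable def apxUpdate (p : ℝ) (w₀ w s : Fin m → ℝ) : Fin m → ℝ :=
  fun i => median ((1 - apxRadius p) * w₀ i) (gradStep p w₀ w s i) ((1 + apxRadius p) * w₀ i)

theorem InBox.pos {r : ℝ} (h : InBox r w₀ w) (hr : r < 1) (hw₀ : ∀ i, 0 < w₀ i) (i : Fin m) :
    0 < w i :=
  lt_of_lt_of_le (mul_pos (by linarith) (hw₀ i)) (h i).1

theorem inBox_self {r : ℝ} (hr : 0 ≤ r) (hw₀ : ∀ i, 0 < w₀ i) : InBox r w₀ w₀ := fun i => by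
  have := mul_nonneg hr (hw₀ i).le
  constructor <;> linarith

theorem inBox_apxUpdate (hp : 0 < p) (hp4 : p < 4) (hw₀ : ∀ i, 0 < w₀ i) (s : Fin m → ℝ) :
    InBox (apxRadius p) w₀ (apxUpdate p w₀ w s) := fun i =>
  median_mem (by have := mul_pos (apxRadius_pos hp hp4) (hw₀ i); linarith)

/-- Clipping to an interval is nonexpansive in each coordinate, so contraction need only be proved
for the unprojected step. -/
theorem abs_apxUpdate_sub_le (hp : 0 < p) (hp4 : p < 4) (hw₀ : ∀ i, 0 < w₀ i)
    (s t : Fin m → ℝ) (i : Fin m) :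
    |apxUpdate p w₀ w s i - apxUpdate p w₀ u t i| ≤ |gradStep p w₀ w s i - gradStep p w₀ u t i| :=
  abs_median_sub_median_le
    (by have := mul_pos (apxRadius_pos hp hp4) (hw₀ i); linarith) _ _

theorem IsLewisWeight.gradStep_eq (h : IsLewisWeight A p v) :
    gradStep p w₀ v (leverageScores (reweight A p v)) = v := by
  funext i
  rw [gradStep, ← h.2, div_mul_cancel₀ _ (h.1 i).ne']
  ring

theorem IsLewisWeight.apxUpdate_eq (h : IsLewisWeight A p v) (hv : InBox (apxRadius p) w₀ v) :
    apxUpdate p w₀ v (leverageScores (reweight A p v)) = v := by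
  funext i
  rw [apxUpdate, h.gradStep_eq]
  exact median_eq_self (hv i).1 (hv i).2

theorem InBox.logClose {r : ℝ} (hr0 : 0 ≤ r) (hr : r ≤ 1 / 10) (hw₀ : ∀ i, 0 < w₀ i)
    (hw : InBox r w₀ w) (hu : InBox r w₀ u) : LogClose (3 * r) w u := by
  intro i
  refine (abs_log_sub_log_le (mul_pos (by linarith) (hw₀ i)) (hw i).1 (hu i).1).trans ?_
  rw [div_le_iff₀ (mul_pos (by linarith) (hw₀ i)), abs_le]
  have h1 := hw i
  have h2 := hu i
  have h3 : 2 * r * w₀ i ≤ 3 * r * ((1 - r) * w₀ i) := by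
    rw [← mul_assoc]
    exact mul_le_mul_of_nonneg_right (by nlinarith) (hw₀ i).le
  constructor <;> linarith

theorem InBox.logClose_of_abs_sub_le {r Δ : ℝ} (hr : r ≤ 1 / 100)
    (hw₀ : ∀ i, 0 < w₀ i)
    (hw : InBox r w₀ w) (hu : InBox r w₀ u) (h : ∀ i, |w i - u i| ≤ Δ * w₀ i) :
    LogClose (Δ / (1 - r)) w u := by
  intro i
  have hi := hw₀ i
  have h1 : 0 < 1 - r := by linarith
  refine (abs_log_sub_log_le (mul_pos h1 hi) (hw i).1 (hu i).1).trans ?_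
  rw [div_le_div_iff₀ (mul_pos h1 hi) h1]
  nlinarith [h i]

/-- The gradient depends on the leverage scores only through this ratio, which is `1` at the Lewis
weights. -/
theorem NonDegenerate.log_leverage_div (hA : NonDegenerate A) (hw : ∀ i, 0 < w i) (i : Fin m) :
    Real.log (leverageScores (reweight A p w) i / w i)
      = Real.log (lewisDiag A p w i) - 2 / p * Real.log (w i) := by
  rw [leverageScores_reweight hw, Real.log_div
    (mul_pos (lewisDensity_pos hw i) (hA.lewisDiag_pos hw i)).ne' (hw i).ne',
    Real.log_mul (lewisDensity_pos hw i).ne' (hA.lewisDiag_pos hw i).ne', lewisDensity,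
    Real.log_rpow (hw i)]
  ring

/-- Near the Lewis weights, the leverage scores are close to the weights. -/
theorem IsLewisWeight.leverage_div_mem (h : IsLewisWeight A p v) (hA : NonDegenerate A)
    (hp : 0 < p) (hp4 : p < 4) (hw₀ : ∀ i, 0 < w₀ i) (hv : InBox (apxRadius p) w₀ v)
    (hw : InBox (apxRadius p) w₀ w) (i : Fin m) :
    99 / 100 ≤ leverageScores (reweight A p w) i / w i ∧
      leverageScores (reweight A p w) i / w i ≤ 101 / 100 := by
  have hr := apxRadius_le hp hp4
  have hr0 := apxRadius_pos hp hp4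
  have hwp := hw.pos (lt_of_le_of_lt hr (by norm_num)) hw₀
  have hlc := InBox.logClose hr0.le (hr.trans (by norm_num)) hw₀ hw hv
  have h1 := hA.abs_log_lewisDiag_sub_le (p := p) hwp h.1 hlc i
  have h2 := hA.log_leverage_div (p := p) hwp i
  have h3 : Real.log (lewisDiag A p v i) = 2 / p * Real.log (v i) := by
    rw [h.lewisDiag_eq, Real.log_rpow (h.1 i)]
  have hpos : 0 < leverageScores (reweight A p w) i / w i :=
    div_pos (hA.leverageScores_reweight_pos hwp i) (hwp i)
  set g := leverageScores (reweight A p w) i / w i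
  have hg : |Real.log g| ≤ 1 / 200 := by
    have h4 : Real.log g = (Real.log (lewisDiag A p w i) - Real.log (lewisDiag A p v i))
        - 2 / p * (Real.log (w i) - Real.log (v i)) := by rw [h2, h3]; ring
    rw [h4]
    refine (abs_sub _ _).trans ?_
    rw [abs_mul, abs_of_pos (show 0 < 2 / p by positivity)]
    have h5 := mul_le_mul_of_nonneg_left (hlc i) (show 0 ≤ 2 / p by positivity)
    have h6 : |1 - 2 / p| ≤ 1 + 2 / p := by
      refine (abs_sub _ _).trans ?_
      rw [abs_one, abs_of_pos (show 0 < 2 / p by positivity)]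
    have h7 := mul_le_mul_of_nonneg_right h6 (show 0 ≤ 3 * apxRadius p by positivity)
    have h8 : (1 + 2 / p) * (3 * apxRadius p) + 2 / p * (3 * apxRadius p)
        = 3 * apxRadius p + 12 * (apxRadius p / p) := by field_simp; ring
    have h9 : apxRadius p / p ≤ 1 / 2 ^ 18 := by
      rw [div_le_iff₀ hp]; linarith [apxRadius_le_mul hp]
    calc _ ≤ 3 * apxRadius p + 12 * (apxRadius p / p) := by linarith
      _ ≤ 3 * (1 / 2 ^ 16) + 12 * (1 / 2 ^ 18) := by linarith
      _ ≤ _ := by norm_num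
  have h10 := Real.abs_exp_sub_one_sub_id_le (hg.trans (by norm_num))
  rw [Real.exp_log hpos] at h10
  have h11 : Real.log g ^ 2 ≤ 1 / 200 := by
    rw [← sq_abs]; nlinarith [abs_nonneg (Real.log g)]
  have h12 := abs_le.mp h10
  have h13 := abs_le.mp hg
  constructor <;> nlinarith [sq_abs (Real.log g), abs_nonneg (Real.log g)]

theorem four_le_step (p : ℝ) : 4 ≤ max 4 (8 / p) := le_max_left _ _

theorem two_div_le_step (p : ℝ) : 4 * (2 / p) ≤ max 4 (8 / p) := by
  refine le_trans (le_of_eq ?_) (le_max_right _ _)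
  ring

theorem ApxLeverage.abs_sub_le {δ : ℝ} {s : Fin m → ℝ} (hδ : 0 ≤ δ) (hδ' : δ ≤ 1 / 64)
    (hs : ApxLeverage δ (reweight A p w) s) (hA : NonDegenerate A) (hw : ∀ i, 0 < w i)
    (i : Fin m) :
    |s i - leverageScores (reweight A p w) i|
      ≤ 65 / 64 * δ * leverageScores (reweight A p w) i := by
  have h0 := hA.leverageScores_reweight_pos (p := p) hw i
  obtain ⟨h1, h2⟩ := hs i
  have h3 := abs_le.mp (Real.abs_exp_sub_one_sub_id_le (x := δ) (by rw [abs_of_nonneg hδ]; linarith))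
  have h4 := Real.add_one_le_exp (-δ)
  rw [abs_le]
  constructor
  · nlinarith [mul_nonneg hδ h0.le]
  · have : Real.exp δ ≤ 1 + 65 / 64 * δ := by nlinarith
    nlinarith

/-- With all coefficients exact the right side would be `supRate p`. The box costs at most a
twentieth of it, and the factor `θ` another hundredth; `0.99 * 0.95` still exceeds `9/10`. -/
theorem supRate_le_of_perturbation (hp : 0 < p) (hp4 : p < 4) {a θ : ℝ}
    (ha : 1 - apxRadius p ≤ a) (hθ : 99 / 100 ≤ θ) :
    9 / 10 * supRate p ≤ θ * (2 / p * a - |1 - 2 / p| * (1 / (1 - apxRadius p))) := by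
  have hr := apxRadius_le hp hp4
  have hr0 := apxRadius_pos hp hp4
  have h5 : 1 / (1 - apxRadius p) ≤ 1 + 2 * apxRadius p := by
    rw [div_le_iff₀ (by linarith)]; nlinarith
  have h6 := apxRadius_mul_le_supRate hp hp4
  have h2p : 0 < 2 / p := by positivity
  have h7 : 19 / 20 * supRate p ≤ 2 / p * a - |1 - 2 / p| * (1 / (1 - apxRadius p)) := by
    have a1 := mul_le_mul_of_nonneg_left ha h2p.le
    have a2 := mul_le_mul_of_nonneg_left h5 (abs_nonneg (1 - 2 / p))
    have a3 : supRate p = 2 / p - |1 - 2 / p| := rfl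
    have a4 : 0 ≤ apxRadius p * (2 / p) := by positivity
    linarith
  have h8 := supRate_pos hp hp4
  have h9 := mul_le_mul hθ h7 (by linarith) (by linarith)
  linarith

/-- One step with approximate leverage scores against one step with exact ones: contraction in
the maximum norm relative to `w₀`, up to the error of the leverage scores. -/
theorem IsLewisWeight.abs_gradStep_sub_le (h : IsLewisWeight A p v) (hA : NonDegenerate A)
    (hp : 0 < p) (hp4 : p < 4) (hw₀ : ∀ i, 0 < w₀ i) (hv : InBox (apxRadius p) w₀ v)
    (hw : InBox (apxRadius p) w₀ w) (hu : InBox (apxRadius p) w₀ u) {δ Δ : ℝ} (hδ : 0 ≤ δ)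
    (hδ' : δ ≤ 1 / 64) {s : Fin m → ℝ} (hs : ApxLeverage δ (reweight A p w) s)
    (hΔ : 0 ≤ Δ) (hwu : ∀ i, |w i - u i| ≤ Δ * w₀ i) (i : Fin m) :
    |gradStep p w₀ w s i - gradStep p w₀ u (leverageScores (reweight A p u)) i|
      ≤ (Δ * (1 - 9 / 10 * supRate p / max 4 (8 / p)) + 11 / 10 * δ / max 4 (8 / p)) * w₀ i := by
  have hr := apxRadius_le hp hp4
  have hr0 := apxRadius_pos hp hp4
  have hwp := hw.pos (lt_of_le_of_lt hr (by norm_num)) hw₀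
  have hup := hu.pos (lt_of_le_of_lt hr (by norm_num)) hw₀
  have hgw := h.leverage_div_mem hA hp hp4 hw₀ hv hw i
  have hgu := h.leverage_div_mem hA hp hp4 hw₀ hv hu i
  have hlc := InBox.logClose_of_abs_sub_le (hr.trans (by norm_num)) hw₀ hw hu hwu
  have hE := hA.abs_log_lewisDiag_sub_le (p := p) hwp hup hlc i
  have hlw := hA.log_leverage_div (p := p) hwp i
  have hlu := hA.log_leverage_div (p := p) hup i
  have hσ := hA.leverageScores_reweight_pos (p := p) hwp i
  have hs' := hs.abs_sub_le hδ hδ' hA hwp i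
  set L := max 4 (8 / p) with hL
  have hL4 : 4 ≤ L := four_le_step p
  have hLp : 4 * (2 / p) ≤ L := two_div_le_step p
  set σw := leverageScores (reweight A p w) i
  set σu := leverageScores (reweight A p u) i
  set r := apxRadius p
  -- Two logarithmic means replace derivatives: `θ ≈ 1` converts differences of `σ/w` into
  -- differences of logarithms, and `k ≈ w₀ i` does the same for the weights. The step difference
  -- becomes exactly affine in `x` and `E`.
  obtain ⟨θ, hθ1, hθ2, hθ⟩ := exists_sub_eq_mul_log_sub (by norm_num) hgw.1 hgw.2 hgu.1 hgu.2
  have hi := hw₀ i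
  obtain ⟨k, hk1, hk2, hk⟩ := exists_sub_eq_mul_log_sub (mul_pos (by linarith) hi)
    (hw i).1 (hw i).2 (hu i).1 (hu i).2
  have hk0 : 0 < k := lt_of_lt_of_le (mul_pos (by linarith) hi) hk1
  set ℓ := Real.log (w i) - Real.log (u i) with hℓ
  set E := Real.log (lewisDiag A p w i) - Real.log (lewisDiag A p u i) with hEdef
  -- the relative displacement
  set x := (w i - u i) / w₀ i with hx
  have hxΔ : |x| ≤ Δ := by
    rw [hx, abs_div, abs_of_pos hi, div_le_iff₀ hi]; exact hwu i
  set hh := w₀ i / k with hhh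
  have hℓx : ℓ = hh * x := by
    rw [hhh, hx, hk]; field_simp
  have hh1 : 1 - r ≤ hh := by
    rw [hhh, le_div_iff₀ hk0]
    nlinarith [mul_nonneg (sq_nonneg r) hi.le]
  have hh2 : hh ≤ 101 / 100 := by
    rw [hhh, div_le_iff₀ hk0]; nlinarith
  have hdiff : σw / w i - σu / u i = θ * (E - 2 / p * (hh * x)) := by
    rw [hθ, hlw, hlu, ← hℓx, hEdef, hℓ]; ring
  have hmain : gradStep p w₀ w s i - gradStep p w₀ u (leverageScores (reweight A p u)) i
      = w₀ i * (x * (1 - 2 / p * θ * hh / L) + θ * E / L + (s i - σw) / w i / L) := by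
    have e1 : gradStep p w₀ w s i - gradStep p w₀ u (leverageScores (reweight A p u)) i
        = w₀ i * (x + 1 / L * (σw / w i - σu / u i) + (s i - σw) / w i / L) := by
      simp only [gradStep, hx]
      have := (hwp i).ne'
      have := (hup i).ne'
      field_simp
      ring
    rw [e1, hdiff]; ring
  have hL0 : 0 < L := by linarith
  -- Here `L ≥ 4 (2/p)` matters: with a nonnegative coefficient of `x`, the gain `2/p` and the loss
  -- `|1 - 2/p|` combine to the rate `κ` after absolute values are taken.
  have hcoef : 0 ≤ 1 - 2 / p * θ * hh / L := by
    rw [sub_nonneg, div_le_one hL0]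
    have h2p : 0 < 2 / p := by positivity
    have h1 : θ * hh ≤ 101 / 100 * (101 / 100) :=
      mul_le_mul hθ2 hh2 (by linarith) (by norm_num)
    have h2 := mul_le_mul_of_nonneg_left h1 h2p.le
    rw [mul_assoc]
    linarith
  have hnoise : |(s i - σw) / w i / L| ≤ 11 / 10 * δ / L := by
    rw [abs_div, abs_div, abs_of_pos hL0, abs_of_pos (hwp i)]
    refine div_le_div_of_nonneg_right ?_ hL0.le
    calc _ ≤ 65 / 64 * δ * σw / w i := div_le_div_of_nonneg_right hs' (hwp i).le
      _ = 65 / 64 * δ * (σw / w i) := by ring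
      _ ≤ 65 / 64 * δ * (101 / 100) := mul_le_mul_of_nonneg_left hgw.2 (by positivity)
      _ ≤ _ := by linarith
  rw [hmain, abs_mul, abs_of_pos hi, mul_comm]
  refine mul_le_mul_of_nonneg_right ?_ hi.le
  have hθ0 : 0 < θ := by linarith
  have hEL : |θ * E / L| ≤ θ * (|1 - 2 / p| * (Δ / (1 - r))) / L := by
    rw [abs_div, abs_of_pos hL0, abs_mul, abs_of_pos hθ0]
    exact div_le_div_of_nonneg_right (mul_le_mul_of_nonneg_left hE hθ0.le) hL0.le
  have hxc : |x * (1 - 2 / p * θ * hh / L)| ≤ Δ * (1 - 2 / p * θ * hh / L) := by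
    rw [abs_mul, abs_of_nonneg hcoef]
    exact mul_le_mul_of_nonneg_right hxΔ hcoef
  have hsum : Δ * (1 - 2 / p * θ * hh / L) + θ * (|1 - 2 / p| * (Δ / (1 - r))) / L
      ≤ Δ * (1 - 9 / 10 * supRate p / L) := by
    have e2 : Δ * (1 - 2 / p * θ * hh / L) + θ * (|1 - 2 / p| * (Δ / (1 - r))) / L
        = Δ * (1 - θ * (2 / p * hh - |1 - 2 / p| * (1 / (1 - r))) / L) := by
      ring
    rw [e2]
    refine mul_le_mul_of_nonneg_left (sub_le_sub_left (div_le_div_of_nonneg_right ?_ hL0.le) _) hΔ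
    exact supRate_le_of_perturbation hp hp4 hh1 hθ1
  calc _ ≤ |x * (1 - 2 / p * θ * hh / L)| + |θ * E / L| + |(s i - σw) / w i / L| :=
        abs_add_three _ _ _
    _ ≤ _ := by linarith

end Convergence

/-! ### Contraction in the weighted Euclidean norm for `2 ≤ p < 4`. -/

section EnergyNorm

variable {m n : ℕ} {A : Matrix (Fin m) (Fin n) ℝ} {p : ℝ} {w₀ w u v d : Fin m → ℝ}

/-- The averaging operator with the row-stochastic matrix `d_j G_ij² / G_ii`, where `G` is the
kernel. -/
noncomputable def levAverage (A : Matrix (Fin m) (Fin n) ℝ) (d f : Fin m → ℝ) : Fin m → ℝ :=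
  fun i => ∑ j, d j * levKernel A d i j ^ 2 / levKernel A d i i * f j

theorem NonDegenerate.sum_average_weights (hA : NonDegenerate A) (hd : ∀ i, 0 < d i)
    (i : Fin m) : ∑ j, d j * levKernel A d i j ^ 2 / levKernel A d i i = 1 := by
  rw [← Finset.sum_div, hA.sum_levKernel_sq hd i, div_self (hA.levKernel_pos hd i).ne']

theorem NonDegenerate.average_weight_nonneg (hA : NonDegenerate A) (hd : ∀ i, 0 < d i)
    (i j : Fin m) : 0 ≤ d j * levKernel A d i j ^ 2 / levKernel A d i i :=
  div_nonneg (mul_nonneg (hd j).le (sq_nonneg _)) (hA.levKernel_pos hd i).le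

theorem NonDegenerate.levAverage_mono (hA : NonDegenerate A) (hd : ∀ i, 0 < d i)
    {f g : Fin m → ℝ} (h : ∀ j, f j ≤ g j) (i : Fin m) : levAverage A d f i ≤ levAverage A d g i :=
  Finset.sum_le_sum fun j _ =>
    mul_le_mul_of_nonneg_left (h j) (hA.average_weight_nonneg hd i j)

theorem NonDegenerate.abs_levAverage_le (hA : NonDegenerate A) (hd : ∀ i, 0 < d i)
    (f : Fin m → ℝ) (i : Fin m) : |levAverage A d f i| ≤ levAverage A d (fun j => |f j|) i := by
  refine (Finset.abs_sum_le_sum_abs _ _).trans (le_of_eq ?_)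
  refine Finset.sum_congr rfl fun j _ => ?_
  rw [abs_mul, abs_of_nonneg (hA.average_weight_nonneg hd i j)]

theorem levAverage_mul (c : ℝ) (f : Fin m → ℝ) (i : Fin m) :
    levAverage A d (fun j => c * f j) i = c * levAverage A d f i := by
  rw [levAverage, levAverage, Finset.mul_sum]
  exact Finset.sum_congr rfl fun j _ => by ring

theorem levAverage_sub (f g : Fin m → ℝ) (i : Fin m) :
    levAverage A d (fun j => f j - g j) i = levAverage A d f i - levAverage A d g i := by
  simp only [levAverage, ← Finset.sum_sub_distrib, mul_sub]

theorem NonDegenerate.mul_levAverage (hA : NonDegenerate A) (hd : ∀ i, 0 < d i)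
    (f : Fin m → ℝ) (i : Fin m) :
    d i * levKernel A d i i * levAverage A d f i = ∑ j, d i * d j * levKernel A d i j ^ 2 * f j := by
  rw [levAverage, Finset.mul_sum]
  refine Finset.sum_congr rfl fun j _ => ?_
  have := (hA.levKernel_pos hd i).ne'
  field_simp

/-- Jensen for the row-stochastic weights, followed by stationarity: `d_i d_j G_ij²` is symmetric,
and its column sums are again `d_j G_jj`. -/
theorem NonDegenerate.sum_levAverage_sq_le (hA : NonDegenerate A) (hd : ∀ i, 0 < d i)
    (f : Fin m → ℝ) :
    ∑ i, d i * levKernel A d i i * levAverage A d f i ^ 2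
      ≤ ∑ i, d i * levKernel A d i i * f i ^ 2 := by
  have h1 : ∀ i, levAverage A d f i ^ 2 ≤ levAverage A d (fun j => f j ^ 2) i := by
    intro i
    have h := Finset.sum_mul_sq_le_sq_mul_sq Finset.univ
      (fun j => Real.sqrt (d j * levKernel A d i j ^ 2 / levKernel A d i i))
      (fun j => Real.sqrt (d j * levKernel A d i j ^ 2 / levKernel A d i i) * f j)
    simp only [mul_pow, Real.sq_sqrt (hA.average_weight_nonneg hd i _), ← mul_assoc,
      Real.mul_self_sqrt (hA.average_weight_nonneg hd i _), hA.sum_average_weights hd,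
      one_mul] at h
    exact h
  calc _ ≤ ∑ i, d i * levKernel A d i i * levAverage A d (fun j => f j ^ 2) i :=
        Finset.sum_le_sum fun i _ => mul_le_mul_of_nonneg_left (h1 i)
          (mul_nonneg (hd i).le (hA.levKernel_pos hd i).le)
    _ = ∑ i, ∑ j, d i * d j * levKernel A d i j ^ 2 * f j ^ 2 := by
        simp only [hA.mul_levAverage hd]
    _ = ∑ j, ∑ i, d i * d j * levKernel A d i j ^ 2 * f j ^ 2 := Finset.sum_comm
    _ = _ := by
        refine Finset.sum_congr rfl fun j _ => ?_
        rw [← hA.sum_levKernel_sq hd j, Finset.mul_sum, Finset.sum_mul]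
        refine Finset.sum_congr rfl fun i _ => ?_
        rw [levKernel_symm A d i j]; ring

/-- The form is that of the Hadamard square of the kernel, evaluated at `d f`. Its sign allows the
cross term in the contraction estimate to be dropped. -/
theorem NonDegenerate.sum_mul_levAverage_nonneg (hA : NonDegenerate A) (hd : ∀ i, 0 < d i)
    (f : Fin m → ℝ) : 0 ≤ ∑ i, d i * levKernel A d i i * (f i * levAverage A d f i) := by
  have h := hA.sum_levKernel_sq_mul_nonneg hd (fun i => d i * f i)
  refine h.trans (le_of_eq ?_)
  refine Finset.sum_congr rfl fun i _ => ?_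
  rw [show d i * levKernel A d i i * (f i * levAverage A d f i)
    = f i * (d i * levKernel A d i i * levAverage A d f i) by ring, hA.mul_levAverage hd,
    Finset.mul_sum]
  exact Finset.sum_congr rfl fun j _ => by ring

/-- Second-order expansion of the diagonal of the kernel. -/
theorem NonDegenerate.abs_levKernel_div_sub_le (hA : NonDegenerate A) (hd : ∀ i, 0 < d i)
    {e : Fin m → ℝ} (he : ∀ j, |e j| ≤ 1 / 10) (i : Fin m) :
    |levKernel A (fun j => d j * (1 + e j)) i i / levKernel A d i i - 1 + levAverage A d e i|
      ≤ 10 / 9 * levAverage A d (fun j => e j ^ 2) i := by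
  have he' : ∀ j, 9 / 10 ≤ 1 + e j := fun j => by
    have := (abs_le.mp (he j)).1; linarith
  have hd' : ∀ j, 0 < d j * (1 + e j) := fun j => mul_pos (hd j) (by linarith [he' j])
  have h1 := hA.levKernel_sub_le hd hd' i
  have h2 := hA.levKernel_le_sub_add hd hd' i
  have hτ := hA.levKernel_pos hd i
  have h3 : ∑ j, (d j * (1 + e j) - d j) * levKernel A d i j ^ 2
      = levKernel A d i i * levAverage A d e i := by
    rw [levAverage, Finset.mul_sum]
    refine Finset.sum_congr rfl fun j _ => ?_
    field_simp
    ring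
  have h4 : ∑ j, (d j * (1 + e j) - d j) ^ 2 / (d j * (1 + e j)) * levKernel A d i j ^ 2
      ≤ levKernel A d i i * (10 / 9 * levAverage A d (fun j => e j ^ 2) i) := by
    rw [levAverage, Finset.mul_sum, Finset.mul_sum]
    refine Finset.sum_le_sum fun j _ => ?_
    have a1 : (d j * (1 + e j) - d j) ^ 2 / (d j * (1 + e j))
        = d j * e j ^ 2 * (1 / (1 + e j)) := by
      have := (hd j).ne'
      have : 1 + e j ≠ 0 := by linarith [he' j]
      field_simp
      ring
    have a2 : 1 / (1 + e j) ≤ 10 / 9 := by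
      rw [div_le_iff₀ (by linarith [he' j])]; linarith [he' j]
    have a3 : levKernel A d i i * (10 / 9 * (d j * levKernel A d i j ^ 2 / levKernel A d i i
        * e j ^ 2)) = (d j * e j ^ 2) * (10 / 9) * levKernel A d i j ^ 2 := by
      field_simp
    rw [a1, a3]
    exact mul_le_mul_of_nonneg_right (mul_le_mul_of_nonneg_left a2
      (mul_nonneg (hd j).le (sq_nonneg _))) (sq_nonneg _)
  rw [h3] at h1 h2
  have h5 : 0 ≤ levAverage A d (fun j => e j ^ 2) i :=
    Finset.sum_nonneg fun j _ => mul_nonneg (hA.average_weight_nonneg hd i j) (sq_nonneg _)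
  set τ' := levKernel A (fun j => d j * (1 + e j)) i i
  set τ := levKernel A d i i
  have h6 : τ' / τ - 1 + levAverage A d e i = (τ' - τ + τ * levAverage A d e i) / τ := by
    field_simp
  rw [h6, abs_le, le_div_iff₀ hτ, div_le_iff₀ hτ]
  constructor
  · have := mul_nonneg h5 hτ.le
    linarith
  · linarith

/-- The scalar core of the expansion, with `a = 2/p`: `x` is the relative displacement, `X` and `Z`
are the relative changes of `w ^ (-a)` and of the kernel diagonal, `c` and `y` are the averages of
the displacement and of its absolute value, and `ζ = w₀ / v`. -/
theorem expansion_error_le {x X Z y c ξ a ζ : ℝ} (hξ0 : 0 ≤ ξ) (hξ : ξ ≤ 1 / 10000)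
    (hx : |x| ≤ ξ) (ha0 : 1 / 2 ≤ a) (ha1 : a ≤ 1) (hc : |c| ≤ y)
    (hX : |X + a * x| ≤ 3 * ξ * |x|) (hZ : |Z + (1 - a) * c| ≤ 5 * ξ * y) (hζ : |ζ - 1| ≤ ξ) :
    |x + 1 / 4 * ζ * ((1 + X) * (1 + Z) - 1) - ((1 - a / 4) * x - (1 - a) / 4 * c)|
      ≤ 2 * ξ * |x| + 3 * ξ * y := by
  have hx0 := abs_nonneg x
  have hy0 : 0 ≤ y := (abs_nonneg c).trans hc
  have hXb : |X| ≤ 2 * |x| := by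
    have h1 : |X| ≤ |X + a * x| + |a * x| := by
      have := abs_sub (X + a * x) (a * x); simpa using this
    rw [abs_mul, abs_of_pos (by linarith : 0 < a)] at h1
    nlinarith
  have hZb : |Z| ≤ y := by
    have h1 : |Z| ≤ |Z + (1 - a) * c| + |(1 - a) * c| := by
      have := abs_sub (Z + (1 - a) * c) ((1 - a) * c); simpa using this
    rw [abs_mul, abs_of_nonneg (by linarith : 0 ≤ 1 - a)] at h1
    nlinarith
  have hXZ : |X * Z| ≤ 2 * ξ * y := by
    rw [abs_mul]
    exact mul_le_mul (by linarith) hZb (abs_nonneg _) (by linarith)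
  have hg : |(1 + X) * (1 + Z) - 1| ≤ 2 * |x| + 2 * y := by
    have : (1 + X) * (1 + Z) - 1 = X + Z + X * Z := by ring
    rw [this]
    refine (abs_add_three _ _ _).trans ?_
    nlinarith
  have hζg : |(ζ - 1) * ((1 + X) * (1 + Z) - 1)| ≤ ξ * (2 * |x| + 2 * y) := by
    rw [abs_mul]
    exact mul_le_mul hζ hg (abs_nonneg _) hξ0
  have : x + 1 / 4 * ζ * ((1 + X) * (1 + Z) - 1) - ((1 - a / 4) * x - (1 - a) / 4 * c)
      = 1 / 4 * ((X + a * x) + (Z + (1 - a) * c) + X * Z + (ζ - 1) * ((1 + X) * (1 + Z) - 1)) := by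
    ring
  rw [this, abs_mul, abs_of_pos (by norm_num : (0 : ℝ) < 1 / 4)]
  have h2 := (abs_add_le ((X + a * x) + (Z + (1 - a) * c) + X * Z)
    ((ζ - 1) * ((1 + X) * (1 + Z) - 1))).trans (add_le_add_left (abs_add_three _ _ _) _)
  nlinarith [mul_nonneg hξ0 hx0, mul_nonneg hξ0 hy0]

/-- Expansion of one gradient step around the Lewis weights. -/
theorem IsLewisWeight.gradStep_expansion (h : IsLewisWeight A p v) (hA : NonDegenerate A)
    (hp : 2 ≤ p) (hp4 : p < 4) (hw₀ : ∀ i, 0 < w₀ i) (hv : InBox (apxRadius p) w₀ v)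
    (hw : InBox (apxRadius p) w₀ w) (i : Fin m) :
    |(gradStep p w₀ w (leverageScores (reweight A p w)) i - v i) / v i
      - ((1 - 2 / p / 4) * ((w i - v i) / v i)
        - (1 - 2 / p) / 4 * levAverage A (lewisDensity p v) (fun j => (w j - v j) / v j) i)|
      ≤ 2 * (1 / 10000) * |(w i - v i) / v i|
        + 3 * (1 / 10000) * levAverage A (lewisDensity p v) (fun j => |(w j - v j) / v j|) i := by
  have hp0 : 0 < p := by linarith
  have hr := apxRadius_le hp0 hp4
  have hr0 := apxRadius_pos hp0 hp4
  have hwp := hw.pos (lt_of_le_of_lt hr (by norm_num)) hw₀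
  have hd := lewisDensity_pos (p := p) h.1
  set x : Fin m → ℝ := fun j => (w j - v j) / v j with hx
  set a := 2 / p with ha
  have ha0 : 1 / 2 ≤ a := by rw [ha, le_div_iff₀ hp0]; linarith
  have ha1 : a ≤ 1 := by rw [ha, div_le_iff₀ hp0]; linarith
  have hwv : ∀ j, w j = v j * (1 + x j) := fun j => by
    have := (h.1 j).ne'
    rw [hx]; field_simp; ring
  have hv0 : ∀ j, (1 - apxRadius p) * w₀ j ≤ v j := fun j => (hv j).1
  have hxb : ∀ j, |x j| ≤ 1 / 10000 := by
    intro j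
    rw [hx]
    simp only
    rw [abs_div, abs_of_pos (h.1 j), div_le_iff₀ (h.1 j), abs_le]
    have h1 := hw j
    have h2 := hv j
    have h3 := hw₀ j
    have h4 : 2 * apxRadius p * w₀ j ≤ 1 / 10000 * ((1 - apxRadius p) * w₀ j) := by
      rw [← mul_assoc]
      exact mul_le_mul_of_nonneg_right (by norm_num at hr ⊢; linarith) h3.le
    constructor <;> linarith
  have hx1 : ∀ j, 0 < 1 + x j := fun j => by
    have := (abs_le.mp (hxb j)).1; linarith
  -- the change of the density
  set e : Fin m → ℝ := fun j => (1 + x j) ^ (1 - a) - 1 with he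
  have hexp : ∀ j, |e j - (1 - a) * x j| ≤ 3 * (1 / 10000) * |x j| := by
    intro j
    have h1 := abs_one_add_rpow_sub_le (x := x j) (c := 1 - a) ((hxb j).trans (by norm_num))
      (by rw [abs_le]; constructor <;> linarith)
    refine h1.trans ?_
    rw [← sq_abs]
    nlinarith [hxb j, abs_nonneg (x j)]
  have heb : ∀ j, |e j| ≤ |x j| := by
    intro j
    have h1 : |e j| ≤ |e j - (1 - a) * x j| + |(1 - a) * x j| := by
      have := abs_add_le (e j - (1 - a) * x j) ((1 - a) * x j); simpa using this
    rw [abs_mul, abs_of_nonneg (by linarith : 0 ≤ 1 - a)] at h1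
    nlinarith [hexp j, abs_nonneg (x j)]
  have hdens : lewisDensity p w = fun j => lewisDensity p v j * (1 + e j) := by
    funext j
    rw [lewisDensity, lewisDensity, hwv j, Real.mul_rpow (h.1 j).le (hx1 j).le, he]
    simp [ha]
  have hexpand := hA.abs_levKernel_div_sub_le hd
    (fun j => ((heb j).trans (hxb j)).trans (by norm_num)) (e := e) i
  rw [← hdens] at hexpand
  set N := levAverage A (lewisDensity p v) with hN
  set Z := levKernel A (lewisDensity p w) i i / levKernel A (lewisDensity p v) i i - 1 with hZ
  have hZ' : |Z + (1 - a) * N x i| ≤ 5 * (1 / 10000) * N (fun j => |x j|) i := by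
    have h1 : |N e i - (1 - a) * N x i| ≤ 3 * (1 / 10000) * N (fun j => |x j|) i := by
      rw [hN, ← levAverage_mul, ← levAverage_sub, ← levAverage_mul]
      exact (hA.abs_levAverage_le hd _ i).trans (hA.levAverage_mono hd hexp i)
    have h2 : N (fun j => e j ^ 2) i ≤ 1 / 10000 * N (fun j => |x j|) i := by
      rw [hN, ← levAverage_mul]
      refine hA.levAverage_mono hd (fun j => ?_) i
      rw [← sq_abs]
      nlinarith [hxb j, heb j, abs_nonneg (x j), abs_nonneg (e j)]
    have h3 : Z + (1 - a) * N x i = (Z + N e i) - (N e i - (1 - a) * N x i) := by ring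
    rw [h3]
    refine (abs_sub _ _).trans ?_
    have h4 : 0 ≤ N (fun j => |x j|) i := (abs_nonneg _).trans (hA.abs_levAverage_le hd x i)
    linarith
  set X := (1 + x i) ^ (-a) - 1 with hX
  have hX' : |X + a * x i| ≤ 3 * (1 / 10000) * |x i| := by
    have h1 := abs_one_add_rpow_sub_le (x := x i) (c := -a) ((hxb i).trans (by norm_num))
      (by rw [abs_le]; constructor <;> linarith)
    rw [show (1 + x i) ^ (-a) - 1 - -a * x i = X + a * x i by rw [hX]; ring] at h1
    refine h1.trans ?_
    rw [← sq_abs]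
    nlinarith [hxb i, abs_nonneg (x i)]
  have hζ : |w₀ i / v i - 1| ≤ 1 / 10000 := by
    rw [div_sub_one (h.1 i).ne', abs_div, abs_of_pos (h.1 i), div_le_iff₀ (h.1 i), abs_le]
    have h1 := hv i
    have h2 := hw₀ i
    have h4 : apxRadius p * w₀ i ≤ 1 / 10000 * ((1 - apxRadius p) * w₀ i) := by
      rw [← mul_assoc]
      exact mul_le_mul_of_nonneg_right (by norm_num at hr ⊢; linarith) h2.le
    constructor <;> linarith
  have hL : max 4 (8 / p) = 4 := by
    refine max_eq_left ?_
    rw [div_le_iff₀ hp0]; linarith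
  have hτv := h.lewisDiag_eq i
  -- The powers of `v i` cancel because the kernel diagonal at `v` is `v ^ a`.
  have hσ : leverageScores (reweight A p w) i / w i = (1 + X) * (1 + Z) := by
    have hτ0 : 0 < levKernel A (lewisDensity p v) i i := hA.levKernel_pos hd i
    have h1 : levKernel A (lewisDensity p w) i i = v i ^ a * (1 + Z) := by
      rw [ha, ← hτv, hZ, lewisDiag]; field_simp; ring
    rw [leverageScores_reweight hwp, lewisDiag, h1, lewisDensity, hX, div_eq_mul_inv,
      ← Real.rpow_neg_one]
    have h2 : w i ^ (1 - 2 / p) * w i ^ (-1 : ℝ) = v i ^ (-a) * (1 + x i) ^ (-a) := by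
      rw [← Real.rpow_add (hwp i), ← Real.mul_rpow (h.1 i).le (hx1 i).le, ← hwv i]
      congr 1
      rw [ha]; ring
    have h3 : v i ^ (-a) * v i ^ a = 1 := by
      rw [← Real.rpow_add (h.1 i)]; simp
    linear_combination (v i ^ a * (1 + Z)) * h2 + ((1 + x i) ^ (-a) * (1 + Z)) * h3
  have hstep : (gradStep p w₀ w (leverageScores (reweight A p w)) i - v i) / v i
      = x i + 1 / 4 * (w₀ i / v i) * ((1 + X) * (1 + Z) - 1) := by
    rw [← hσ, gradStep, hL, hx]
    have := (h.1 i).ne'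
    have := (hwp i).ne'
    field_simp
    ring
  rw [hstep]
  exact expansion_error_le (by norm_num) le_rfl (hxb i) ha0 ha1 (hA.abs_levAverage_le hd x i)
    hX' hZ' hζ

/-- Young's inequality with parameter `1/100`: the main term loses one percent, the perturbation
pays a factor `101`. -/
theorem sum_sq_perturb_le {ι : Type*} (s : Finset ι) (c f g : ι → ℝ) (hc : ∀ i, 0 ≤ c i) {F G : ℝ}
    (hF : ∑ i ∈ s, c i * f i ^ 2 ≤ F) (hG : ∑ i ∈ s, c i * g i ^ 2 ≤ G) :
    ∑ i ∈ s, c i * (f i + g i) ^ 2 ≤ 101 / 100 * F + 101 * G := by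
  calc ∑ i ∈ s, c i * (f i + g i) ^ 2
      ≤ ∑ i ∈ s, (101 / 100 * (c i * f i ^ 2) + 101 * (c i * g i ^ 2)) := by
        refine Finset.sum_le_sum fun i _ => ?_
        have : (f i + g i) ^ 2 ≤ 101 / 100 * f i ^ 2 + 101 * g i ^ 2 := by
          nlinarith [sq_nonneg (f i / 10 - 10 * g i)]
        nlinarith [mul_le_mul_of_nonneg_left this (hc i)]
    _ = 101 / 100 * ∑ i ∈ s, c i * f i ^ 2 + 101 * ∑ i ∈ s, c i * g i ^ 2 := by
        rw [Finset.sum_add_distrib, Finset.mul_sum, Finset.mul_sum]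
    _ ≤ _ := by linarith

/-- For `2 ≤ p < 4`, an exact gradient step contracts the distance to the Lewis weights in the
weighted Euclidean norm, at a rate independent of `p`. -/
theorem IsLewisWeight.sum_sq_gradStep_le (h : IsLewisWeight A p v) (hA : NonDegenerate A)
    (hp : 2 ≤ p) (hp4 : p < 4) (hw₀ : ∀ i, 0 < w₀ i) (hv : InBox (apxRadius p) w₀ v)
    (hw : InBox (apxRadius p) w₀ w) :
    ∑ i, v i * ((gradStep p w₀ w (leverageScores (reweight A p w)) i - v i) / v i) ^ 2
      ≤ (9 / 10) ^ 2 * ∑ i, v i * ((w i - v i) / v i) ^ 2 := by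
  have hp0 : 0 < p := by linarith
  have hd := lewisDensity_pos (p := p) h.1
  have hexp := h.gradStep_expansion hA hp hp4 hw₀ hv hw
  set x : Fin m → ℝ := fun j => (w j - v j) / v j with hx
  set N := levAverage A (lewisDensity p v) with hN
  set a := 2 / p with ha
  have ha0 : 1 / 2 ≤ a := by rw [ha, le_div_iff₀ hp0]; linarith
  have ha1 : a ≤ 1 := by rw [ha, div_le_iff₀ hp0]; linarith
  set y : Fin m → ℝ := fun i =>
    (gradStep p w₀ w (leverageScores (reweight A p w)) i - v i) / v i with hy
  set M : Fin m → ℝ := fun i => (1 - a / 4) * x i - (1 - a) / 4 * N x i with hM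
  set Q := ∑ i, v i * x i ^ 2 with hQ
  have hv' : ∀ i, lewisDensity p v i * levKernel A (lewisDensity p v) i i = v i :=
    h.density_mul_diag
  have hNle : ∀ f : Fin m → ℝ, ∑ i, v i * N f i ^ 2 ≤ ∑ i, v i * f i ^ 2 := by
    intro f
    have := hA.sum_levAverage_sq_le hd f
    simpa only [hv'] using this
  have hNnn : 0 ≤ ∑ i, v i * (x i * N x i) := by
    have := hA.sum_mul_levAverage_nonneg hd x
    simpa only [hv'] using this
  have hQ0 : 0 ≤ Q := Finset.sum_nonneg fun i _ => mul_nonneg (h.1 i).le (sq_nonneg _)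
  -- After the cross term is dropped and `‖N‖ ≤ 1` is used, the coefficient is `(1 - a/4)² + ((1 -
  -- a)/4)²`. On `[1/2, 1]` it is largest at `a = 1/2`, with value `25/32 < 79/100`.
  have hMQ : ∑ i, v i * M i ^ 2 ≤ 79 / 100 * Q := by
    have e1 : ∑ i, v i * M i ^ 2 = (1 - a / 4) ^ 2 * Q
        - 2 * (1 - a / 4) * ((1 - a) / 4) * ∑ i, v i * (x i * N x i)
        + ((1 - a) / 4) ^ 2 * ∑ i, v i * N x i ^ 2 := by
      rw [hQ, Finset.mul_sum, Finset.mul_sum, Finset.mul_sum, ← Finset.sum_sub_distrib,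
        ← Finset.sum_add_distrib]
      exact Finset.sum_congr rfl fun i _ => by simp only [hM]; ring
    have h2 : 0 ≤ 2 * (1 - a / 4) * ((1 - a) / 4) * ∑ i, v i * (x i * N x i) :=
      mul_nonneg (mul_nonneg (by linarith) (by linarith)) hNnn
    have h3 := mul_le_mul_of_nonneg_left (hNle x) (sq_nonneg ((1 - a) / 4))
    have h4 : (1 - a / 4) ^ 2 + ((1 - a) / 4) ^ 2 ≤ 79 / 100 := by nlinarith
    have h5 := mul_le_mul_of_nonneg_right h4 hQ0
    rw [e1]
    linarith
  have hEQ : ∑ i, v i * (y i - M i) ^ 2 ≤ 26 * (1 / 10000) ^ 2 * Q := by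
    have h1 : ∀ i, v i * (y i - M i) ^ 2 ≤ (1 / 10000) ^ 2 *
        (8 * (v i * x i ^ 2) + 18 * (v i * N (fun j => |x j|) i ^ 2)) := by
      intro i
      have h2 := pow_le_pow_left₀ (abs_nonneg _) (hexp i) 2
      rw [sq_abs] at h2
      have h3 : (2 * (1 / 10000) * |x i| + 3 * (1 / 10000) * N (fun j => |x j|) i) ^ 2
          ≤ (1 / 10000) ^ 2 * (8 * x i ^ 2 + 18 * N (fun j => |x j|) i ^ 2) := by
        rw [← sq_abs (x i)]
        nlinarith [sq_nonneg (2 * |x i| - 3 * N (fun j => |x j|) i)]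
      have := mul_le_mul_of_nonneg_left (h2.trans h3) (h.1 i).le
      exact (show v i * (y i - M i) ^ 2 ≤ _ from this).trans (le_of_eq (by ring))
    refine (Finset.sum_le_sum fun i _ => h1 i).trans ?_
    rw [← Finset.mul_sum, Finset.sum_add_distrib, ← Finset.mul_sum, ← Finset.mul_sum]
    have h2 := hNle fun j => |x j|
    simp only [sq_abs] at h2
    linarith
  -- The total is `1.01 * 0.79` plus `101 * 26 * 10⁻⁸`, below `0.81 = (9/10)²`.
  have := sum_sq_perturb_le Finset.univ v M (fun i => y i - M i) (fun i => (h.1 i).le) hMQ hEQ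
  simp only [add_sub_cancel] at this
  refine this.trans ?_
  linarith

end EnergyNorm

/-! ### Exact and noisy runs, and the accuracy of the output. -/

section Run

variable {m n : ℕ} {A : Matrix (Fin m) (Fin n) ℝ} {p ε δ : ℝ} {w₀ v : Fin m → ℝ}

theorem apxLeverage_self (B : Matrix (Fin m) (Fin n) ℝ) : ApxLeverage 0 B (leverageScores B) :=
  fun i => by simp

theorem ApxLeverage.mono {B : Matrix (Fin m) (Fin n) ℝ} {η : ℝ} {s : Fin m → ℝ}
    (h : ApxLeverage δ B s) (hB : ∀ i, 0 ≤ leverageScores B i) (hδ : δ ≤ η) :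
    ApxLeverage η B s := fun i =>
  ⟨(mul_le_mul_of_nonneg_right (Real.exp_le_exp.mpr (neg_le_neg hδ)) (hB i)).trans (h i).1,
    (h i).2.trans (mul_le_mul_of_nonneg_right (Real.exp_le_exp.mpr hδ) (hB i))⟩

theorem norm_inv_mul_sub_le_iff {r : ℝ} (hr : 0 ≤ r) {w u : Fin m → ℝ} (hw : ∀ i, 0 < w i) :
    ‖w⁻¹ * (u - w)‖ ≤ r ↔ ∀ i, |u i - w i| ≤ r * w i := by
  rw [pi_norm_le_iff_of_nonneg hr]
  refine forall_congr' fun i => ?_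
  rw [Pi.mul_apply, Pi.inv_apply, Pi.sub_apply, Real.norm_eq_abs, abs_mul, abs_inv,
    abs_of_pos (hw i), inv_mul_le_iff₀ (hw i), mul_comm r]

theorem inBox_of_norm_le {r : ℝ} (hr : 0 ≤ r) (hw₀ : ∀ i, 0 < w₀ i)
    (h : ‖w₀⁻¹ * (v - w₀)‖ ≤ r) : InBox r w₀ v := by
  intro i
  have := abs_le.mp ((norm_inv_mul_sub_le_iff hr hw₀).mp h i)
  constructor <;> linarith

/-- The iteration with exact leverage scores. -/
noncomputable def exactRun (A : Matrix (Fin m) (Fin n) ℝ) (p : ℝ) (w₀ : Fin m → ℝ) :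
    ℕ → Fin m → ℝ
  | 0 => w₀
  | j + 1 => apxUpdate p w₀ (exactRun A p w₀ j)
      (leverageScores (reweight A p (exactRun A p w₀ j)))

theorem inBox_exactRun (hp : 0 < p) (hp4 : p < 4) (hw₀ : ∀ i, 0 < w₀ i) (j : ℕ) :
    InBox (apxRadius p) w₀ (exactRun A p w₀ j) := by
  cases j with
  | zero => exact inBox_self (apxRadius_pos hp hp4).le hw₀
  | succ j => exact inBox_apxUpdate hp hp4 hw₀ _

/-- A run of length `N` with leverage scores of accuracy `δ`. -/
def IsNoisyRun (A : Matrix (Fin m) (Fin n) ℝ) (p : ℝ) (w₀ : Fin m → ℝ) (δ : ℝ) (N : ℕ)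
    (w : ℕ → Fin m → ℝ) : Prop :=
  w 0 = w₀ ∧ ∀ j < N, ∃ s, ApxLeverage δ (reweight A p (w j)) s ∧
    w (j + 1) = apxUpdate p w₀ (w j) s

theorem IsNoisyRun.inBox {N : ℕ} {w : ℕ → Fin m → ℝ} (h : IsNoisyRun A p w₀ δ N w) (hp : 0 < p)
    (hp4 : p < 4) (hw₀ : ∀ i, 0 < w₀ i) {j : ℕ} (hj : j ≤ N) : InBox (apxRadius p) w₀ (w j) := by
  cases j with
  | zero => rw [h.1]; exact inBox_self (apxRadius_pos hp hp4).le hw₀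
  | succ j =>
    obtain ⟨s, -, hs⟩ := h.2 j hj
    rw [hs]
    exact inBox_apxUpdate hp hp4 hw₀ _

/-- The bound is the fixed point of the recursion `Δ ↦ Δ (1 - (9/10) κ / L) + (11/10) δ / L`, so it
persists for any number of steps. -/
theorem IsNoisyRun.abs_sub_exactRun_le {N : ℕ} {w : ℕ → Fin m → ℝ}
    (h : IsNoisyRun A p w₀ δ N w) (hv : IsLewisWeight A p v) (hA : NonDegenerate A) (hp : 0 < p)
    (hp4 : p < 4) (hw₀ : ∀ i, 0 < w₀ i) (hbox : InBox (apxRadius p) w₀ v) (hδ : 0 ≤ δ)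
    (hδ' : δ ≤ 1 / 64) {j : ℕ} (hj : j ≤ N) (i : Fin m) :
    |w j i - exactRun A p w₀ j i| ≤ 11 / 9 * δ / supRate p * w₀ i := by
  have hκ := supRate_pos hp hp4
  induction j generalizing i with
  | zero =>
    rw [h.1, exactRun, sub_self, abs_zero]
    exact mul_nonneg (by positivity) (hw₀ i).le
  | succ j ih =>
    obtain ⟨s, hs, hstep⟩ := h.2 j hj
    rw [hstep, exactRun]
    refine (abs_apxUpdate_sub_le hp hp4 hw₀ _ _ i).trans ?_
    refine (hv.abs_gradStep_sub_le hA hp hp4 hw₀ hbox (h.inBox hp hp4 hw₀ (by omega))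
      (inBox_exactRun hp hp4 hw₀ j) hδ hδ' hs (by positivity)
      (fun i => ih (by omega) i) i).trans (le_of_eq ?_)
    have : (0 : ℝ) < max 4 (8 / p) := lt_of_lt_of_le (by norm_num) (four_le_step p)
    congr 1
    field_simp
    ring

/-- For `p ≤ 2` the rate is `κ = 1` and `L = 8/p`, so a step without noise contracts by `1 -
(9/10)(p/8)`. -/
theorem IsLewisWeight.abs_exactRun_sub_le (hv : IsLewisWeight A p v) (hA : NonDegenerate A)
    (hp : 0 < p) (hp2 : p ≤ 2) (hw₀ : ∀ i, 0 < w₀ i)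
    (hbox : InBox (apxRadius p) w₀ v) (j : ℕ) (i : Fin m) :
    |exactRun A p w₀ j i - v i| ≤ apxRadius p * (1 - 9 / 80 * p) ^ j * w₀ i := by
  have hp4 : p < 4 := by linarith
  have hr := apxRadius_pos hp hp4
  have hL : max 4 (8 / p) = 8 / p := by
    refine max_eq_right ?_
    rw [le_div_iff₀ hp]; linarith
  induction j generalizing i with
  | zero =>
    rw [exactRun, pow_zero, mul_one, abs_le]
    have := hbox i
    constructor <;> linarith
  | succ j ih =>
    rw [exactRun]
    conv_lhs => rw [← hv.apxUpdate_eq hbox]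
    refine (abs_apxUpdate_sub_le hp hp4 hw₀ _ _ i).trans ?_
    have hq : 0 ≤ 1 - 9 / 80 * p := by linarith
    refine (hv.abs_gradStep_sub_le hA hp hp4 hw₀ hbox (inBox_exactRun hp hp4 hw₀ j) hbox le_rfl
      (by norm_num) (apxLeverage_self _) (by positivity) ih i).trans (le_of_eq ?_)
    rw [supRate_of_le_two hp hp2, hL]
    congr 1
    field_simp
    ring

/-- The projection fixes `v` and brings no coordinate further from it, so the contraction of the
gradient step survives. Initially each relative displacement is at most `2 r` and the weights `v`
sum to `n`. -/
theorem IsLewisWeight.sum_sq_exactRun_le (hv : IsLewisWeight A p v) (hA : NonDegenerate A)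
    (hp : 2 ≤ p) (hp4 : p < 4) (hw₀ : ∀ i, 0 < w₀ i) (hbox : InBox (apxRadius p) w₀ v) (j : ℕ) :
    ∑ i, v i * ((exactRun A p w₀ j i - v i) / v i) ^ 2
      ≤ (2 * apxRadius p * Real.sqrt n * (9 / 10) ^ j) ^ 2 := by
  have hp0 : 0 < p := by linarith
  have hr := apxRadius_le hp0 hp4
  have hr0 := apxRadius_pos hp0 hp4
  induction j with
  | zero =>
    rw [pow_zero, mul_one, mul_pow, Real.sq_sqrt (Nat.cast_nonneg n), ← hv.sum_eq hA,
      Finset.mul_sum]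
    refine Finset.sum_le_sum fun i _ => ?_
    rw [mul_comm _ (v i)]
    refine mul_le_mul_of_nonneg_left ?_ (hv.1 i).le
    refine sq_le_sq' ?_ ?_
    · rw [le_div_iff₀ (hv.1 i), exactRun]
      nlinarith [hbox i, hw₀ i]
    · rw [div_le_iff₀ (hv.1 i), exactRun]
      nlinarith [hbox i, hw₀ i, mul_nonneg hr0.le (hw₀ i).le]
  | succ j ih =>
    calc _ ≤ ∑ i, v i * ((gradStep p w₀ (exactRun A p w₀ j)
          (leverageScores (reweight A p (exactRun A p w₀ j))) i - v i) / v i) ^ 2 := by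
          refine Finset.sum_le_sum fun i _ => mul_le_mul_of_nonneg_left ?_ (hv.1 i).le
          rw [div_pow, div_pow]
          refine div_le_div_of_nonneg_right (sq_le_sq.mpr ?_) (sq_nonneg _)
          have := abs_apxUpdate_sub_le hp0 hp4 hw₀ (w := exactRun A p w₀ j) (u := v)
            (leverageScores (reweight A p (exactRun A p w₀ j)))
            (leverageScores (reweight A p v)) i
          rwa [hv.apxUpdate_eq hbox, hv.gradStep_eq] at this
      _ ≤ (9 / 10) ^ 2 * ∑ i, v i * ((exactRun A p w₀ j i - v i) / v i) ^ 2 :=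
          hv.sum_sq_gradStep_le hA hp hp4 hw₀ hbox (inBox_exactRun hp0 hp4 hw₀ j)
      _ ≤ (9 / 10) ^ 2 * (2 * apxRadius p * Real.sqrt n * (9 / 10) ^ j) ^ 2 :=
          mul_le_mul_of_nonneg_left ih (by norm_num)
      _ = _ := by ring

/-- Closeness in the weighted Euclidean norm makes the diagonals close in the maximum norm. -/
theorem IsLewisWeight.abs_log_lewisDiag_le_of_sum_sq_le (hv : IsLewisWeight A p v)
    (hA : NonDegenerate A) (hp : 2 ≤ p) {w : Fin m → ℝ} (hw : ∀ i, 0 < w i)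
    (hx : ∀ i, |(w i - v i) / v i| ≤ 1 / 10) {η : ℝ} (hη0 : 0 ≤ η) (hη : η ≤ 1 / 2)
    (h : ∑ i, v i * ((w i - v i) / v i) ^ 2 ≤ η ^ 2) (i : Fin m) :
    |Real.log (lewisDiag A p w i) - Real.log (lewisDiag A p v i)| ≤ 2 * η := by
  have hp0 : 0 < p := by linarith
  have hd := lewisDensity_pos (p := p) hv.1
  set a := 2 / p with ha
  have ha0 : 0 < a := by positivity
  have ha1 : a ≤ 1 := by rw [ha, div_le_iff₀ hp0]; linarith
  set x : Fin m → ℝ := fun j => (w j - v j) / v j with hxdef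
  have hwv : ∀ j, w j = v j * (1 + x j) := fun j => by
    have := (hv.1 j).ne'
    rw [hxdef]; field_simp; ring
  have hx1 : ∀ j, 0 < 1 + x j := fun j => by
    have := (abs_le.mp (hx j)).1
    simp only [hxdef]
    linarith
  set e : Fin m → ℝ := fun j => (1 + x j) ^ (1 - a) - 1 with he
  have hdens : ∀ j, lewisDensity p w j = lewisDensity p v j * (1 + e j) := by
    intro j
    rw [lewisDensity, lewisDensity, hwv j, Real.mul_rpow (hv.1 j).le (hx1 j).le, he]
    simp [ha]
  -- Since `0 ≤ 1 - a ≤ 1`, the power `(1 + x) ^ (1 - a)` lies between `1` and `1 + x`.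
  have heb : ∀ j, |e j| ≤ |x j| := by
    intro j
    rw [he]
    simp only
    rcases le_total 0 (x j) with h0 | h0
    · have h1 : (1 + x j) ^ (1 - a) ≤ (1 + x j) ^ (1 : ℝ) :=
        Real.rpow_le_rpow_of_exponent_le (by linarith) (by linarith)
      have h2 : 1 ≤ (1 + x j) ^ (1 - a) := Real.one_le_rpow (by linarith) (by linarith)
      rw [Real.rpow_one] at h1
      rw [abs_of_nonneg h0, abs_of_nonneg (by linarith)]
      linarith
    · have h1 : (1 + x j) ^ (1 : ℝ) ≤ (1 + x j) ^ (1 - a) :=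
        Real.rpow_le_rpow_of_exponent_ge (hx1 j) (by linarith) (by linarith)
      have h2 : (1 + x j) ^ (1 - a) ≤ 1 := Real.rpow_le_one (hx1 j).le (by linarith) (by linarith)
      rw [Real.rpow_one] at h1
      rw [abs_of_nonpos h0, abs_of_nonpos (by linarith)]
      linarith
  have hsum : ∑ j, lewisDensity p v j * levKernel A (lewisDensity p v) j j * e j ^ 2 ≤ η ^ 2 := by
    refine le_trans (Finset.sum_le_sum fun j _ => ?_) h
    rw [show lewisDensity p v j * levKernel A (lewisDensity p v) j j = v j from
      hv.density_mul_diag j]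
    exact mul_le_mul_of_nonneg_left (sq_le_sq.mpr (heb j)) (hv.1 j).le
  have henergy : ∀ y, |energy A (lewisDensity p w) y - energy A (lewisDensity p v) y|
      ≤ η * energy A (lewisDensity p v) y := by
    intro y
    refine le_trans (le_of_eq ?_) (hA.abs_energy_sub_le hd hη0 hsum y)
    rw [energy, energy, ← Finset.sum_sub_distrib]
    congr 1
    refine Finset.sum_congr rfl fun j _ => ?_
    rw [hdens j]; ring
  have h1 := hA.levKernel_le_of_energy_le (lewisDensity_pos (p := p) hw) hd (c := 1 + η)
    (fun y => by have := (abs_le.mp (henergy y)).2; linarith) i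
  -- The constant `1 + 2 η` works because `(1 + 2 η)(1 - η) ≥ 1` for `η ≤ 1/2`.
  have h2 := hA.levKernel_le_of_energy_le hd (lewisDensity_pos (p := p) hw) (c := 1 + 2 * η)
    (fun y => by
      have a1 := (abs_le.mp (henergy y)).1
      have a2 := energy_nonneg (A := A) hd y
      nlinarith [mul_nonneg (mul_nonneg hη0 (by linarith : 0 ≤ 1 / 2 - η)) a2]) i
  have hτv := hA.lewisDiag_pos (p := p) hv.1 i
  have hτw := hA.lewisDiag_pos (p := p) hw i
  have h3 := Real.log_le_log hτv h1
  have h4 := Real.log_le_log hτw h2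
  rw [Real.log_mul (by positivity) (hA.levKernel_pos (lewisDensity_pos hw) i).ne'] at h3
  rw [Real.log_mul (by positivity) (hA.levKernel_pos hd i).ne'] at h4
  have h5 := Real.log_le_sub_one_of_pos (show 0 < 1 + η by positivity)
  have h6 := Real.log_le_sub_one_of_pos (show 0 < 1 + 2 * η by positivity)
  have e1 : Real.log (lewisDiag A p v i) = Real.log (levKernel A (lewisDensity p v) i i) := rfl
  have e2 : Real.log (lewisDiag A p w i) = Real.log (levKernel A (lewisDensity p w) i i) := rfl
  rw [abs_le]
  constructor <;> linarith

/-- The number of iterations suffices for a contraction at rate `κ`. -/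
theorem pow_apxIterations_le (hn : 0 < n) (hp : 0 < p) (hε : 0 < ε) {q κ : ℝ} (hq : 0 ≤ q)
    (hqκ : q ≤ 1 - κ) (hκ0 : 0 ≤ κ) (hκ : κ ≤ 1 / 2) (hκp : 1 ≤ κ * (80 * (p / 2 + 2 / p))) :
    q ^ (apxIterations n p ε - 1) ≤ 64 * ε / (p * n) := by
  have hn' : (0 : ℝ) < n := by exact_mod_cast hn
  set x := p * n / (32 * ε) with hx
  have hx0 : 0 < x := by positivity
  have hxi : 64 * ε / (p * n) = 2 / x := by rw [hx]; field_simp; norm_num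
  rw [hxi]
  have hq1 : q ≤ 1 := by linarith
  -- For `x ≤ 1` the logarithm in `T` is nonpositive and no decay is available, but the claimed
  -- bound `2 / x` exceeds `1`.
  rcases le_total x 1 with h1 | h1
  · refine (pow_le_one₀ hq hq1).trans ?_
    rw [le_div_iff₀ hx0]; linarith
  · have hlog : 0 ≤ Real.log x := Real.log_nonneg h1
    have hT : 80 * (p / 2 + 2 / p) * Real.log x ≤ apxIterations n p ε := Nat.le_ceil _
    set T := apxIterations n p ε
    have hT1 : (T : ℝ) - 1 ≤ ((T - 1 : ℕ) : ℝ) := by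
      have : T ≤ (T - 1) + 1 := by omega
      have : (T : ℝ) ≤ ((T - 1 : ℕ) : ℝ) + 1 := by exact_mod_cast this
      linarith
    calc q ^ (T - 1) ≤ Real.exp (-κ) ^ (T - 1) := by
          refine pow_le_pow_left₀ hq (hqκ.trans ?_) _
          have := Real.add_one_le_exp (-κ); linarith
      _ = Real.exp (-(κ * (T - 1 : ℕ))) := by rw [← Real.exp_nat_mul]; congr 1; ring
      -- Only `T - 1` steps are performed; the missing one costs the factor `exp κ ≤ 2`.
      _ ≤ Real.exp (κ - Real.log x) := by
          rw [Real.exp_le_exp]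
          have a1 := mul_le_mul_of_nonneg_left hT1 hκ0
          have a2 := mul_le_mul_of_nonneg_left hT hκ0
          have a3 := mul_le_mul_of_nonneg_right hκp hlog
          linarith
      _ = Real.exp κ / x := by rw [Real.exp_sub, Real.exp_log hx0]
      _ ≤ 2 / x := by
          refine div_le_div_of_nonneg_right ?_ hx0.le
          have h2 := (abs_le.mp (Real.abs_exp_sub_one_sub_id_le (x := κ)
            (by rw [abs_of_nonneg hκ0]; linarith))).2
          nlinarith

/-- After the prescribed number of exact iterations, the diagonal is accurate. -/
theorem IsLewisWeight.abs_log_lewisDiag_exactRun_le (hv : IsLewisWeight A p v)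
    (hA : NonDegenerate A) (hn : 0 < n) (hp : 0 < p) (hp4 : p < 4) (hε : 0 < ε) (hε1 : ε < 1)
    (hw₀ : ∀ i, 0 < w₀ i) (hbox : InBox (apxRadius p) w₀ v) (i : Fin m) :
    p / 2 * |Real.log (lewisDiag A p (exactRun A p w₀ (apxIterations n p ε - 1)) i)
      - Real.log (lewisDiag A p v i)| ≤ ε / 8 := by
  have hr := apxRadius_le hp hp4
  have hr0 := apxRadius_pos hp hp4
  have hrp : apxRadius p / p ≤ 1 / 2 ^ 18 := by
    rw [div_le_iff₀ hp]; linarith [apxRadius_le_mul hp]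
  have hn' : (1 : ℝ) ≤ n := by exact_mod_cast hn
  set T := apxIterations n p ε - 1
  have hub := inBox_exactRun (A := A) hp hp4 hw₀ T
  have hu := hub.pos (lt_of_le_of_lt hr (by norm_num)) hw₀
  rcases le_total p 2 with hp2 | hp2
  · have hq := pow_apxIterations_le (κ := 9 / 80 * p) (q := 1 - 9 / 80 * p) (ε := ε) hn hp hε
      (by linarith) le_rfl (by positivity) (by linarith) (by field_simp; nlinarith)
    have h1 : ∀ j, |exactRun A p w₀ T j - v j| ≤ ε / 100 * w₀ j := by
      intro j
      refine (hv.abs_exactRun_sub_le hA hp hp2 hw₀ hbox T j).trans ?_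
      refine mul_le_mul_of_nonneg_right ?_ (hw₀ j).le
      -- The factor `1/p` left by the iteration count is absorbed by `r ≤ p / 2¹⁸`.
      calc _ ≤ apxRadius p * (64 * ε / (p * n)) := mul_le_mul_of_nonneg_left hq hr0.le
        _ = (apxRadius p / p) * (64 * ε / n) := by field_simp
        _ ≤ 1 / 2 ^ 18 * (64 * ε / 1) := by
            refine mul_le_mul hrp ?_ (by positivity) (by norm_num)
            exact div_le_div_of_nonneg_left (by positivity) one_pos hn'
        _ ≤ _ := by norm_num; linarith
    have h2 := InBox.logClose_of_abs_sub_le (hr.trans (by norm_num)) hw₀ hub hbox h1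
    have h3 := mul_le_mul_of_nonneg_left (hA.abs_log_lewisDiag_sub_le (p := p) hu hv.1 h2 i)
      (half_pos hp).le
    rw [← mul_assoc, half_mul_abs_one_sub hp] at h3
    refine h3.trans ?_
    have h4 : ε / 100 / (1 - apxRadius p) ≤ ε / 8 := by
      rw [div_le_iff₀ (by linarith)]; nlinarith
    have h5 := abs_one_sub_half_lt_one hp hp4
    have h6 : 0 ≤ ε / 100 / (1 - apxRadius p) := div_nonneg (by linarith) (by linarith)
    nlinarith [abs_nonneg (1 - p / 2)]
  · have hq := pow_apxIterations_le (κ := 1 / 10) (q := 9 / 10) (ε := ε) hn hp hε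
      (by norm_num) (by norm_num) (by norm_num) (by norm_num)
      (by have : 0 < 2 / p := by positivity
          linarith)
    have h1 := hv.sum_sq_exactRun_le hA hp2 hp4 hw₀ hbox T
    -- The `√n` from the initial Euclidean distance is paid by the factor `1/n` of the iteration
    -- count.
    have hη : 2 * apxRadius p * Real.sqrt n * (9 / 10) ^ T ≤ ε / 100 := by
      have hs : Real.sqrt n ≤ n := by
        rw [Real.sqrt_le_left (by linarith)]
        nlinarith
      calc _ ≤ 2 * apxRadius p * n * (64 * ε / (p * n)) := by
            refine mul_le_mul (mul_le_mul_of_nonneg_left hs (by positivity)) hq (by positivity)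
              (by positivity)
        _ = (apxRadius p / p) * (128 * ε) := by field_simp; norm_num
        _ ≤ 1 / 2 ^ 18 * (128 * ε) := mul_le_mul_of_nonneg_right hrp (by positivity)
        _ ≤ _ := by norm_num; linarith
    have hx : ∀ j, |(exactRun A p w₀ T j - v j) / v j| ≤ 1 / 10 := by
      intro j
      rw [abs_div, abs_of_pos (hv.1 j), div_le_iff₀ (hv.1 j), abs_le]
      have b1 := hub j
      have b2 := hbox j
      have b3 := hw₀ j
      have b4 : 2 * apxRadius p * w₀ j ≤ 1 / 10 * ((1 - apxRadius p) * w₀ j) := by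
        rw [← mul_assoc]
        exact mul_le_mul_of_nonneg_right (by norm_num at hr ⊢; linarith) b3.le
      constructor <;> linarith
    have h2 := hv.abs_log_lewisDiag_le_of_sum_sq_le hA hp2 hu hx (by positivity)
      (hη.trans (by linarith)) h1 i
    nlinarith [abs_nonneg (Real.log (lewisDiag A p (exactRun A p w₀ T) i)
      - Real.log (lewisDiag A p v i))]

theorem abs_sub_le_of_abs_log_sub_le {x y ε : ℝ} (hx : 0 < x) (hy : 0 < y) (hε : 0 ≤ ε)
    (hε1 : ε ≤ 1) (h : |Real.log x - Real.log y| ≤ ε / 2) : |y - x| ≤ ε * y := by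
  have h1 := Real.abs_exp_sub_one_sub_id_le (x := Real.log x - Real.log y) (by linarith)
  rw [Real.exp_sub, Real.exp_log hx, Real.exp_log hy] at h1
  have h2 : (Real.log x - Real.log y) ^ 2 ≤ ε / 4 := by
    rw [← sq_abs]; nlinarith [abs_nonneg (Real.log x - Real.log y)]
  have h3 := abs_le.mp h1
  have h4 := abs_le.mp h
  have h5 : |x / y - 1| ≤ ε := by
    rw [abs_le]; constructor <;> linarith
  rw [abs_sub_comm, show x - y = (x / y - 1) * y by field_simp, abs_mul, abs_of_pos hy]
  exact mul_le_mul_of_nonneg_right h5 hy.le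

/-- Every result of the iteration is accurate. -/
theorem IsApxWeightRun.accurate {out : Fin m → ℝ} (hrun : IsApxWeightRun A p w₀ ε out)
    (hA : NonDegenerate A) (hn : 0 < n) (hp : 0 < p) (hp4 : p < 4) (hε : 0 < ε) (hε1 : ε < 1)
    (hw₀ : ∀ i, 0 < w₀ i) (hclose : ‖w₀⁻¹ * (lewisWeight A p - w₀)‖ ≤ apxRadius p) :
    ‖(lewisWeight A p)⁻¹ * (lewisWeight A p - out)‖ ≤ ε := by
  have hv := hA.isLewisWeight_lewisWeight hp hp4
  set v := lewisWeight A p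
  have hr := apxRadius_le hp hp4
  have hr0 := apxRadius_pos hp hp4
  have hbox := inBox_of_norm_le hr0.le hw₀ hclose
  obtain ⟨w, hw0, hstep, s, hs, hout⟩ := hrun
  set δ := (4 - p) * ε / 256 with hδ
  set T := apxIterations n p ε - 1 with hT
  have hδ0 : 0 ≤ δ := by rw [hδ]; exact div_nonneg (mul_nonneg (by linarith) hε.le) (by norm_num)
  have hδε : δ ≤ ε / 64 := by rw [hδ]; nlinarith
  have hnoisy : IsNoisyRun A p w₀ δ T w := by
    refine ⟨hw0, fun j hj => ?_⟩
    obtain ⟨s, hs, hsw⟩ := hstep j hj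
    exact ⟨s, hs, funext hsw⟩
  have hwT := hnoisy.inBox hp hp4 hw₀ le_rfl
  have hwpos := hwT.pos (lt_of_le_of_lt hr (by norm_num)) hw₀
  have hub := inBox_exactRun (A := A) hp hp4 hw₀ T
  have hupos := hub.pos (lt_of_le_of_lt hr (by norm_num)) hw₀
  have hκ := supRate_pos hp hp4
  -- The factor `4 - p` in `δ` cancels the degenerating rate `κ ≥ (4 - p)/4`.
  have hE : 11 / 9 * δ / supRate p ≤ ε / 50 := by
    rw [div_le_iff₀ hκ]
    have := mul_le_mul_of_nonneg_left (supRate_ge hp hp4) (by positivity : 0 ≤ ε / 50)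
    refine le_trans ?_ this
    rw [hδ]
    nlinarith [mul_pos hε (by linarith : 0 < 4 - p)]
  have hclose' := InBox.logClose_of_abs_sub_le (Δ := ε / 50) (hr.trans (by norm_num)) hw₀ hwT hub
    (fun i => (hnoisy.abs_sub_exactRun_le hv hA hp hp4 hw₀ hbox hδ0 (by linarith) le_rfl i).trans
      (mul_le_mul_of_nonneg_right hE (hw₀ i).le))
  have hposo : ∀ i, 0 < out i := fun i => by
    rw [hout i]
    exact lewisUpdate_pos hwpos (hs.pos hA hwpos) i
  rw [← norm_neg, ← mul_neg, neg_sub, norm_inv_mul_sub_le_iff hε.le hv.1]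
  intro i
  rw [abs_sub_comm]
  refine abs_sub_le_of_abs_log_sub_le (hposo i) (hv.1 i) hε.le hε1.le ?_
  have h1 := hs.abs_log_lewisUpdate_sub_le hA hp hwpos i
  rw [show lewisUpdate p (w T) s i = out i from (hout i).symm] at h1
  have h2 := mul_le_mul_of_nonneg_left
    (hA.abs_log_lewisDiag_sub_le (p := p) hwpos hupos hclose' i) (half_pos hp).le
  rw [← mul_assoc, half_mul_abs_one_sub hp] at h2
  have h3 := hv.abs_log_lewisDiag_exactRun_le hA hn hp hp4 hε hε1 hw₀ hbox i
  have h4 := (isLewisWeight_iff hA hp hv.1).mp hv i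
  have h5 := abs_one_sub_half_lt_one hp hp4
  have h6 : ε / 50 / (1 - apxRadius p) ≤ ε / 25 := by
    rw [div_le_iff₀ (by linarith)]; nlinarith
  have h7 : |1 - p / 2| * (ε / 50 / (1 - apxRadius p)) ≤ ε / 25 := by
    have : 0 ≤ ε / 50 / (1 - apxRadius p) := div_nonneg (by linarith) (by linarith)
    nlinarith [abs_nonneg (1 - p / 2)]
  have h8 : p / 2 * δ ≤ ε / 32 := by nlinarith
  set a := Real.log (lewisDiag A p (w T) i)
  set b := Real.log (lewisDiag A p (exactRun A p w₀ T) i)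
  set c := Real.log (lewisDiag A p v i)
  -- Three errors: the last leverage scores (`ε/32`), the noisy against the exact run (`ε/25`), and
  -- the exact run against the Lewis weights (`ε/8`). Their sum is below the `ε/2` that the passage
  -- from logarithms to ratios permits.
  have h9 : Real.log (out i) - Real.log (v i)
      = (Real.log (out i) - p / 2 * a) + p / 2 * (a - b) + p / 2 * (b - c) := by
    rw [h4]; ring
  rw [h9]
  refine (abs_add_three _ _ _).trans ?_
  rw [abs_mul (p / 2), abs_mul (p / 2), abs_of_pos (half_pos hp)]
  linarith

end Run

/-! ### Random sign vectors -/

section Signs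

variable {m : ℕ}

/-- The sign vector of a vector of bits. -/
def signVec (b : Fin m → Bool) : Fin m → ℝ := fun i => if b i then 1 else -1

/-- The coordinates are independent, and each contributes `cosh (t x_i) ≤ exp (t² x_i² / 2)`. -/
theorem sum_exp_signVec_le (x : Fin m → ℝ) (t : ℝ) :
    ∑ b : Fin m → Bool, Real.exp (t * (x ⬝ᵥ signVec b))
      ≤ 2 ^ m * Real.exp (t ^ 2 * (x ⬝ᵥ x) / 2) := by
  have h1 : ∀ b : Fin m → Bool, Real.exp (t * (x ⬝ᵥ signVec b))
      = ∏ i, Real.exp (t * (x i * if b i then 1 else -1)) := by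
    intro b
    rw [← Real.exp_sum, dotProduct, Finset.mul_sum]
    rfl
  simp only [h1]
  have h2 := Finset.prod_univ_sum (fun _ : Fin m => (Finset.univ : Finset Bool))
    (fun i β => Real.exp (t * (x i * if β then 1 else -1)))
  rw [Fintype.piFinset_univ] at h2
  rw [← h2]
  calc _ ≤ ∏ i : Fin m, (2 * Real.exp ((t * x i) ^ 2 / 2)) := by
        refine Finset.prod_le_prod (fun i _ => Finset.sum_nonneg fun β _ => (Real.exp_pos _).le)
          fun i _ => ?_
        have h3 := Real.cosh_le_exp_half_sq (t * x i)
        rw [Real.cosh_eq] at h3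
        simp only [Fintype.univ_bool, Finset.mem_singleton, Bool.true_eq_false, not_false_eq_true,
          Finset.sum_insert, Finset.sum_singleton, if_true, Bool.false_eq_true, if_false, mul_one,
          mul_neg]
        linarith
    _ = _ := by
        rw [Finset.prod_mul_distrib, Finset.prod_const, ← Real.exp_sum, Finset.card_univ,
          Fintype.card_fin, dotProduct, Finset.mul_sum, Finset.sum_div]
        congr 2
        exact Finset.sum_congr rfl fun i _ => by ring

theorem integral_exp_mul_gaussian (t : ℝ) :
    MeasureTheory.Integrable (fun g : ℝ => Real.exp (t * g) * Real.exp (-(1 / 2) * g ^ 2)) ∧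
    ∫ g : ℝ, Real.exp (t * g) * Real.exp (-(1 / 2) * g ^ 2)
      = Real.sqrt (Real.pi / (1 / 2)) * Real.exp (t ^ 2 / 2) := by
  have h1 : ∀ g : ℝ, Real.exp (t * g) * Real.exp (-(1 / 2) * g ^ 2)
      = Real.exp (-(1 / 2) * (g - t) ^ 2) * Real.exp (t ^ 2 / 2) := by
    intro g
    rw [← Real.exp_add, ← Real.exp_add]
    congr 1; ring
  simp only [h1]
  refine ⟨((integrable_exp_neg_mul_sq (by norm_num : (0 : ℝ) < 1 / 2)).comp_sub_right t).mul_const _,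
    ?_⟩
  rw [MeasureTheory.integral_mul_const,
    MeasureTheory.integral_sub_right_eq_self (fun g : ℝ => Real.exp (-(1 / 2) * g ^ 2)) t,
    integral_gaussian]

/-- Linearise the square by a Gaussian `g`: `exp (l y²)` is the mean of `exp (√(2l) y g)`.
Exchanging the means reduces to the linear exponential moment, and the remaining Gaussian integral
converges for `l < 1/2`. -/
theorem sum_exp_sq_signVec_le_sqrt {x : Fin m → ℝ} (hx : x ⬝ᵥ x = 1) {l : ℝ} (hl0 : 0 ≤ l)
    (hl : l < 1 / 2) :
    ∑ b : Fin m → Bool, Real.exp (l * (x ⬝ᵥ signVec b) ^ 2)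
      ≤ 2 ^ m * Real.sqrt (1 / (1 - 2 * l)) := by
  have hpi : 0 < Real.sqrt (Real.pi / (1 / 2)) := Real.sqrt_pos.mpr (by positivity)
  refine le_of_mul_le_mul_left ?_ hpi
  set c := Real.sqrt (2 * l) with hc
  have hc2 : c ^ 2 = 2 * l := Real.sq_sqrt (by linarith)
  have hb : 0 < 1 / 2 - l := by linarith
  calc _ = ∑ b : Fin m → Bool, ∫ g : ℝ, Real.exp (c * (x ⬝ᵥ signVec b) * g)
          * Real.exp (-(1 / 2) * g ^ 2) := by
        rw [Finset.mul_sum]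
        refine Finset.sum_congr rfl fun b _ => ?_
        rw [(integral_exp_mul_gaussian _).2, mul_pow, hc2]
        congr 2; ring
    _ = ∫ g : ℝ, ∑ b : Fin m → Bool, Real.exp (c * (x ⬝ᵥ signVec b) * g)
          * Real.exp (-(1 / 2) * g ^ 2) :=
        (MeasureTheory.integral_finsetSum _ fun b _ => (integral_exp_mul_gaussian _).1).symm
    _ ≤ ∫ g : ℝ, 2 ^ m * Real.exp (-(1 / 2 - l) * g ^ 2) := by
        refine MeasureTheory.integral_mono
          (MeasureTheory.integrable_finsetSum _ fun b _ => (integral_exp_mul_gaussian _).1)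
          ((integrable_exp_neg_mul_sq hb).const_mul _) fun g => ?_
        simp only
        rw [← Finset.sum_mul]
        have h1 := sum_exp_signVec_le x (c * g)
        rw [hx, mul_pow, hc2] at h1
        have h2 : ∀ b : Fin m → Bool, c * (x ⬝ᵥ signVec b) * g = c * g * (x ⬝ᵥ signVec b) :=
          fun b => by ring
        simp only [h2]
        refine (mul_le_mul_of_nonneg_right h1 (Real.exp_pos _).le).trans (le_of_eq ?_)
        rw [mul_assoc, ← Real.exp_add]
        congr 2; ring
    _ = _ := by
        rw [MeasureTheory.integral_const_mul, integral_gaussian, ← mul_assoc,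
          mul_comm _ ((2 : ℝ) ^ m), mul_assoc, ← Real.sqrt_mul (by positivity)]
        congr 2
        have : 1 - 2 * l ≠ 0 := by linarith
        have : 1 / 2 - l ≠ 0 := by linarith
        field_simp

theorem sqrt_one_div_le_exp {l : ℝ} (hl0 : 0 ≤ l) (hl : l ≤ 1 / 4) :
    Real.sqrt (1 / (1 - 2 * l)) ≤ Real.exp (l + 2 * l ^ 2) := by
  rw [Real.sqrt_le_left (Real.exp_pos _).le, ← Real.exp_nat_mul, div_le_iff₀ (by linarith)]
  set z := 2 * l with hz
  have h1 := Real.quadratic_le_exp_of_nonneg (x := z + z ^ 2) (by positivity)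
  have h2 : ((2 : ℕ) : ℝ) * (l + 2 * l ^ 2) = z + z ^ 2 := by push_cast; rw [hz]; ring
  rw [h2]
  have hz0 : 0 ≤ z := by positivity
  have hz1 : z ≤ 1 / 2 := by linarith
  have h3 : 1 ≤ (1 + (z + z ^ 2) + (z + z ^ 2) ^ 2 / 2) * (1 - z) := by
    have h4 : 0 ≤ (1 - z) * (1 + z) ^ 2 / 2 - z := by nlinarith
    nlinarith [mul_nonneg (sq_nonneg z) h4]
  exact h3.trans (mul_le_mul_of_nonneg_right h1 (by linarith))

/-- Upper exponential moment of the squared inner product with a random sign vector. -/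
theorem sum_exp_sq_signVec_le {x : Fin m → ℝ} (hx : x ⬝ᵥ x = 1) {l : ℝ} (hl0 : 0 ≤ l)
    (hl : l ≤ 1 / 4) :
    ∑ b : Fin m → Bool, Real.exp (l * (x ⬝ᵥ signVec b) ^ 2)
      ≤ 2 ^ m * Real.exp (l + 2 * l ^ 2) :=
  (sum_exp_sq_signVec_le_sqrt hx hl0 (by linarith)).trans
    (mul_le_mul_of_nonneg_left (sqrt_one_div_le_exp hl0 hl) (by positivity))

theorem sum_signVec_mul_signVec (i j : Fin m) :
    ∑ b : Fin m → Bool, signVec b i * signVec b j = if i = j then 2 ^ m else 0 := by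
  split_ifs with h
  · subst h
    have : ∀ b : Fin m → Bool, signVec b i * signVec b i = 1 := fun b => by
      rw [signVec]; split_ifs <;> norm_num
    simp [this]
  -- Flipping the bit `i` reverses the sign of the product and has no fixed point.
  · refine Finset.sum_involution (fun b _ => Function.update b i (!b i)) (fun b _ => ?_)
      (fun b _ _ => ?_) (fun _ _ => Finset.mem_univ _) (fun b _ => by simp)
    · simp only [signVec, Function.update_self, Function.update_of_ne (Ne.symm h)]
      cases b i <;> cases b j <;> simp
    · intro hb
      have := congrFun hb i
      simp at this

theorem sum_sq_signVec (x : Fin m → ℝ) :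
    ∑ b : Fin m → Bool, (x ⬝ᵥ signVec b) ^ 2 = 2 ^ m * (x ⬝ᵥ x) := by
  have h1 : ∀ b : Fin m → Bool, (x ⬝ᵥ signVec b) ^ 2
      = ∑ i, ∑ j, x i * x j * (signVec b i * signVec b j) := by
    intro b
    rw [sq, dotProduct, Finset.sum_mul_sum]
    exact Finset.sum_congr rfl fun i _ => Finset.sum_congr rfl fun j _ => by ring
  simp only [h1]
  rw [Finset.sum_comm]
  have h2 : ∀ i, ∑ b : Fin m → Bool, ∑ j, x i * x j * (signVec b i * signVec b j)
      = x i * x i * 2 ^ m := by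
    intro i
    rw [Finset.sum_comm]
    simp only [← Finset.mul_sum, sum_signVec_mul_signVec]
    simp
  simp only [h2, dotProduct, Finset.mul_sum]
  exact Finset.sum_congr rfl fun i _ => by ring

/-- Read off from the exponential moment at `l = 1/4`: with `1 + z + z²/2 ≤ exp z` and the known
second moment, `1 + 1/4 + M/32 ≤ √2 ≤ 23/16` for the fourth moment `M`. -/
theorem sum_pow_four_signVec_le {x : Fin m → ℝ} (hx : x ⬝ᵥ x = 1) :
    ∑ b : Fin m → Bool, (x ⬝ᵥ signVec b) ^ 4 ≤ 2 ^ m * 6 := by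
  have h1 := sum_exp_sq_signVec_le_sqrt hx (l := 1 / 4) (by norm_num) (by norm_num)
  have h2 : ∑ b : Fin m → Bool, (1 + 1 / 4 * (x ⬝ᵥ signVec b) ^ 2
      + 1 / 32 * (x ⬝ᵥ signVec b) ^ 4) ≤ 2 ^ m * Real.sqrt (1 / (1 - 2 * (1 / 4))) := by
    refine (Finset.sum_le_sum fun b _ => ?_).trans h1
    have := Real.quadratic_le_exp_of_nonneg (x := 1 / 4 * (x ⬝ᵥ signVec b) ^ 2) (by positivity)
    refine le_trans (le_of_eq ?_) this
    ring
  rw [Finset.sum_add_distrib, Finset.sum_add_distrib, ← Finset.mul_sum, ← Finset.mul_sum,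
    sum_sq_signVec, hx] at h2
  have h3 : Real.sqrt (1 / (1 - 2 * (1 / 4))) ≤ 23 / 16 := by
    rw [Real.sqrt_le_left (by norm_num)]; norm_num
  have h4 : (0 : ℝ) < 2 ^ m := by positivity
  have h5 : ∑ _b : Fin m → Bool, (1 : ℝ) = 2 ^ m := by simp
  rw [h5] at h2
  nlinarith

theorem exp_neg_le_quadratic {x : ℝ} (hx : 0 ≤ x) : Real.exp (-x) ≤ 1 - x + x ^ 2 / 2 := by
  have h1 := Real.quadratic_le_exp_of_nonneg hx
  have h2 : Real.exp (-x) * Real.exp x = 1 := by rw [← Real.exp_add]; simp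
  have h3 : 0 ≤ 1 - x + x ^ 2 / 2 := by nlinarith [sq_nonneg (x - 1)]
  have h4 : 1 ≤ (1 - x + x ^ 2 / 2) * Real.exp x := by
    refine le_trans ?_ (mul_le_mul_of_nonneg_left h1 h3)
    nlinarith [sq_nonneg (x ^ 2)]
  exact le_of_mul_le_mul_right (h2.trans_le h4) (Real.exp_pos x)

/-- Lower exponential moment of the squared inner product with a random sign vector. -/
theorem sum_exp_neg_sq_signVec_le {x : Fin m → ℝ} (hx : x ⬝ᵥ x = 1) {l : ℝ} (hl0 : 0 ≤ l) :
    ∑ b : Fin m → Bool, Real.exp (-(l * (x ⬝ᵥ signVec b) ^ 2))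
      ≤ 2 ^ m * Real.exp (-l + 3 * l ^ 2) := by
  have h1 : ∑ b : Fin m → Bool, Real.exp (-(l * (x ⬝ᵥ signVec b) ^ 2))
      ≤ ∑ b : Fin m → Bool, (1 - l * (x ⬝ᵥ signVec b) ^ 2
        + l ^ 2 / 2 * (x ⬝ᵥ signVec b) ^ 4) := by
    refine Finset.sum_le_sum fun b _ => ?_
    refine (exp_neg_le_quadratic (by positivity)).trans (le_of_eq ?_)
    ring
  rw [Finset.sum_add_distrib, Finset.sum_sub_distrib, ← Finset.mul_sum, ← Finset.mul_sum,
    sum_sq_signVec, hx] at h1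
  have h2 := mul_le_mul_of_nonneg_left (sum_pow_four_signVec_le hx)
    (by positivity : 0 ≤ l ^ 2 / 2)
  have h5 : ∑ _b : Fin m → Bool, (1 : ℝ) = 2 ^ m := by simp
  rw [h5] at h1
  have h3 := Real.add_one_le_exp (-l + 3 * l ^ 2)
  have h4 : (0 : ℝ) < 2 ^ m := by positivity
  nlinarith

end Signs

/-! ### Expectations over the runs of a program -/

section Machine

open scoped ENNReal

variable {m n : ℕ} {A : Matrix (Fin m) (Fin n) ℝ}

/-- Expectation of a nonnegative function. -/
noncomputable def PMF.expect {α : Type*} (μ : PMF α) (f : α → ℝ≥0∞) : ℝ≥0∞ := ∑' a, μ a * f a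

theorem PMF.expect_pure {α : Type*} (a : α) (f : α → ℝ≥0∞) : (PMF.pure a).expect f = f a := by
  rw [PMF.expect, tsum_eq_single a]
  · simp
  · intro b hb
    simp [hb]

theorem PMF.expect_bind {α β : Type*} (μ : PMF α) (ν : α → PMF β) (f : β → ℝ≥0∞) :
    (μ.bind ν).expect f = μ.expect fun a => (ν a).expect f := by
  simp only [PMF.expect, PMF.bind_apply, ← ENNReal.tsum_mul_right, ← ENNReal.tsum_mul_left]
  rw [ENNReal.tsum_comm]
  simp only [mul_assoc]

theorem PMF.expect_map {α β : Type*} (μ : PMF α) (g : α → β) (f : β → ℝ≥0∞) :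
    (μ.map g).expect f = μ.expect fun a => f (g a) := by
  rw [← PMF.bind_pure_comp, PMF.expect_bind]
  simp only [Function.comp, PMF.expect_pure]

theorem PMF.expect_mono {α : Type*} (μ : PMF α) {f g : α → ℝ≥0∞} (h : ∀ a, f a ≤ g a) :
    μ.expect f ≤ μ.expect g :=
  ENNReal.tsum_le_tsum fun a => mul_le_mul_right (h a) _

theorem PMF.expect_add {α : Type*} (μ : PMF α) (f g : α → ℝ≥0∞) :
    μ.expect (fun a => f a + g a) = μ.expect f + μ.expect g := by
  simp only [PMF.expect, mul_add, ENNReal.tsum_add]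

theorem PMF.expect_const {α : Type*} (μ : PMF α) (c : ℝ≥0∞) : μ.expect (fun _ => c) = c := by
  rw [PMF.expect, ENNReal.tsum_mul_right, μ.tsum_coe, one_mul]

theorem PMF.toOuterMeasure_eq_expect {α : Type*} (μ : PMF α) (E : Set α) :
    μ.toOuterMeasure E = μ.expect (E.indicator 1) := by
  rw [PMF.toOuterMeasure_apply, PMF.expect]
  refine tsum_congr fun a => ?_
  by_cases h : a ∈ E <;> simp [h]

/-- Expectation of `f` over the states reached from `S` by executing `cs`. -/
noncomputable def wp (A : Matrix (Fin m) (Fin n) ℝ) (cs : List (Instr m n))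
    (f : MachineState m n → ℝ≥0∞) (S : MachineState m n) : ℝ≥0∞ :=
  (List.foldlM (fun S c => Instr.run A S c) S cs).expect f

theorem wp_nil (f : MachineState m n → ℝ≥0∞) (S : MachineState m n) : wp A [] f S = f S :=
  PMF.expect_pure S f

theorem wp_cons (c : Instr m n) (cs : List (Instr m n)) (f : MachineState m n → ℝ≥0∞)
    (S : MachineState m n) : wp A (c :: cs) f S = (Instr.run A S c).expect (wp A cs f) := by
  rw [wp, List.foldlM_cons]
  exact PMF.expect_bind _ _ _

theorem wp_append (cs ds : List (Instr m n)) (f : MachineState m n → ℝ≥0∞)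
    (S : MachineState m n) : wp A (cs ++ ds) f S = wp A cs (wp A ds f) S := by
  rw [wp, List.foldlM_append]
  exact PMF.expect_bind _ _ _

theorem wp_mulVec (dst x : ℕ) (cs : List (Instr m n)) (f : MachineState m n → ℝ≥0∞)
    (S : MachineState m n) :
    wp A (.mulVec dst x :: cs) f S = wp A cs f (S.setRow dst (A *ᵥ S.col x)) := by
  rw [wp_cons]; exact PMF.expect_pure _ _

theorem wp_transMulVec (dst y : ℕ) (cs : List (Instr m n)) (f : MachineState m n → ℝ≥0∞)
    (S : MachineState m n) :
    wp A (.transMulVec dst y :: cs) f S = wp A cs f (S.setCol dst (Aᵀ *ᵥ S.row y)) := by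
  rw [wp_cons]; exact PMF.expect_pure _ _

theorem wp_solve (dst d z : ℕ) (cs : List (Instr m n)) (f : MachineState m n → ℝ≥0∞)
    (S : MachineState m n) :
    wp A (.solve dst d z :: cs) f S
      = wp A cs f (S.setCol dst (solveSystem A (S.row d) (S.col z))) := by
  rw [wp_cons]; exact PMF.expect_pure _ _

theorem wp_rowConst (dst : ℕ) (v : Fin m → ℝ) (cs : List (Instr m n))
    (f : MachineState m n → ℝ≥0∞) (S : MachineState m n) :
    wp A (.rowConst dst v :: cs) f S = wp A cs f (S.setRow dst v) := by
  rw [wp_cons]; exact PMF.expect_pure _ _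

theorem wp_colConst (dst : ℕ) (v : Fin n → ℝ) (cs : List (Instr m n))
    (f : MachineState m n → ℝ≥0∞) (S : MachineState m n) :
    wp A (.colConst dst v :: cs) f S = wp A cs f (S.setCol dst v) := by
  rw [wp_cons]; exact PMF.expect_pure _ _

theorem wp_rowOp (op : ScalarOp) (dst x y : ℕ) (cs : List (Instr m n))
    (f : MachineState m n → ℝ≥0∞) (S : MachineState m n) :
    wp A (.rowOp op dst x y :: cs) f S
      = wp A cs f (S.setRow dst fun i => op.eval (S.row x i) (S.row y i)) := by
  rw [wp_cons]; exact PMF.expect_pure _ _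

theorem wp_rowPow (dst x : ℕ) (a : ℝ) (cs : List (Instr m n))
    (f : MachineState m n → ℝ≥0∞) (S : MachineState m n) :
    wp A (.rowPow dst x a :: cs) f S = wp A cs f (S.setRow dst fun i => S.row x i ^ a) := by
  rw [wp_cons]; exact PMF.expect_pure _ _

theorem wp_signs (dst : ℕ) (cs : List (Instr m n)) (f : MachineState m n → ℝ≥0∞)
    (S : MachineState m n) :
    wp A (.signs dst :: cs) f S
      = ∑ b : Fin m → Bool, ENNReal.ofReal (2 ^ m)⁻¹ * wp A cs f (S.setRow dst (signVec b)) := by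
  rw [wp_cons, Instr.run, PMF.expect_map, PMF.expect, tsum_fintype]
  refine Finset.sum_congr rfl fun b _ => ?_
  congr 1
  rw [PMF.uniformOfFintype_apply, Fintype.card_fun, Fintype.card_bool, Fintype.card_fin,
    ENNReal.ofReal_inv_of_pos (by positivity), ENNReal.ofReal_pow (by norm_num)]
  simp

theorem MachineState.setRow_row (S : MachineState m n) (k : ℕ) (v : Fin m → ℝ) (j : ℕ) :
    (S.setRow k v).row j = if j = k then v else S.row j := by
  simp [MachineState.setRow, Function.update_apply]

theorem MachineState.setRow_col (S : MachineState m n) (k : ℕ) (v : Fin m → ℝ) :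
    (S.setRow k v).col = S.col := rfl

theorem MachineState.setCol_col (S : MachineState m n) (k : ℕ) (v : Fin n → ℝ) (j : ℕ) :
    (S.setCol k v).col j = if j = k then v else S.col j := by
  simp [MachineState.setCol, Function.update_apply]

theorem MachineState.setCol_row (S : MachineState m n) (k : ℕ) (v : Fin n → ℝ) :
    (S.setCol k v).row = S.row := rfl

/-- From every state satisfying `pre`, executing `cs` leads to a state satisfying `post`, except
with probability at most `q`. -/
def Hoare (A : Matrix (Fin m) (Fin n) ℝ) (pre : MachineState m n → Prop) (cs : List (Instr m n))
    (post : MachineState m n → Prop) (q : ℝ≥0∞) : Prop :=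
  ∀ S, pre S → wp A cs ({S' | ¬ post S'}.indicator 1) S ≤ q

variable {pre mid post : MachineState m n → Prop} {cs ds : List (Instr m n)} {q r : ℝ≥0∞}

/-- A union bound: final failure is charged either to failure at the intermediate assertion or to
the second program. -/
theorem Hoare.seq (h : Hoare A pre cs mid q) (h' : Hoare A mid ds post r) :
    Hoare A pre (cs ++ ds) post (q + r) := by
  intro S hS
  rw [wp_append]
  calc _ ≤ wp A cs (fun S' => {S' | ¬ mid S'}.indicator 1 S' + r) S := by
        refine PMF.expect_mono _ fun S' => ?_
        by_cases hm : mid S'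
        · exact (h' S' hm).trans le_add_self
        · refine le_trans ?_ le_self_add
          rw [Set.indicator_of_mem (show S' ∈ {S' | ¬ mid S'} from hm)]
          calc _ ≤ wp A ds (fun _ => 1) S' :=
                PMF.expect_mono _ fun S'' => Set.indicator_le_self' (fun _ _ => zero_le_one) S''
            _ = 1 := PMF.expect_const _ _
            _ = _ := rfl
    _ = wp A cs ({S' | ¬ mid S'}.indicator 1) S + r := by
        rw [wp, PMF.expect_add, PMF.expect_const]; rfl
    _ ≤ q + r := add_le_add_left (h S hS) r

theorem Hoare.mono_right (h : Hoare A pre cs mid q) (hp : ∀ S, mid S → post S) :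
    Hoare A pre cs post q := by
  intro S hS
  refine le_trans (PMF.expect_mono _ fun S' => ?_) (h S hS)
  have hsub : {S' | ¬ post S'} ⊆ {S' | ¬ mid S'} := fun S'' h1 h2 => h1 (hp S'' h2)
  exact Set.indicator_le_indicator_of_subset hsub (fun _ => zero_le_one) S'

theorem Hoare.mono_prob (h : Hoare A pre cs post q) (hq : q ≤ r) : Hoare A pre cs post r :=
  fun S hS => (h S hS).trans hq

theorem Hoare.nil (pre : MachineState m n → Prop) : Hoare A pre [] pre 0 := by
  intro S hS
  rw [wp_nil, Set.indicator_of_notMem (by simpa using hS)]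

theorem Hoare.iterate {I : ℕ → MachineState m n → Prop} (k : ℕ)
    (h : ∀ j < k, Hoare A (I j) cs (I (j + 1)) q) :
    Hoare A (I 0) (List.replicate k cs).flatten (I k) (k * q) := by
  induction k with
  | zero => simpa using Hoare.nil (A := A) (I 0)
  | succ k ih =>
    rw [List.replicate_succ', List.flatten_append, List.flatten_singleton]
    have := (ih fun j hj => h j (by omega)).seq (h k (by omega))
    refine this.mono_prob (le_of_eq ?_)
    push_cast
    ring

/-- A Hoare triple bounds the probability of the output from below. -/
theorem Hoare.le_prob {P : Program m n} {input : Fin m → ℝ} {E : Set (Fin m → ℝ)} {c : ℝ}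
    (h : Hoare A (fun S => S.row 0 = input) P.flatten (fun S => S.row 0 ∈ E) (ENNReal.ofReal c))
    (hc : 0 ≤ c) : 1 - c ≤ P.prob A input E := by
  rw [Program.prob, PMF.toOuterMeasure_eq_expect]
  set μ := P.output A input with hμ
  have h1 : μ.expect (E.indicator 1) + μ.expect (Eᶜ.indicator 1) = 1 := by
    rw [← PMF.expect_add, ← PMF.expect_const μ 1]
    congr 1
    funext a
    by_cases ha : a ∈ E <;> simp [ha]
  have h2 : μ.expect (Eᶜ.indicator 1) ≤ ENNReal.ofReal c := by
    rw [hμ, Program.output, PMF.expect_map]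
    have h0 := h (MachineState.setRow ⟨fun _ => 0, fun _ => 0⟩ 0 input)
      (by simp [MachineState.setRow])
    exact le_trans (le_of_eq rfl) h0
  have h3 : μ.expect (E.indicator 1) ≠ ⊤ := fun hh => by simp [hh] at h1
  have h4 : 1 ≤ (μ.expect (E.indicator 1)).toReal + c := by
    rw [← ENNReal.toReal_ofReal hc, ← ENNReal.toReal_add h3 ENNReal.ofReal_ne_top,
      ← ENNReal.toReal_one]
    refine ENNReal.toReal_mono (ENNReal.add_ne_top.mpr ⟨h3, ENNReal.ofReal_ne_top⟩) ?_
    rw [← h1]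
    gcongr
  linarith

end Machine

/-! ### Computing leverage scores on the machine -/

section Blocks

open scoped ENNReal

variable {m n : ℕ} {A : Matrix (Fin m) (Fin n) ℝ} {p : ℝ}

/-- Row register `3` gets `w ^ (1/2 - 1/p)`, register `4` its square, the accumulator `2` zero,
where `w` is in register `1`. -/
noncomputable def prepStep (m n : ℕ) (p : ℝ) : Step m n :=
  [.rowPow 3 1 (1 / 2 - 1 / p), .rowOp .mul 4 3 3, .rowConst 2 0]

/-- Adds the squares of the projection of a random sign vector to the accumulator. -/
def sampleStep (m n : ℕ) : Step m n :=
  [.signs 5, .rowOp .mul 6 3 5, .transMulVec 0 6, .solve 1 4 0, .mulVec 7 1, .rowOp .mul 8 3 7,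
    .rowOp .mul 9 8 8, .rowOp .add 2 2 9]

/-- Divides the accumulator by the number of samples. -/
noncomputable def averageStep (m n k : ℕ) : Step m n :=
  [.rowConst 5 fun _ => k, .rowOp .div 2 2 5]

/-- Approximate leverage scores from `k` random sign vectors. -/
noncomputable def sketchBlock (m n : ℕ) (p : ℝ) (k : ℕ) : Program m n :=
  prepStep m n p :: (List.replicate k (sampleStep m n) ++ [averageStep m n k])

/-- Adds the contribution of one column to the accumulator. -/
noncomputable def columnStep (m n : ℕ) (l : Fin n) : Step m n :=
  [.colConst 0 (Pi.single l 1), .solve 1 4 0, .mulVec 7 1, .mulVec 6 0, .rowOp .mul 8 6 7,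
    .rowOp .add 2 2 8]

/-- Multiplies the accumulator by the density. -/
def scaleStep (m n : ℕ) : Step m n := [.rowOp .mul 2 4 2]

/-- Exact leverage scores from `n` calls of the solver. -/
noncomputable def exactBlock (m n : ℕ) (p : ℝ) : Program m n :=
  prepStep m n p :: ((List.finRange n).map (columnStep m n) ++ [scaleStep m n])

/-- The state after `prepStep`. -/
def Prepared (p : ℝ) (v₀ w : Fin m → ℝ) (S : MachineState m n) : Prop :=
  S.row 0 = v₀ ∧ S.row 1 = w ∧ (S.row 3 = fun i => w i ^ (1 / 2 - 1 / p)) ∧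
    S.row 4 = lewisDensity p w

theorem hoare_prepStep {v₀ w : Fin m → ℝ} (hw : ∀ i, 0 < w i) :
    Hoare A (fun S => S.row 0 = v₀ ∧ S.row 1 = w) (prepStep m n p)
      (fun S => Prepared p v₀ w S ∧ S.row 2 = 0) 0 := by
  rintro S ⟨h0, h1⟩
  simp only [prepStep, wp_rowPow, wp_rowOp, wp_rowConst, wp_nil]
  rw [Set.indicator_of_notMem]
  simp only [Set.mem_ofPred_eq, not_not, Prepared, MachineState.setRow_row, ScalarOp.eval]
  norm_num [h0, h1]
  funext i
  rw [← sq_rpow_half_sub hw, sq]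
  norm_num

/-- The projection matrix of `W ^ (1/2 - 1/p) A`, as rows. -/
noncomputable def projRow (A : Matrix (Fin m) (Fin n) ℝ) (p : ℝ) (w : Fin m → ℝ) (i : Fin m) :
    Fin m → ℝ :=
  fun j => w i ^ (1 / 2 - 1 / p) * levKernel A (lewisDensity p w) i j * w j ^ (1 / 2 - 1 / p)

/-- For an orthogonal projection the diagonal entry equals the squared length of the row. Hence the
squared inner product of the row with a random sign vector is an unbiased estimate of the leverage
score. -/
theorem NonDegenerate.projRow_dotProduct_self (hA : NonDegenerate A) {w : Fin m → ℝ}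
    (hw : ∀ i, 0 < w i) (i : Fin m) :
    projRow A p w i ⬝ᵥ projRow A p w i = leverageScores (reweight A p w) i := by
  rw [leverageScores_reweight hw, lewisDiag, ← hA.sum_levKernel_sq (lewisDensity_pos hw),
    Finset.mul_sum, dotProduct]
  refine Finset.sum_congr rfl fun j _ => ?_
  rw [← sq_rpow_half_sub hw i, ← sq_rpow_half_sub hw j, projRow]
  ring

/-- Stated for an arbitrary continuation `ds` with bound `F`, since an exponential moment, and not
just a failure event, has to be carried backwards through the samples. -/
theorem wp_sampleStep {v₀ w : Fin m → ℝ} (hw : ∀ i, 0 < w i)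
    {ds : List (Instr m n)} {f : MachineState m n → ℝ≥0∞} {F : (Fin m → ℝ) → ℝ≥0∞}
    (hF : ∀ S, Prepared p v₀ w S → wp A ds f S ≤ F (S.row 2)) {S : MachineState m n}
    (hS : Prepared p v₀ w S) :
    wp A (sampleStep m n ++ ds) f S ≤ ∑ b : Fin m → Bool, ENNReal.ofReal (2 ^ m)⁻¹ *
      F (fun i => S.row 2 i + (projRow A p w i ⬝ᵥ signVec b) ^ 2) := by
  obtain ⟨h0, h1, h3, h4⟩ := hS
  rw [sampleStep, List.cons_append, wp_signs]
  refine Finset.sum_le_sum fun b _ => mul_le_mul_right ?_ _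
  simp only [List.cons_append, List.nil_append, wp_rowOp, wp_transMulVec, wp_solve, wp_mulVec]
  refine (hF _ ?_).trans (le_of_eq ?_)
  · simp only [Prepared, MachineState.setRow_row, MachineState.setCol_row]
    norm_num [h0, h1, h3, h4]
  · congr 1
    funext i
    simp only [MachineState.setRow_row, MachineState.setCol_row, MachineState.setRow_col,
      MachineState.setCol_col, ScalarOp.eval]
    norm_num [h3, h4]
    rw [solveSystem, if_pos (lewisDensity_pos hw), ← sq]
    congr 1
    rw [Matrix.mulVec_mulVec, Matrix.mulVec_mulVec]
    simp only [Matrix.mulVec, dotProduct, projRow, Finset.mul_sum]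
    refine Finset.sum_congr rfl fun j _ => ?_
    rw [levKernel]
    norm_num
    ring

/-- The potential that controls the upper and the lower tail of the accumulator. -/
noncomputable def sketchPotential (σ : Fin m → ℝ) (l u c d : ℝ) (k : ℕ) (a : Fin m → ℝ) : ℝ :=
  ∑ i, (Real.exp (k * (l + 2 * l ^ 2) + c) * Real.exp (l * (a i / σ i))
    + Real.exp (k * (-u + 3 * u ^ 2) + d) * Real.exp (-(u * (a i / σ i))))

theorem sketchPotential_nonneg (σ : Fin m → ℝ) (l u c d : ℝ) (k : ℕ) (a : Fin m → ℝ) :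
    0 ≤ sketchPotential σ l u c d k a :=
  Finset.sum_nonneg fun i _ => by positivity

/-- The supermartingale property: averaging over one sign vector multiplies the two exponentials by
at most `exp (l + 2 l²)` and `exp (-u + 3 u²)`, exactly the prefactors by which the index `k` grows.
-/
theorem sum_sketchPotential_le {σ : Fin m → ℝ} (hσ : ∀ i, 0 < σ i) {P : Fin m → Fin m → ℝ}
    (hP : ∀ i, P i ⬝ᵥ P i = σ i) {l u : ℝ} (hl0 : 0 ≤ l) (hl : l ≤ 1 / 4) (hu0 : 0 ≤ u)
    (c d : ℝ) (k : ℕ) (a : Fin m → ℝ) :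
    ∑ b : Fin m → Bool, (2 ^ m)⁻¹ *
        sketchPotential σ l u c d k (fun i => a i + (P i ⬝ᵥ signVec b) ^ 2)
      ≤ sketchPotential σ l u c d (k + 1) a := by
  rw [← Finset.mul_sum]
  simp only [sketchPotential]
  rw [Finset.sum_comm, Finset.mul_sum]
  refine Finset.sum_le_sum fun i _ => ?_
  set x : Fin m → ℝ := fun j => P i j / Real.sqrt (σ i) with hx
  have hs : 0 < Real.sqrt (σ i) := Real.sqrt_pos.mpr (hσ i)
  have hx1 : x ⬝ᵥ x = 1 := by
    have : x ⬝ᵥ x = (P i ⬝ᵥ P i) / σ i := by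
      rw [dotProduct, dotProduct, Finset.sum_div]
      refine Finset.sum_congr rfl fun j _ => ?_
      rw [hx, div_mul_div_comm, Real.mul_self_sqrt (hσ i).le]
    rw [this, hP, div_self (hσ i).ne']
  have hdot : ∀ b : Fin m → Bool, (P i ⬝ᵥ signVec b) ^ 2 / σ i = (x ⬝ᵥ signVec b) ^ 2 := by
    intro b
    have : x ⬝ᵥ signVec b = (P i ⬝ᵥ signVec b) / Real.sqrt (σ i) := by
      rw [dotProduct, dotProduct, Finset.sum_div]
      exact Finset.sum_congr rfl fun j _ => by rw [hx]; ring
    rw [this, div_pow, Real.sq_sqrt (hσ i).le]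
  have h1 := sum_exp_sq_signVec_le hx1 hl0 hl
  have h2 := sum_exp_neg_sq_signVec_le hx1 hu0
  have e1 : ∀ b : Fin m → Bool, Real.exp (l * ((a i + (P i ⬝ᵥ signVec b) ^ 2) / σ i))
      = Real.exp (l * (a i / σ i)) * Real.exp (l * (x ⬝ᵥ signVec b) ^ 2) := by
    intro b
    rw [← Real.exp_add, add_div, hdot]; congr 1; ring
  have e2 : ∀ b : Fin m → Bool, Real.exp (-(u * ((a i + (P i ⬝ᵥ signVec b) ^ 2) / σ i)))
      = Real.exp (-(u * (a i / σ i))) * Real.exp (-(u * (x ⬝ᵥ signVec b) ^ 2)) := by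
    intro b
    rw [← Real.exp_add, add_div, hdot]; congr 1; ring
  simp only [e1, e2, Finset.sum_add_distrib, ← mul_assoc, ← Finset.mul_sum]
  have hm : (0 : ℝ) < 2 ^ m := by positivity
  have f1 : Real.exp ((k + 1 : ℕ) * (l + 2 * l ^ 2) + c)
      = Real.exp (k * (l + 2 * l ^ 2) + c) * Real.exp (l + 2 * l ^ 2) := by
    rw [← Real.exp_add]; congr 1; push_cast; ring
  have f2 : Real.exp ((k + 1 : ℕ) * (-u + 3 * u ^ 2) + d)
      = Real.exp (k * (-u + 3 * u ^ 2) + d) * Real.exp (-u + 3 * u ^ 2) := by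
    rw [← Real.exp_add]; congr 1; push_cast; ring
  rw [f1, f2, inv_mul_le_iff₀ hm]
  have g1 := mul_le_mul_of_nonneg_left h1 (mul_nonneg (Real.exp_pos (k * (l + 2 * l ^ 2) + c)).le
    (Real.exp_pos (l * (a i / σ i))).le)
  have g2 := mul_le_mul_of_nonneg_left h2 (mul_nonneg (Real.exp_pos (k * (-u + 3 * u ^ 2) + d)).le
    (Real.exp_pos (-(u * (a i / σ i)))).le)
  linarith

theorem wp_samples {v₀ w : Fin m → ℝ} (hA : NonDegenerate A) (hw : ∀ i, 0 < w i) {l u : ℝ}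
    (hl0 : 0 ≤ l) (hl : l ≤ 1 / 4) (hu0 : 0 ≤ u) (c d : ℝ) {ds : List (Instr m n)}
    {f : MachineState m n → ℝ≥0∞}
    (hf : ∀ S, Prepared p v₀ w S → wp A ds f S
      ≤ ENNReal.ofReal (sketchPotential (leverageScores (reweight A p w)) l u c d 0 (S.row 2)))
    (k : ℕ) (S : MachineState m n) (hS : Prepared p v₀ w S) :
    wp A ((List.replicate k (sampleStep m n)).flatten ++ ds) f S
      ≤ ENNReal.ofReal (sketchPotential (leverageScores (reweight A p w)) l u c d k (S.row 2)) := by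
  induction k generalizing S with
  | zero => simpa using hf S hS
  | succ k ih =>
    rw [List.replicate_succ, List.flatten_cons, List.append_assoc]
    refine (wp_sampleStep (F := fun a => ENNReal.ofReal
      (sketchPotential (leverageScores (reweight A p w)) l u c d k a)) hw ih hS).trans ?_
    have hnn : ∀ b : Fin m → Bool, 0 ≤ (2 ^ m : ℝ)⁻¹ *
        sketchPotential (leverageScores (reweight A p w)) l u c d k
          (fun i => S.row 2 i + (projRow A p w i ⬝ᵥ signVec b) ^ 2) :=
      fun b => mul_nonneg (by positivity) (sketchPotential_nonneg _ _ _ _ _ _ _)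
    simp only [← ENNReal.ofReal_mul (show (0 : ℝ) ≤ (2 ^ m)⁻¹ by positivity)]
    rw [← ENNReal.ofReal_sum_of_nonneg fun b _ => hnn b]
    exact ENNReal.ofReal_le_ofReal (sum_sketchPotential_le
      (hA.leverageScores_reweight_pos hw) (hA.projRow_dotProduct_self hw) hl0 hl hu0 c d k _)

/-- The registers `0` and `1` are kept and register `2` holds approximate leverage scores. -/
def LevPost (A : Matrix (Fin m) (Fin n) ℝ) (p δ : ℝ) (v₀ w : Fin m → ℝ)
    (S : MachineState m n) : Prop :=
  S.row 0 = v₀ ∧ S.row 1 = w ∧ ApxLeverage δ (reweight A p w) (S.row 2)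

/-- The offsets put the thresholds at `k (1 + δ)` and `k (1 - δ/2)`. By `exp δ ≥ 1 + δ` and `exp
(-δ) ≤ 1 - δ/2`, a miss in coordinate `i` crosses one of them and makes the corresponding
exponential at least `1`. -/
theorem one_le_sketchPotential {σ a : Fin m → ℝ} (hσ : ∀ i, 0 < σ i) {δ : ℝ} (hδ : 0 < δ)
    (hδ1 : δ ≤ 1) {k : ℕ} (hk : 0 < k) {i : Fin m}
    (h : ¬ (Real.exp (-δ) * σ i ≤ a i / k ∧ a i / k ≤ Real.exp δ * σ i)) :
    1 ≤ sketchPotential σ (δ / 4) (δ / 12) (-(δ / 4 * (k * (1 + δ)))) (δ / 12 * (k * (1 - δ / 2)))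
      0 a := by
  have hk' : (0 : ℝ) < k := by exact_mod_cast hk
  rw [sketchPotential]
  refine le_trans ?_ (Finset.single_le_sum (f := fun i => _)
    (fun i _ => by positivity) (Finset.mem_univ i))
  simp only [← Real.exp_add]
  push_cast
  rcases not_and_or.mp h with h1 | h1
  · refine le_trans ?_ (le_add_of_nonneg_left (Real.exp_pos _).le)
    refine Real.one_le_exp ?_
    have h2 : Real.exp (-δ) ≤ 1 - δ / 2 := by
      have := exp_neg_le_quadratic hδ.le
      nlinarith
    have h3 : a i / σ i ≤ k * (1 - δ / 2) := by
      rw [not_le, div_lt_iff₀ hk'] at h1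
      rw [div_le_iff₀ (hσ i)]
      have := mul_le_mul_of_nonneg_right h2 (mul_nonneg (hσ i).le hk'.le)
      linarith
    have := mul_le_mul_of_nonneg_left h3 (by positivity : 0 ≤ δ / 12)
    linarith
  · refine le_trans ?_ (le_add_of_nonneg_right (Real.exp_pos _).le)
    refine Real.one_le_exp ?_
    have h2 := Real.add_one_le_exp δ
    have h3 : k * (1 + δ) ≤ a i / σ i := by
      rw [not_le, lt_div_iff₀ hk'] at h1
      rw [le_div_iff₀ (hσ i)]
      have := mul_le_mul_of_nonneg_right h2 (mul_nonneg (hσ i).le hk'.le)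
      linarith
    have := mul_le_mul_of_nonneg_left h3 (by positivity : 0 ≤ δ / 4)
    linarith

/-- With `l = δ/4` the upper exponent is `-k δ²/8`; with `u = δ/12` the lower one is exactly `-k
δ²/48`. -/
theorem sketchPotential_zero_le (σ : Fin m → ℝ) {δ : ℝ} (k : ℕ) :
    sketchPotential σ (δ / 4) (δ / 12) (-(δ / 4 * (k * (1 + δ)))) (δ / 12 * (k * (1 - δ / 2)))
      k 0 ≤ 2 * m * Real.exp (-(k * δ ^ 2 / 48)) := by
  have h : ∀ i ∈ (Finset.univ : Finset (Fin m)),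
      Real.exp (k * (δ / 4 + 2 * (δ / 4) ^ 2) + -(δ / 4 * (k * (1 + δ))))
        * Real.exp (δ / 4 * ((0 : Fin m → ℝ) i / σ i))
      + Real.exp (k * (-(δ / 12) + 3 * (δ / 12) ^ 2) + δ / 12 * (k * (1 - δ / 2)))
        * Real.exp (-(δ / 12 * ((0 : Fin m → ℝ) i / σ i)))
      ≤ 2 * Real.exp (-(k * δ ^ 2 / 48)) := by
    intro i _
    simp only [Pi.zero_apply, zero_div, mul_zero, neg_zero, Real.exp_zero, mul_one]
    have h0 : 0 ≤ (k : ℝ) * δ ^ 2 := by positivity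
    have h1 : Real.exp (k * (δ / 4 + 2 * (δ / 4) ^ 2) + -(δ / 4 * (k * (1 + δ))))
        ≤ Real.exp (-(k * δ ^ 2 / 48)) := by
      rw [Real.exp_le_exp]; linarith
    have h2 : Real.exp (k * (-(δ / 12) + 3 * (δ / 12) ^ 2) + δ / 12 * (k * (1 - δ / 2)))
        ≤ Real.exp (-(k * δ ^ 2 / 48)) := by
      rw [Real.exp_le_exp]; linarith
    linarith
  refine (Finset.sum_le_sum h).trans (le_of_eq ?_)
  rw [Finset.sum_const, Finset.card_univ, Fintype.card_fin, nsmul_eq_mul]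
  ring

/-- The sketch yields approximate leverage scores with high probability. -/
theorem hoare_sketchBlock {v₀ w : Fin m → ℝ} (hA : NonDegenerate A) (hw : ∀ i, 0 < w i) {δ : ℝ}
    (hδ : 0 < δ) (hδ1 : δ ≤ 1) {k : ℕ} (hk : 0 < k) :
    Hoare A (fun S => S.row 0 = v₀ ∧ S.row 1 = w) (sketchBlock m n p k).flatten
      (LevPost A p δ v₀ w) (ENNReal.ofReal (2 * m * Real.exp (-(k * δ ^ 2 / 48)))) := by
  rw [sketchBlock, List.flatten_cons, List.flatten_append, List.flatten_singleton]
  rw [← zero_add (ENNReal.ofReal _)]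
  refine (hoare_prepStep hw).seq fun S hS => ?_
  have hσ := hA.leverageScores_reweight_pos (p := p) hw
  have key := wp_samples (v₀ := v₀) (ds := averageStep m n k)
    (f := {S' | ¬ LevPost A p δ v₀ w S'}.indicator 1) hA hw (l := δ / 4) (u := δ / 12)
    (by positivity) (by linarith) (by positivity) (-(δ / 4 * (k * (1 + δ))))
    (δ / 12 * (k * (1 - δ / 2))) ?_ k S hS.1
  · rw [hS.2] at key
    exact key.trans (ENNReal.ofReal_le_ofReal (sketchPotential_zero_le _ k))
  · rintro S' ⟨h0, h1, -, -⟩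
    simp only [averageStep, wp_rowConst, wp_rowOp, wp_nil]
    -- Markov's inequality in pointwise form: the indicator of failure is at most the potential with
    -- no samples left.
    by_cases hbad : ((S'.setRow 5 fun _ => (k : ℝ)).setRow 2 fun i => ScalarOp.div.eval
        ((S'.setRow 5 fun _ => (k : ℝ)).row 2 i) ((S'.setRow 5 fun _ => (k : ℝ)).row 5 i))
        ∈ {S' | ¬ LevPost A p δ v₀ w S'}
    · rw [Set.indicator_of_mem hbad, Pi.one_apply, ← ENNReal.ofReal_one]
      refine ENNReal.ofReal_le_ofReal ?_
      simp only [Set.mem_ofPred_eq, LevPost, MachineState.setRow_row, ScalarOp.eval] at hbad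
      norm_num [h0, h1, ApxLeverage] at hbad
      obtain ⟨i, hi⟩ := hbad
      refine one_le_sketchPotential (i := i) hσ hδ hδ1 hk ?_
      rintro ⟨hi1, hi2⟩
      exact absurd hi2 (not_le.mpr (hi hi1))
    · rw [Set.indicator_of_notMem hbad]
      exact zero_le

/-- The diagonal entry is `∑ₗ A_il (A (Aᵀ D A)⁻¹)_il`, and one solve with a unit vector yields the
column `l` of the second factor. -/
theorem hoare_columnSteps {v₀ w : Fin m → ℝ} (hw : ∀ i, 0 < w i) (ls : List (Fin n))
    (a : Fin m → ℝ) :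
    Hoare A (fun S => Prepared p v₀ w S ∧ S.row 2 = a) (ls.map (columnStep m n)).flatten
      (fun S => Prepared p v₀ w S ∧ S.row 2 = fun i => a i + (ls.map fun l => A i l *
        (A * (Aᵀ * Matrix.diagonal (lewisDensity p w) * A)⁻¹) i l).sum) 0 := by
  induction ls generalizing a with
  | nil => simpa using Hoare.nil (A := A) _
  | cons l ls ih =>
    rw [List.map_cons, List.flatten_cons, ← zero_add (0 : ℝ≥0∞)]
    have hstep : Hoare A (fun S => Prepared p v₀ w S ∧ S.row 2 = a) (columnStep m n l)
        (fun S => Prepared p v₀ w S ∧ S.row 2 = fun i => a i + A i l *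
          (A * (Aᵀ * Matrix.diagonal (lewisDensity p w) * A)⁻¹) i l) 0 := by
      rintro S ⟨⟨h0, h1, h3, h4⟩, h2⟩
      simp only [columnStep, wp_colConst, wp_solve, wp_mulVec, wp_rowOp, wp_nil]
      rw [Set.indicator_of_notMem]
      simp only [Set.mem_ofPred_eq, not_not, Prepared, MachineState.setRow_row,
        MachineState.setCol_row, MachineState.setRow_col, MachineState.setCol_col, ScalarOp.eval]
      norm_num [h0, h1, h2, h3, h4]
      funext i
      rw [solveSystem, if_pos (lewisDensity_pos hw), Matrix.mulVec_mulVec,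
        Matrix.mulVec_single_one, Matrix.col_apply]
    refine (hstep.seq (ih _)).mono_right ?_
    rintro S ⟨hS, h2⟩
    refine ⟨hS, ?_⟩
    rw [h2]
    funext i
    rw [List.map_cons, List.sum_cons, add_assoc]

theorem hoare_exactBlock {v₀ w : Fin m → ℝ} (hw : ∀ i, 0 < w i) :
    Hoare A (fun S => S.row 0 = v₀ ∧ S.row 1 = w) (exactBlock m n p).flatten
      (LevPost A p 0 v₀ w) 0 := by
  rw [exactBlock, List.flatten_cons, List.flatten_append, List.flatten_singleton,
    ← zero_add (0 : ℝ≥0∞)]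
  refine (hoare_prepStep hw).seq ?_
  rw [← zero_add (0 : ℝ≥0∞)]
  refine (hoare_columnSteps hw _ 0).seq ?_
  rintro S ⟨⟨h0, h1, h3, h4⟩, h2⟩
  simp only [scaleStep, wp_rowOp, wp_nil]
  rw [Set.indicator_of_notMem]
  simp only [Set.mem_ofPred_eq, not_not, LevPost, MachineState.setRow_row, ScalarOp.eval]
  norm_num [h0, h1, h2, h4]
  have : (fun i => lewisDensity p w i * (List.map (fun l => A i l *
      (A * (Aᵀ * Matrix.diagonal (lewisDensity p w) * A)⁻¹) i l) (List.finRange n)).sum)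
      = leverageScores (reweight A p w) := by
    funext i
    rw [leverageScores_reweight hw, lewisDiag, levKernel, Matrix.mul_apply, ← Fin.sum_univ_def]
    congr 1
    exact Finset.sum_congr rfl fun l _ => by rw [Matrix.transpose_apply, mul_comm]
  rw [this]
  exact apxLeverage_self _

/-- Leverage scores by the cheaper of the two methods. -/
noncomputable def levBlock (m n : ℕ) (p : ℝ) (k : ℕ) : Program m n :=
  if n ≤ k then exactBlock m n p else sketchBlock m n p k

theorem hoare_levBlock {v₀ w : Fin m → ℝ} (hA : NonDegenerate A) (hw : ∀ i, 0 < w i) {δ : ℝ}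
    (hδ : 0 < δ) (hδ1 : δ ≤ 1) {k : ℕ} (hk : 0 < k) :
    Hoare A (fun S => S.row 0 = v₀ ∧ S.row 1 = w) (levBlock m n p k).flatten
      (LevPost A p δ v₀ w)
      (if n ≤ k then 0 else ENNReal.ofReal (2 * m * Real.exp (-(k * δ ^ 2 / 48)))) := by
  rw [levBlock]
  split_ifs with h
  · refine (hoare_exactBlock hw).mono_right ?_
    rintro S ⟨h0, h1, h2⟩
    exact ⟨h0, h1, h2.mono (fun i => (hA.leverageScores_reweight_pos hw i).le) hδ.le⟩
  · exact hoare_sketchBlock hA hw hδ hδ1 hk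

end Blocks

/-! ### The programs -/

section Programs

open scoped ENNReal

variable {m n : ℕ} {A : Matrix (Fin m) (Fin n) ℝ} {p ε : ℝ}

/-- The projected gradient step; the weights are in register `1`, the leverage scores in `2`. -/
noncomputable def updateStep (m n : ℕ) (p : ℝ) : Step m n :=
  [.rowConst 5 fun _ => 1 - apxRadius p, .rowOp .mul 5 5 0,
    .rowConst 6 fun _ => 1 + apxRadius p, .rowOp .mul 6 6 0,
    .rowOp .div 7 0 1, .rowOp .mul 7 7 2, .rowOp .sub 7 0 7,
    .rowConst 8 fun _ => 1 / max 4 (8 / p), .rowOp .mul 7 8 7, .rowOp .sub 7 1 7,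
    .rowOp .min 8 5 7, .rowOp .max 9 5 7, .rowOp .min 9 9 6, .rowOp .max 1 8 9]

/-- Writes `(w ^ (2/p - 1) s) ^ (p/2)` into register `dst`. -/
noncomputable def lewisStep (m n : ℕ) (p : ℝ) (dst : ℕ) : Step m n :=
  [.rowPow 5 1 (2 / p - 1), .rowOp .mul 5 5 2, .rowPow dst 5 (p / 2)]

/-- Copies register `src` into register `dst`. -/
noncomputable def copyStep (m n : ℕ) (dst src : ℕ) : Step m n := [.rowPow dst src 1]

/-- One iteration of the projected gradient method. -/
noncomputable def apxBody (m n : ℕ) (p : ℝ) (k : ℕ) : Program m n :=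
  sketchBlock m n p k ++ [updateStep m n p]

/-- The projected gradient method, started from the weights in register `0`. -/
noncomputable def apxProgram (m n : ℕ) (p ε : ℝ) (k : ℕ) : Program m n :=
  copyStep m n 1 0 :: ((List.replicate (apxIterations n p ε - 1) (apxBody m n p k)).flatten ++
    (sketchBlock m n p k ++ [lewisStep m n p 0]))

theorem hoare_copyStep (dst src : ℕ) (x : Fin m → ℝ) {pre : MachineState m n → Prop}
    {post : MachineState m n → Prop} (h : ∀ S, pre S → S.row src = x)
    (h' : ∀ S, pre S → post (S.setRow dst x)) :
    Hoare A pre (copyStep m n dst src) post 0 := by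
  intro S hS
  simp only [copyStep, wp_rowPow, wp_nil, Real.rpow_one]
  rw [Set.indicator_of_notMem]
  simp only [Set.mem_ofPred_eq, not_not]
  rw [h S hS]
  exact h' S hS

theorem wp_updateStep (f : MachineState m n → ℝ≥0∞) (S : MachineState m n) :
    ∃ S', wp A (updateStep m n p) f S = f S' ∧ S'.row 0 = S.row 0 ∧
      S'.row 1 = apxUpdate p (S.row 0) (S.row 1) (S.row 2) := by
  refine ⟨_, by simp only [updateStep, wp_rowConst, wp_rowOp, wp_nil]; rfl, ?_, ?_⟩
  · simp [MachineState.setRow_row]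
  · funext i
    simp [MachineState.setRow_row, ScalarOp.eval, apxUpdate, gradStep, median]

theorem wp_lewisStep (dst : ℕ) (f : MachineState m n → ℝ≥0∞) (S : MachineState m n) :
    ∃ S', wp A (lewisStep m n p dst) f S = f S' ∧
      S'.row dst = lewisUpdate p (S.row 1) (S.row 2) := by
  refine ⟨_, by simp only [lewisStep, wp_rowPow, wp_rowOp, wp_nil]; rfl, ?_⟩
  funext i
  simp [MachineState.setRow_row, ScalarOp.eval, lewisUpdate]

/-- The loop invariant keeps the history of iterates as an existential witness; this lengthens the
history by one step. -/
theorem IsNoisyRun.extend {w₀ : Fin m → ℝ} {δ : ℝ} {j : ℕ} {w : ℕ → Fin m → ℝ}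
    (h : IsNoisyRun A p w₀ δ j w) {s : Fin m → ℝ} (hs : ApxLeverage δ (reweight A p (w j)) s) :
    ∃ w', IsNoisyRun A p w₀ δ (j + 1) w' ∧ w' (j + 1) = apxUpdate p w₀ (w j) s := by
  refine ⟨Function.update w (j + 1) (apxUpdate p w₀ (w j) s), ⟨?_, fun i hi => ?_⟩, by simp⟩
  · rw [Function.update_of_ne (by omega)]; exact h.1
  · rcases Nat.lt_succ_iff_lt_or_eq.mp hi with hlt | rfl
    · obtain ⟨t, ht, hw⟩ := h.2 i hlt
      refine ⟨t, ?_, ?_⟩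
      · rwa [Function.update_of_ne (by omega)]
      · rwa [Function.update_of_ne (by omega), Function.update_of_ne (by omega)]
    · refine ⟨s, ?_, ?_⟩
      · rwa [Function.update_of_ne (by omega)]
      · rw [Function.update_self, Function.update_of_ne (by omega)]

/-- Register `1` holds the state of a run of length `j` that starts with register `0`. -/
def RunInv (A : Matrix (Fin m) (Fin n) ℝ) (p : ℝ) (w₀ : Fin m → ℝ) (δ : ℝ) (j : ℕ)
    (S : MachineState m n) : Prop :=
  S.row 0 = w₀ ∧ ∃ w, IsNoisyRun A p w₀ δ j w ∧ w j = S.row 1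

/-- The probability that a sketch with `k` samples misses the accuracy `δ`. -/
noncomputable def sketchFailure (m k : ℕ) (δ : ℝ) : ℝ := 2 * m * Real.exp (-(k * δ ^ 2 / 48))

theorem sketchFailure_nonneg (m k : ℕ) (δ : ℝ) : 0 ≤ sketchFailure m k δ := by
  rw [sketchFailure]; positivity

theorem hoare_sketchBlock_runInv (hA : NonDegenerate A) (hp : 0 < p) (hp4 : p < 4)
    {w₀ : Fin m → ℝ} (hw₀ : ∀ i, 0 < w₀ i) {δ : ℝ} (hδ : 0 < δ) (hδ1 : δ ≤ 1) {k : ℕ}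
    (hk : 0 < k) (j : ℕ) :
    Hoare A (RunInv A p w₀ δ j) (sketchBlock m n p k).flatten
      (fun S => RunInv A p w₀ δ j S ∧ ApxLeverage δ (reweight A p (S.row 1)) (S.row 2))
      (ENNReal.ofReal (sketchFailure m k δ)) := by
  rintro S ⟨h0, w, hw, hwj⟩
  have hpos : ∀ i, 0 < S.row 1 i := by
    rw [← hwj]
    exact (hw.inBox hp hp4 hw₀ le_rfl).pos (lt_of_le_of_lt (apxRadius_le hp hp4) (by norm_num)) hw₀
  have h := hoare_sketchBlock (A := A) (p := p) (v₀ := w₀) hA hpos hδ hδ1 hk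
  refine h.mono_right (post := fun S' => RunInv A p w₀ δ j S' ∧
    ApxLeverage δ (reweight A p (S'.row 1)) (S'.row 2)) ?_ S ⟨h0, rfl⟩
  rintro S' ⟨h0', h1', h2'⟩
  refine ⟨⟨h0', w, hw, by rw [hwj, h1']⟩, ?_⟩
  rwa [h1']

theorem hoare_apxBody (hA : NonDegenerate A) (hp : 0 < p) (hp4 : p < 4)
    {w₀ : Fin m → ℝ} (hw₀ : ∀ i, 0 < w₀ i) {δ : ℝ} (hδ : 0 < δ) (hδ1 : δ ≤ 1) {k : ℕ}
    (hk : 0 < k) (j : ℕ) :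
    Hoare A (RunInv A p w₀ δ j) (apxBody m n p k).flatten (RunInv A p w₀ δ (j + 1))
      (ENNReal.ofReal (sketchFailure m k δ)) := by
  rw [apxBody, List.flatten_append, List.flatten_singleton,
    ← add_zero (ENNReal.ofReal (sketchFailure m k δ))]
  refine (hoare_sketchBlock_runInv hA hp hp4 hw₀ hδ hδ1 hk j).seq ?_
  rintro S ⟨⟨h0, w, hw, hwj⟩, hs⟩
  obtain ⟨S', h1, h2, h3⟩ := wp_updateStep (A := A) (p := p)
    ({S' | ¬ RunInv A p w₀ δ (j + 1) S'}.indicator 1) S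
  rw [h1, Set.indicator_of_notMem]
  simp only [Set.mem_ofPred_eq, not_not]
  rw [← hwj] at hs
  obtain ⟨w', hw', hlast⟩ := hw.extend hs
  refine ⟨h2.trans h0, w', hw', ?_⟩
  rw [hlast, h3, h0, hwj]

/-- The first program computes a run of the iteration, except with small probability. -/
theorem hoare_apxProgram (hA : NonDegenerate A) (hp : 0 < p) (hp4 : p < 4) (hε : 0 < ε)
    (hε1 : ε < 1) {w₀ : Fin m → ℝ} (hw₀ : ∀ i, 0 < w₀ i) {k : ℕ} (hk : 0 < k) :
    Hoare A (fun S => S.row 0 = w₀) (apxProgram m n p ε k).flatten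
      (fun S => IsApxWeightRun A p w₀ ε (S.row 0))
      (ENNReal.ofReal ((apxIterations n p ε + 1 : ℕ) *
        sketchFailure m k ((4 - p) * ε / 256))) := by
  set δ := (4 - p) * ε / 256 with hδdef
  have hδ : 0 < δ := div_pos (mul_pos (by linarith) hε) (by norm_num)
  have hδ1 : δ ≤ 1 := by rw [hδdef]; nlinarith
  set T := apxIterations n p ε with hT
  set q := ENNReal.ofReal (sketchFailure m k δ) with hq
  have hcopy : Hoare A (fun S => S.row 0 = w₀) (copyStep m n 1 0) (RunInv A p w₀ δ 0) 0 := by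
    refine hoare_copyStep 1 0 w₀ (fun S hS => hS) fun S hS => ⟨?_, fun _ => w₀, ⟨rfl, ?_⟩, ?_⟩
    · simpa [MachineState.setRow_row] using hS
    · intro j hj; omega
    · simp [MachineState.setRow_row]
  have hloop := Hoare.iterate (A := A) (I := RunInv A p w₀ δ) (T - 1)
    fun j _ => hoare_apxBody hA hp hp4 hw₀ hδ hδ1 hk j
  have hlast : Hoare A (fun S => RunInv A p w₀ δ (T - 1) S ∧
      ApxLeverage δ (reweight A p (S.row 1)) (S.row 2)) (lewisStep m n p 0)
      (fun S => IsApxWeightRun A p w₀ ε (S.row 0)) 0 := by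
    rintro S ⟨⟨h0, w, hw, hwj⟩, hs⟩
    obtain ⟨S', h1, h2⟩ := wp_lewisStep (A := A) (p := p) 0
      ({S' | ¬ IsApxWeightRun A p w₀ ε (S'.row 0)}.indicator 1) S
    rw [h1, Set.indicator_of_notMem]
    simp only [Set.mem_ofPred_eq, not_not]
    refine ⟨w, hw.1, fun j hj => ?_, S.row 2, ?_, fun i => ?_⟩
    · obtain ⟨s, hs, hws⟩ := hw.2 j hj
      exact ⟨s, hs, fun i => congrFun hws i⟩
    · rwa [← hT, hwj]
    · rw [h2, ← hT, hwj]; rfl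
  have hall := hcopy.seq (hloop.seq
    ((hoare_sketchBlock_runInv hA hp hp4 hw₀ hδ hδ1 hk (T - 1)).seq hlast))
  have hflat : (apxProgram m n p ε k).flatten = copyStep m n 1 0 ++
      ((List.replicate (T - 1) (apxBody m n p k).flatten).flatten ++
        ((sketchBlock m n p k).flatten ++ lewisStep m n p 0)) := by
    rw [apxProgram, List.flatten_cons, List.flatten_append, List.flatten_append,
      List.flatten_singleton, List.flatten_flatten, List.map_replicate]
  rw [hflat]
  refine hall.mono_prob ?_
  rw [zero_add, add_zero, ENNReal.ofReal_mul (by positivity), ENNReal.ofReal_natCast, ← hq]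
  -- With truncated subtraction the number of sketches is `1` even for `T = 0`, so `T + 1` is used
  -- as a uniform bound.
  calc ((T - 1 : ℕ) : ℝ≥0∞) * q + q = ((T - 1 + 1 : ℕ) : ℝ≥0∞) * q := by push_cast; ring
    _ ≤ _ := by
        gcongr
        exact Nat.sub_le _ _

/-- One reweighting step. -/
noncomputable def lewisBody (m n : ℕ) (p : ℝ) (k : ℕ) : Program m n :=
  levBlock m n p k ++ [lewisStep m n p 1]

/-- Reweighting steps from the all-ones vector; the result is copied to register `0`. -/
noncomputable def startProgram (m n : ℕ) (p : ℝ) (k K : ℕ) : Program m n :=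
  [.rowConst 1 fun _ => 1] :: (lewisBody m n p k ++
    ((List.replicate K (lewisBody m n p k)).flatten ++ [copyStep m n 0 1]))

/-- The probability that `levBlock` misses the accuracy `δ`. -/
noncomputable def levFailure (m n k : ℕ) (δ : ℝ) : ℝ := if n ≤ k then 0 else sketchFailure m k δ

theorem levFailure_nonneg (m n k : ℕ) (δ : ℝ) : 0 ≤ levFailure m n k δ := by
  rw [levFailure]
  split_ifs
  · exact le_rfl
  · exact sketchFailure_nonneg m k δ

theorem hoare_lewisBody (hA : NonDegenerate A) {δ : ℝ} (hδ : 0 < δ) (hδ1 : δ ≤ 1) {k : ℕ}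
    (hk : 0 < k) {pre post : (Fin m → ℝ) → Prop} (hpre : ∀ w, pre w → ∀ i, 0 < w i)
    (hstep : ∀ w s, pre w → ApxLeverage δ (reweight A p w) s → post (lewisUpdate p w s)) :
    Hoare A (fun S => pre (S.row 1)) (lewisBody m n p k).flatten (fun S => post (S.row 1))
      (ENNReal.ofReal (levFailure m n k δ)) := by
  intro S hS
  rw [lewisBody, List.flatten_append, List.flatten_singleton,
    ← add_zero (ENNReal.ofReal (levFailure m n k δ))]
  have h := hoare_levBlock (A := A) (p := p) (v₀ := S.row 0) hA (hpre _ hS) hδ hδ1 hk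
  have hq : (if n ≤ k then 0 else ENNReal.ofReal (2 * m * Real.exp (-(k * δ ^ 2 / 48))))
      = ENNReal.ofReal (levFailure m n k δ) := by
    rw [levFailure, sketchFailure]; split_ifs <;> simp
  rw [hq] at h
  refine h.seq (post := fun S => post (S.row 1)) ?_ S ⟨rfl, rfl⟩
  rintro S₁ ⟨-, h1, h2⟩
  obtain ⟨S', h3, h4⟩ := wp_lewisStep (A := A) (p := p) 1
    ({S' | ¬ post (S'.row 1)}.indicator 1) S₁
  rw [h3, Set.indicator_of_notMem]
  simp only [Set.mem_ofPred_eq, not_not]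
  rw [h4, h1]
  exact hstep _ _ hS h2

/-- The accuracy of the leverage scores in the reweighting steps. -/
noncomputable def startAccuracy (p : ℝ) : ℝ := apxRadius p * (4 - p) / 16

theorem startAccuracy_pos (hp : 0 < p) (hp4 : p < 4) : 0 < startAccuracy p :=
  div_pos (mul_pos (apxRadius_pos hp hp4) (by linarith)) (by norm_num)

theorem startAccuracy_le_one (hp : 0 < p) (hp4 : p < 4) : startAccuracy p ≤ 1 := by
  have := apxRadius_le hp hp4
  have := apxRadius_pos hp hp4
  rw [startAccuracy]
  nlinarith

/-- The slack is `p²/8` on the branch `1 - p/2` and `(4 - p)²/8` on the branch `p/2 - 1`. -/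
theorem abs_one_sub_half_le (hp : 0 < p) (hp4 : p < 4) : |1 - p / 2| ≤ 1 - p * (4 - p) / 8 := by
  rw [abs_le]
  constructor <;> nlinarith

/-- The starting program finds weights in the region of convergence. -/
theorem hoare_startProgram (hA : NonDegenerate A) (hm : 0 < m) (hp : 0 < p) (hp4 : p < 4) {k K : ℕ}
    (hk : 0 < k) (hK : |1 - p / 2| ^ K * (2 * Real.log m) ≤ apxRadius p / 4) :
    Hoare A (fun _ => True) (startProgram m n p k K).flatten
      (fun S => (∀ i, 0 < S.row 0 i) ∧
        ‖(S.row 0)⁻¹ * (lewisWeight A p - S.row 0)‖ ≤ apxRadius p)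
      (ENNReal.ofReal ((K + 1 : ℕ) * levFailure m n k (startAccuracy p))) := by
  have hv := hA.isLewisWeight_lewisWeight hp hp4
  set v := lewisWeight A p
  set η := startAccuracy p with hη
  have hη0 : 0 < η := startAccuracy_pos hp hp4
  have hη1 : η ≤ 1 := startAccuracy_le_one hp hp4
  have hr := apxRadius_le hp hp4
  have hr0 := apxRadius_pos hp hp4
  have hγ := abs_one_sub_half_le hp hp4
  set e := apxRadius p / 4 with he
  have heη : p / 2 * η = p * (4 - p) / 8 * e := by rw [hη, startAccuracy, he]; ring
  -- The noise level is tuned so that the error `e` reproduces itself: one step adds `(p (4 - p)/8)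
  -- e`, which is at most what the contraction removes.
  have hinv : |1 - p / 2| * e + p / 2 * η ≤ e := by
    rw [heη]
    have := mul_le_mul_of_nonneg_right hγ (show 0 ≤ e by positivity)
    linarith
  set q := ENNReal.ofReal (levFailure m n k η) with hq
  let I : ℕ → (Fin m → ℝ) → Prop := fun j w => (∀ i, 0 < w i) ∧
    LogClose (|1 - p / 2| ^ j * (2 * Real.log m) + e) w v
  have hinit : Hoare A (fun _ => True) [.rowConst 1 fun _ => 1]
      (fun S => S.row 1 = fun _ => 1) 0 := by
    intro S _
    rw [wp_rowConst, wp_nil, Set.indicator_of_notMem]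
    simp [MachineState.setRow_row]
  have hfirst := hoare_lewisBody (A := A) (n := n) (p := p) hA hη0 hη1 hk
    (pre := fun w => w = fun _ => 1) (post := I 0) (by rintro w rfl i; exact one_pos)
    (by
      rintro w s rfl hs
      refine ⟨lewisUpdate_pos (fun _ => one_pos) (hs.pos hA fun _ => one_pos), ?_⟩
      refine (hv.logClose_lewisUpdate_one hA hp hp4 hm hs).mono ?_
      have := mul_nonneg (abs_nonneg (1 - p / 2)) (show 0 ≤ e by positivity)
      rw [pow_zero, one_mul]
      linarith)
  have hloop := Hoare.iterate (A := A) (I := fun j S => I j (S.row 1)) K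
    (fun j _ => hoare_lewisBody (A := A) (n := n) (p := p) hA hη0 hη1 hk
      (pre := I j) (post := I (j + 1)) (fun w hw => hw.1)
      (by
        rintro w s ⟨hw, hwv⟩ hs
        refine ⟨lewisUpdate_pos hw (hs.pos hA hw), ?_⟩
        refine (hv.logClose_lewisUpdate hA hp hw hs hwv).mono ?_
        rw [pow_succ]
        linarith))
  have hcopy : Hoare A (fun S => I K (S.row 1)) (copyStep m n 0 1)
      (fun S => (∀ i, 0 < S.row 0 i) ∧ ‖(S.row 0)⁻¹ * (v - S.row 0)‖ ≤ apxRadius p) 0 := by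
    intro S hS
    refine hoare_copyStep (A := A) (pre := fun S' => S' = S)
      (post := fun S => (∀ i, 0 < S.row 0 i) ∧ ‖(S.row 0)⁻¹ * (v - S.row 0)‖ ≤ apxRadius p)
      0 1 (S.row 1) (fun S' h => by rw [h]) (fun S' _ => ?_) S rfl
    have hrow : (S'.setRow 0 (S.row 1)).row 0 = S.row 1 := by simp [MachineState.setRow_row]
    rw [hrow]
    refine ⟨hS.1, ?_⟩
    rw [norm_inv_mul_sub_le_iff hr0.le hS.1]
    intro i
    rw [abs_sub_comm]
    refine abs_sub_le_of_abs_log_sub_le (hv.1 i) (hS.1 i) hr0.le (hr.trans (by norm_num)) ?_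
    refine (hS.2.symm i).trans ?_
    rw [he]
    linarith
  have hall := hinit.seq (hfirst.seq (hloop.seq hcopy))
  have hflat : (startProgram m n p k K).flatten = [.rowConst 1 fun _ => 1] ++
      ((lewisBody m n p k).flatten ++ ((List.replicate K (lewisBody m n p k).flatten).flatten ++
        copyStep m n 0 1)) := by
    rw [startProgram, List.flatten_cons, List.flatten_append, List.flatten_append,
      List.flatten_singleton, List.flatten_flatten, List.map_replicate]
  rw [hflat]
  refine hall.mono_prob ?_
  rw [zero_add, add_zero, ENNReal.ofReal_mul (by positivity), ENNReal.ofReal_natCast, ← hq]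
  push_cast
  rw [add_mul, one_mul, add_comm]

/-- The program without input weights. -/
theorem hoare_startProgram_apxProgram (hA : NonDegenerate A) (hm : 0 < m) (hp : 0 < p)
    (hp4 : p < 4) (hε : 0 < ε) (hε1 : ε < 1) {k K k' : ℕ} (hk : 0 < k) (hk' : 0 < k')
    (hK : |1 - p / 2| ^ K * (2 * Real.log m) ≤ apxRadius p / 4) :
    Hoare A (fun _ => True) (startProgram m n p k K ++ apxProgram m n p ε k').flatten
      (fun S => ∃ w₁ : Fin m → ℝ, (∀ i, 0 < w₁ i) ∧
        ‖w₁⁻¹ * (lewisWeight A p - w₁)‖ ≤ apxRadius p ∧ IsApxWeightRun A p w₁ ε (S.row 0))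
      (ENNReal.ofReal ((K + 1 : ℕ) * levFailure m n k (startAccuracy p)
        + (apxIterations n p ε + 1 : ℕ) * sketchFailure m k' ((4 - p) * ε / 256))) := by
  rw [List.flatten_append, ENNReal.ofReal_add
    (mul_nonneg (by positivity) (levFailure_nonneg _ _ _ _))
    (mul_nonneg (by positivity) (sketchFailure_nonneg _ _ _))]
  refine (hoare_startProgram hA hm hp hp4 hk hK).seq ?_
  rintro S ⟨h1, h2⟩
  refine (hoare_apxProgram hA hp hp4 hε hε1 h1 hk').mono_right
    (post := fun S => ∃ w₁ : Fin m → ℝ, (∀ i, 0 < w₁ i) ∧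
      ‖w₁⁻¹ * (lewisWeight A p - w₁)‖ ≤ apxRadius p ∧ IsApxWeightRun A p w₁ ε (S.row 0))
    (fun S' hS' => ⟨S.row 0, h1, h2, hS'⟩) S rfl

end Programs

/-! ### Cost of the programs -/

section Cost

variable {m n : ℕ} {A : Matrix (Fin m) (Fin n) ℝ}

/-- Every row has a nonzero entry, so coordinatewise operations on vectors can be charged to `nnz
A`. -/
theorem NonDegenerate.le_nnz (hA : NonDegenerate A) : m ≤ nnz A := by
  choose j hj using hA.2
  have hinj : Function.Injective fun i : Fin m => (i, j i) := fun a b h => (Prod.ext_iff.mp h).1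
  have h1 : (Set.range fun i : Fin m => (i, j i)).ncard = m := by
    rw [← Set.image_univ, Set.ncard_image_of_injective _ hinj, Set.ncard_univ, Nat.card_fin]
  refine h1.symm.le.trans (Set.ncard_le_ncard ?_ (Set.toFinite _))
  rintro _ ⟨i, rfl⟩
  exact hj i

theorem NonDegenerate.maxRowNnz_pos (hA : NonDegenerate A) (hm : 0 < m) : 0 < maxRowNnz A := by
  obtain ⟨j, hj⟩ := hA.2 ⟨0, hm⟩
  have h1 : 0 < {j | A ⟨0, hm⟩ j ≠ 0}.ncard := (Set.ncard_pos (Set.toFinite _)).mpr ⟨j, hj⟩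
  exact lt_of_lt_of_le h1 (Finset.le_sup (f := fun i => {j | A i j ≠ 0}.ncard) (Finset.mem_univ _))

theorem NonDegenerate.instr_work_le (hA : NonDegenerate A) (hnm : n ≤ m) (Tw : ℕ)
    (c : Instr m n) : c.work A Tw ≤ 2 * (nnz A + Tw) := by
  have h := hA.le_nnz
  cases c <;> simp only [Instr.work] <;> omega

theorem NonDegenerate.instr_depth_le (hA : NonDegenerate A) (hm : 0 < m) {Td : ℕ}
    (hTd : Nat.clog 2 (max (maxRowNnz A) (maxColNnz A) + 1) ≤ Td) (c : Instr m n) :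
    c.depth A Td ≤ 2 * Td := by
  -- A nonzero row makes the argument of `Nat.clog` at least `2`, so the solver depth also dominates
  -- the unit depth of the other instructions.
  have h1 : 1 ≤ Td := by
    refine le_trans (Nat.clog_pos one_lt_two ?_) hTd
    have := hA.maxRowNnz_pos hm
    have := le_max_left (maxRowNnz A) (maxColNnz A)
    omega
  have h2 : Nat.clog 2 (maxRowNnz A) ≤ Td :=
    (Nat.clog_mono_right 2 ((le_max_left _ _).trans (Nat.le_succ _))).trans hTd
  have h3 : Nat.clog 2 (maxColNnz A) ≤ Td :=
    (Nat.clog_mono_right 2 ((le_max_right _ _).trans (Nat.le_succ _))).trans hTd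
  cases c <;> simp only [Instr.depth] <;> omega

/-- A step is short if it has at most `16` instructions, at most one of them a call of the
solver. -/
def ShortStep (s : Step m n) : Prop := s.length ≤ 16 ∧ Step.solves s ≤ 1

theorem cheapSteps_of_shortStep {P : Program m n} (hm : 0 < m) (hnm : n ≤ m)
    (h : ∀ s ∈ P, ShortStep s) {C : ℝ} (hC : 32 ≤ C) : P.CheapSteps C := by
  intro s hs
  refine ⟨(h s hs).2, fun A Tw Td hA hTd => ?_⟩
  have hlen := (h s hs).1
  have hw : Step.work A Tw s ≤ 16 * (2 * (nnz A + Tw)) := by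
    have := List.sum_le_card_nsmul (s.map (Instr.work A Tw)) (2 * (nnz A + Tw)) (by
      intro x hx
      obtain ⟨c, -, rfl⟩ := List.mem_map.mp hx
      exact hA.instr_work_le hnm Tw c)
    rw [List.length_map, smul_eq_mul] at this
    exact this.trans (Nat.mul_le_mul_right _ hlen)
  have hd : Step.depth A Td s ≤ 16 * (2 * Td) := by
    have := List.sum_le_card_nsmul (s.map (Instr.depth A Td)) (2 * Td) (by
      intro x hx
      obtain ⟨c, -, rfl⟩ := List.mem_map.mp hx
      exact hA.instr_depth_le hm hTd c)
    rw [List.length_map, smul_eq_mul] at this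
    exact this.trans (Nat.mul_le_mul_right _ hlen)
  constructor
  · calc (Step.work A Tw s : ℝ) ≤ ((16 * (2 * (nnz A + Tw)) : ℕ) : ℝ) := by exact_mod_cast hw
      _ = 32 * (nnz A + Tw) := by push_cast; ring
      _ ≤ _ := mul_le_mul_of_nonneg_right hC (by positivity)
  · calc (Step.depth A Td s : ℝ) ≤ ((16 * (2 * Td) : ℕ) : ℝ) := by exact_mod_cast hd
      _ = 32 * Td := by push_cast; ring
      _ ≤ _ := mul_le_mul_of_nonneg_right hC (by positivity)

theorem shortStep_sketchBlock (p : ℝ) (k : ℕ) : ∀ s ∈ sketchBlock m n p k, ShortStep s := by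
  intro s hs
  simp only [sketchBlock, List.mem_cons, List.mem_append, List.mem_replicate,
    List.not_mem_nil, or_false] at hs
  rcases hs with rfl | ⟨-, rfl⟩ | rfl <;>
    simp [ShortStep, prepStep, sampleStep, averageStep, Step.solves, Instr.solves]

theorem shortStep_levBlock (p : ℝ) (k : ℕ) : ∀ s ∈ levBlock m n p k, ShortStep s := by
  rw [levBlock]
  split_ifs
  · intro s hs
    simp only [exactBlock, List.mem_cons, List.mem_append, List.mem_map,
      List.not_mem_nil, or_false] at hs
    rcases hs with rfl | ⟨l, -, rfl⟩ | rfl <;>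
      simp [ShortStep, prepStep, columnStep, scaleStep, Step.solves, Instr.solves]
  · exact shortStep_sketchBlock p k

theorem shortStep_apxProgram (p ε : ℝ) (k : ℕ) : ∀ s ∈ apxProgram m n p ε k, ShortStep s := by
  intro s hs
  simp only [apxProgram, apxBody, List.mem_cons, List.mem_append, List.mem_flatten,
    List.mem_replicate, List.not_mem_nil, or_false] at hs
  rcases hs with rfl | ⟨l, ⟨-, rfl⟩, hs⟩ | hs | rfl
  · simp [ShortStep, copyStep, Step.solves, Instr.solves]
  · rw [List.mem_append, List.mem_singleton] at hs
    rcases hs with hs | rfl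
    · exact shortStep_sketchBlock p k s hs
    · simp [ShortStep, updateStep, Step.solves, Instr.solves]
  · exact shortStep_sketchBlock p k s hs
  · simp [ShortStep, lewisStep, Step.solves, Instr.solves]

theorem shortStep_lewisBody (p : ℝ) (k : ℕ) : ∀ s ∈ lewisBody m n p k, ShortStep s := by
  intro s hs
  rw [lewisBody, List.mem_append, List.mem_singleton] at hs
  rcases hs with hs | rfl
  · exact shortStep_levBlock p k s hs
  · simp [ShortStep, lewisStep, Step.solves, Instr.solves]

theorem shortStep_startProgram (p : ℝ) (k K : ℕ) :
    ∀ s ∈ startProgram m n p k K, ShortStep s := by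
  intro s hs
  simp only [startProgram, List.mem_cons, List.mem_append, List.mem_flatten,
    List.mem_replicate, List.not_mem_nil, or_false] at hs
  rcases hs with rfl | hs | ⟨l, ⟨-, rfl⟩, hs⟩ | rfl
  · simp [ShortStep, Step.solves, Instr.solves]
  · exact shortStep_lewisBody p k s hs
  · exact shortStep_lewisBody p k s hs
  · simp [ShortStep, copyStep, Step.solves, Instr.solves]

theorem length_apxProgram_le (p ε : ℝ) (k : ℕ) :
    (apxProgram m n p ε k).length ≤ (apxIterations n p ε + 1) * (k + 4) := by
  simp only [apxProgram, apxBody, sketchBlock, List.length_cons, List.length_append,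
    List.length_flatten, List.map_replicate, List.sum_replicate, List.length_replicate,
    List.length_nil, smul_eq_mul]
  have : (apxIterations n p ε - 1) * (k + (0 + 1) + 1 + (0 + 1)) ≤ apxIterations n p ε * (k + 4) :=
    Nat.mul_le_mul (Nat.sub_le _ _) (by omega)
  rw [add_mul]
  omega

theorem length_levBlock_le (p : ℝ) (k : ℕ) : (levBlock m n p k).length ≤ min n k + 2 := by
  rw [levBlock]
  split_ifs with h
  · simp [exactBlock, h]
  · simp only [sketchBlock, List.length_cons, List.length_append, List.length_replicate,
      List.length_nil]
    omega

theorem length_startProgram_le (p : ℝ) (k K : ℕ) :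
    (startProgram m n p k K).length ≤ (K + 1) * (min n k + 5) := by
  have h : (lewisBody m n p k).length ≤ min n k + 3 := by
    rw [lewisBody, List.length_append, List.length_singleton]
    have := length_levBlock_le (m := m) (n := n) p k
    omega
  simp only [startProgram, List.length_cons, List.length_append,
    List.length_flatten, List.map_replicate, List.sum_replicate, List.length_nil, smul_eq_mul]
  have h1 : K * (lewisBody m n p k).length ≤ K * (min n k + 5) :=
    Nat.mul_le_mul_left _ (by omega)
  rw [add_mul]
  omega

end Cost

/-! ### Choice of the parameters -/

section Parameters

variable {m n : ℕ} {p ε c : ℝ}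

theorem half_le_log_two_add {x : ℝ} (hx : 0 ≤ x) : 1 / 2 ≤ Real.log (2 + x) := by
  have h1 := Real.log_two_gt_d9
  have h2 : Real.log 2 ≤ Real.log (2 + x) := Real.log_le_log two_pos (by linarith)
  linarith

/-- The number of samples for accuracy `δ`; the failure probability is a power of
`2 + m / (p ε)` that depends on `c`. -/
noncomputable def sampleCount (m : ℕ) (p ε c δ : ℝ) : ℕ :=
  ⌈48 * (21 + 3 * c) * (δ ^ 2)⁻¹ * Real.log (2 + m / (p * ε))⌉₊

theorem le_sampleCount (m : ℕ) (p ε c δ : ℝ) :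
    48 * (21 + 3 * c) * (δ ^ 2)⁻¹ * Real.log (2 + m / (p * ε)) ≤ sampleCount m p ε c δ :=
  Nat.le_ceil _

theorem one_le_inv_sq {δ : ℝ} (hδ : 0 < δ) (hδ1 : δ ≤ 1) : 1 ≤ (δ ^ 2)⁻¹ :=
  (one_le_inv₀ (by positivity)).mpr (pow_le_one₀ hδ.le hδ1)

theorem inv_sq_le_sampleCount (hp : 0 < p) (hε : 0 < ε) (hc : 0 < c) {δ : ℝ} (hδ : 0 < δ) :
    (δ ^ 2)⁻¹ ≤ sampleCount m p ε c δ := by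
  refine le_trans ?_ (le_sampleCount m p ε c δ)
  have h1 := half_le_log_two_add (show 0 ≤ (m : ℝ) / (p * ε) by positivity)
  have h2 : 0 < (δ ^ 2)⁻¹ := by positivity
  have h3 : 1 ≤ 48 * (21 + 3 * c) * Real.log (2 + m / (p * ε)) := by nlinarith
  calc (δ ^ 2)⁻¹ = (δ ^ 2)⁻¹ * 1 := (mul_one _).symm
    _ ≤ (δ ^ 2)⁻¹ * (48 * (21 + 3 * c) * Real.log (2 + m / (p * ε))) :=
        mul_le_mul_of_nonneg_left h3 h2.le
    _ = _ := by ring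

theorem sampleCount_pos (hp : 0 < p) (hε : 0 < ε) (hc : 0 < c) {δ : ℝ} (hδ : 0 < δ) :
    0 < sampleCount m p ε c δ := by
  have h1 := inv_sq_le_sampleCount (m := m) hp hε hc hδ
  have h2 : 0 < (δ ^ 2)⁻¹ := by positivity
  exact_mod_cast h2.trans_le h1

theorem sampleCount_le (hp : 0 < p) (hε : 0 < ε) (hc : 0 < c) {δ : ℝ} (hδ : 0 < δ)
    (hδ1 : δ ≤ 1) : (sampleCount m p ε c δ : ℝ)
      ≤ (48 * (21 + 3 * c) + 2) * (δ ^ 2)⁻¹ * Real.log (2 + m / (p * ε)) := by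
  have h1 := half_le_log_two_add (show 0 ≤ (m : ℝ) / (p * ε) by positivity)
  have h2 := one_le_inv_sq hδ hδ1
  have h3 : (sampleCount m p ε c δ : ℝ)
      < 48 * (21 + 3 * c) * (δ ^ 2)⁻¹ * Real.log (2 + m / (p * ε)) + 1 :=
    Nat.ceil_lt_add_one (by positivity)
  nlinarith

theorem nat_le_four_mul (hp : 0 < p) (hp4 : p < 4) (hε : 0 < ε) (hε1 : ε < 1) (k : ℕ) :
    (k : ℝ) ≤ 4 * (2 + k / (p * ε)) := by
  have h1 : p * ε ≤ 4 := by nlinarith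
  have h2 : (k : ℝ) / 4 ≤ k / (p * ε) :=
    div_le_div_of_nonneg_left (Nat.cast_nonneg k) (by positivity) h1
  linarith

/-- A union bound over polynomially many sketches. -/
theorem mul_sketchFailure_le (hm : 0 < m) (hp : 0 < p) (hp4 : p < 4) (hε : 0 < ε) (hε1 : ε < 1)
    (hc : 0 < c) {δ : ℝ} (hδ : 0 < δ) {N : ℝ} (hN : N ≤ (2 + m / (p * ε)) ^ 16) :
    N * sketchFailure m (sampleCount m p ε c δ) δ ≤ (m : ℝ) ^ (-c) / 2 := by
  set X := 2 + (m : ℝ) / (p * ε) with hX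
  have hX2 : 2 ≤ X := by rw [hX]; have : 0 ≤ (m : ℝ) / (p * ε) := by positivity
                         linarith
  have hX0 : 0 < X := by linarith
  have hm' : (0 : ℝ) < m := by exact_mod_cast hm
  have hm4 : (m : ℝ) ≤ 4 * X := nat_le_four_mul hp hp4 hε hε1 m
  have hX4 : 4 * X ≤ X ^ 3 := by
    have h1 : 4 ≤ X ^ 2 := by nlinarith
    nlinarith
  set x := Real.log X with hx
  have hxX : Real.exp x = X := Real.exp_log hX0
  have hfail : sketchFailure m (sampleCount m p ε c δ) δ
      ≤ 2 * m * Real.exp (-((21 + 3 * c) * x)) := by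
    rw [sketchFailure]
    refine mul_le_mul_of_nonneg_left ?_ (by positivity)
    rw [Real.exp_le_exp]
    have h1 := mul_le_mul_of_nonneg_right (le_sampleCount m p ε c δ) (sq_nonneg δ)
    have h2 : 48 * (21 + 3 * c) * (δ ^ 2)⁻¹ * Real.log (2 + m / (p * ε)) * δ ^ 2
        = 48 * (21 + 3 * c) * x := by
      rw [hx, hX]; field_simp
    rw [h2] at h1
    linarith
  have hmc : Real.exp (-(3 * c * x)) ≤ (m : ℝ) ^ (-c) := by
    rw [Real.rpow_def_of_pos hm', Real.exp_le_exp]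
    have h1 : Real.log m ≤ 3 * x := by
      have := Real.log_le_log hm' (hm4.trans hX4)
      rwa [Real.log_pow, Nat.cast_ofNat] at this
    nlinarith
  have hpow : ∀ k : ℕ, X ^ k = Real.exp (k * x) := fun k => by rw [Real.exp_nat_mul, hxX]
  -- Bookkeeping of exponents: `N` takes `16`, the factor `2 m` takes `4`, and one more yields the
  -- division by `2`. The remaining `X ^ (-3c)` is at most `m ^ (-c)` because `m ≤ X³`.
  have h3 : N * (2 * m) ≤ X ^ 21 / 2 := by
    have h4 : 2 * (m : ℝ) ≤ X ^ 4 := by nlinarith [pow_pos hX0 3]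
    have h5 : N * (2 * m) ≤ X ^ 16 * X ^ 4 :=
      mul_le_mul hN h4 (by positivity) (by positivity)
    have h6 : X ^ 16 * X ^ 4 * 2 ≤ X ^ 16 * X ^ 4 * X :=
      mul_le_mul_of_nonneg_left hX2 (by positivity)
    have h7 : X ^ 16 * X ^ 4 * X = X ^ 21 := by ring
    linarith
  rcases le_or_gt N 0 with hN0 | hN0
  · refine le_trans (mul_nonpos_of_nonpos_of_nonneg hN0 (sketchFailure_nonneg _ _ _)) ?_
    positivity
  calc N * sketchFailure m (sampleCount m p ε c δ) δ
      ≤ N * (2 * m * Real.exp (-((21 + 3 * c) * x))) := mul_le_mul_of_nonneg_left hfail hN0.le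
    _ = N * (2 * m) * Real.exp (-((21 + 3 * c) * x)) := by ring
    _ ≤ X ^ 21 / 2 * Real.exp (-((21 + 3 * c) * x)) :=
        mul_le_mul_of_nonneg_right h3 (Real.exp_pos _).le
    _ = Real.exp (-(3 * c * x)) / 2 := by
        rw [hpow, div_mul_eq_mul_div, ← Real.exp_add]
        congr 2
        push_cast
        ring
    _ ≤ _ := by linarith

theorem nat_ceil_le_add_one {y z : ℝ} (h : y ≤ z) (hz : 0 ≤ z) : (⌈y⌉₊ : ℝ) ≤ z + 1 :=
  le_trans (by exact_mod_cast Nat.ceil_mono h) (Nat.ceil_lt_add_one hz).le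

theorem apxIterations_add_one_le (hn : 0 < n) (hp : 0 < p) (hp4 : p < 4) (hε : 0 < ε) :
    ((apxIterations n p ε + 1 : ℕ) : ℝ) ≤ 816 * (p⁻¹ * Real.log (2 + n / (p * ε))) := by
  have hn' : (0 : ℝ) < n := by exact_mod_cast hn
  have hl := half_le_log_two_add (show 0 ≤ (n : ℝ) / (p * ε) by positivity)
  set l := Real.log (2 + n / (p * ε)) with hl'
  have hpi : 1 / 4 ≤ p⁻¹ := by
    rw [one_div]; exact inv_anti₀ hp hp4.le
  have h1 : p / 2 + 2 / p ≤ 10 * p⁻¹ := by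
    rw [← div_eq_mul_inv, ← sub_nonneg]
    have : 10 / p - (p / 2 + 2 / p) = (16 - p ^ 2) / (2 * p) := by field_simp; ring
    rw [this]
    exact div_nonneg (by nlinarith) (by positivity)
  have h2 : Real.log (p * n / (32 * ε)) ≤ l := by
    refine Real.log_le_log (by positivity) ?_
    have : p * n / (32 * ε) ≤ n / (p * ε) := by
      rw [div_le_div_iff₀ (by positivity) (by positivity)]
      have : p ^ 2 ≤ 32 := by nlinarith
      nlinarith [mul_pos hn' hε]
    linarith
  have h3 : 80 * (p / 2 + 2 / p) * Real.log (p * n / (32 * ε)) ≤ 800 * (p⁻¹ * l) := by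
    have h4 : 80 * (p / 2 + 2 / p) * Real.log (p * n / (32 * ε)) ≤ 80 * (p / 2 + 2 / p) * l :=
      mul_le_mul_of_nonneg_left h2 (by positivity)
    have h5 := mul_le_mul_of_nonneg_right h1 (show 0 ≤ 80 * l by linarith)
    linarith
  have h4 := nat_ceil_le_add_one h3 (by positivity)
  have h5 : 1 / 8 ≤ p⁻¹ * l := by nlinarith
  rw [apxIterations]
  push_cast
  linarith

theorem log_two_add_mono (hnm : n ≤ m) (hp : 0 < p) (hε : 0 < ε) :
    Real.log (2 + n / (p * ε)) ≤ Real.log (2 + m / (p * ε)) := by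
  have : (n : ℝ) ≤ m := by exact_mod_cast hnm
  refine Real.log_le_log (by positivity) ?_
  gcongr

theorem inv_le_two_add (hm : 0 < m) (hp : 0 < p) (hε : 0 < ε) (hε1 : ε < 1) :
    p⁻¹ ≤ 2 + m / (p * ε) := by
  have hm' : (1 : ℝ) ≤ m := by exact_mod_cast hm
  have : p⁻¹ ≤ m / (p * ε) := by
    rw [inv_eq_one_div, div_le_div_iff₀ hp (by positivity)]
    nlinarith
  linarith

theorem apxIterations_add_one_le_pow (hn : 0 < n) (hnm : n ≤ m) (hp : 0 < p) (hp4 : p < 4)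
    (hε : 0 < ε) (hε1 : ε < 1) :
    ((apxIterations n p ε + 1 : ℕ) : ℝ) ≤ (2 + m / (p * ε)) ^ 16 := by
  refine (apxIterations_add_one_le hn hp hp4 hε).trans ?_
  set X := 2 + (m : ℝ) / (p * ε) with hX
  have hX2 : 2 ≤ X := by rw [hX]; have : 0 ≤ (m : ℝ) / (p * ε) := by positivity
                         linarith
  have h1 : p⁻¹ ≤ X := inv_le_two_add (hn.trans_le hnm) hp hε hε1
  have h2 : Real.log (2 + n / (p * ε)) ≤ X :=
    (log_two_add_mono hnm hp hε).trans (Real.log_le_self (by linarith))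
  have h3 : p⁻¹ * Real.log (2 + n / (p * ε)) ≤ X * X :=
    mul_le_mul h1 h2 (by linarith [half_le_log_two_add (show 0 ≤ (n : ℝ) / (p * ε) by positivity)])
      (by linarith)
  have h4 : (2 : ℝ) ^ 14 ≤ X ^ 14 := pow_le_pow_left₀ two_pos.le hX2 14
  calc 816 * (p⁻¹ * Real.log (2 + n / (p * ε))) ≤ 2 ^ 14 * (X * X) := by
        norm_num; nlinarith [mul_pos (by linarith : 0 < X) (by linarith : 0 < X)]
    _ ≤ X ^ 14 * (X * X) := mul_le_mul_of_nonneg_right h4 (by positivity)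
    _ = X ^ 16 := by ring

/-- The length of the first program. -/
theorem length_apxProgram_le_apxSteps (hn : 0 < n) (hp : 0 < p) (hp4 : p < 4)
    (hε : 0 < ε) (hε1 : ε < 1) (hc : 0 < c) :
    ((apxProgram m n p ε (sampleCount m p ε c ((4 - p) * ε / 256))).length : ℝ)
      ≤ 816 * 256 ^ 2 * (48 * (21 + 3 * c) + 10) * apxSteps m n p ε := by
  set δ := (4 - p) * ε / 256 with hδdef
  have h4p : 0 < 4 - p := by linarith
  have hδ : 0 < δ := by positivity
  have hδ1 : δ ≤ 1 := by rw [hδdef]; nlinarith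
  set k := sampleCount m p ε c δ with hk
  have h1 : ((apxProgram m n p ε k).length : ℝ)
      ≤ ((apxIterations n p ε + 1 : ℕ) : ℝ) * (k + 4) := by
    exact_mod_cast length_apxProgram_le (m := m) (n := n) p ε k
  have h2 := apxIterations_add_one_le hn hp hp4 hε
  have hl := half_le_log_two_add (show 0 ≤ (m : ℝ) / (p * ε) by positivity)
  have hln := half_le_log_two_add (show 0 ≤ (n : ℝ) / (p * ε) by positivity)
  have h3 : (k : ℝ) + 4
      ≤ (48 * (21 + 3 * c) + 10) * (δ ^ 2)⁻¹ * Real.log (2 + m / (p * ε)) := by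
    have h4 := sampleCount_le (m := m) hp hε hc hδ hδ1
    have h5 := one_le_inv_sq hδ hδ1
    rw [← hk] at h4
    nlinarith
  have h5 : (δ ^ 2)⁻¹ = 256 ^ 2 * ((4 - p) ^ 2)⁻¹ * (ε ^ 2)⁻¹ := by
    rw [hδdef]; field_simp
  calc _ ≤ _ := h1
    _ ≤ (816 * (p⁻¹ * Real.log (2 + n / (p * ε)))) *
        ((48 * (21 + 3 * c) + 10) * (δ ^ 2)⁻¹ * Real.log (2 + m / (p * ε))) :=
        mul_le_mul h2 h3 (by positivity) (by positivity)
    _ = _ := by rw [h5, apxSteps]; ring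

/-- The number of reweighting steps. -/
noncomputable def startIterations (m : ℕ) (p : ℝ) : ℕ :=
  ⌈8 * (p * (4 - p))⁻¹ * Real.log (8 * m / apxRadius p)⌉₊

theorem log_eight_mul_div_ge (hm : 0 < m) (hp : 0 < p) (hp4 : p < 4) :
    2 ≤ Real.log (8 * m / apxRadius p) := by
  have hm' : (1 : ℝ) ≤ m := by exact_mod_cast hm
  have hr := apxRadius_le hp hp4
  have hr0 := apxRadius_pos hp hp4
  rw [Real.le_log_iff_exp_le (by positivity)]
  have h1 : Real.exp 2 ≤ 8 := by
    have h2 : Real.exp 2 = Real.exp 1 ^ 2 := by rw [← Real.exp_nat_mul]; norm_num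
    rw [h2]
    have := Real.exp_one_lt_d9
    nlinarith [Real.exp_pos 1]
  refine h1.trans ?_
  rw [le_div_iff₀ hr0]
  nlinarith

theorem pow_startIterations_le (hm : 0 < m) (hp : 0 < p) (hp4 : p < 4) :
    |1 - p / 2| ^ startIterations m p * (2 * Real.log m) ≤ apxRadius p / 4 := by
  have hm' : (1 : ℝ) ≤ m := by exact_mod_cast hm
  have hr0 := apxRadius_pos hp hp4
  have h4p : 0 < 4 - p := by linarith
  set b := p * (4 - p) / 8 with hb
  have hb0 : 0 < b := by positivity
  have h1 : |1 - p / 2| ≤ Real.exp (-b) :=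
    (abs_one_sub_half_le hp hp4).trans (by have := Real.add_one_le_exp (-b); linarith)
  have h2 : Real.log (8 * m / apxRadius p) ≤ b * startIterations m p := by
    have h3 : 8 * (p * (4 - p))⁻¹ * Real.log (8 * m / apxRadius p) ≤ startIterations m p :=
      Nat.le_ceil _
    have h4 := mul_le_mul_of_nonneg_left h3 hb0.le
    have h5 : b * (8 * (p * (4 - p))⁻¹ * Real.log (8 * m / apxRadius p))
        = Real.log (8 * m / apxRadius p) := by rw [hb]; field_simp
    linarith
  have h3 : |1 - p / 2| ^ startIterations m p ≤ apxRadius p / (8 * m) := by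
    calc _ ≤ Real.exp (-b) ^ startIterations m p := pow_le_pow_left₀ (abs_nonneg _) h1 _
      _ = Real.exp (-(b * startIterations m p)) := by rw [← Real.exp_nat_mul]; congr 1; ring
      _ ≤ Real.exp (-Real.log (8 * m / apxRadius p)) := by
          rw [Real.exp_le_exp]; linarith
      _ = _ := by rw [Real.exp_neg, Real.exp_log (by positivity), inv_div]
  have h4 : Real.log m ≤ m := Real.log_le_self (by linarith)
  have h5 : 0 ≤ Real.log m := Real.log_nonneg hm'
  calc _ ≤ apxRadius p / (8 * m) * (2 * m) := by
        refine mul_le_mul h3 (by linarith) (by linarith) (by positivity)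
    _ = _ := by field_simp; norm_num

theorem startIterations_add_one_le (hm : 0 < m) (hp : 0 < p) (hp4 : p < 4) :
    ((startIterations m p + 1 : ℕ) : ℝ)
      ≤ 16 * (p * (4 - p))⁻¹ * Real.log (8 * m / apxRadius p) := by
  have hl := log_eight_mul_div_ge hm hp hp4
  have h4p : 0 < 4 - p := by linarith
  have h1 : 1 / 4 ≤ (p * (4 - p))⁻¹ := by
    rw [one_div]; exact inv_anti₀ (by positivity) (mul_four_sub_le p)
  have h2 : (startIterations m p : ℝ)
      < 8 * (p * (4 - p))⁻¹ * Real.log (8 * m / apxRadius p) + 1 :=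
    Nat.ceil_lt_add_one (by positivity)
  push_cast
  nlinarith

theorem startAccuracy_eq (p : ℝ) : startAccuracy p = (p * (4 - p)) ^ 2 / 2 ^ 24 := by
  rw [startAccuracy, apxRadius]; ring

/-- If sketches are used for the starting weights, there are polynomially many of them. -/
theorem startIterations_add_one_le_pow (hn : 0 < n) (hnm : n ≤ m) (hp : 0 < p) (hp4 : p < 4)
    (hε : 0 < ε) (hε1 : ε < 1) (hc : 0 < c)
    (hk : ¬ n ≤ sampleCount m p ε c (startAccuracy p)) :
    ((startIterations m p + 1 : ℕ) : ℝ) ≤ (2 + m / (p * ε)) ^ 16 := by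
  have hm : 0 < m := hn.trans_le hnm
  have hm' : (1 : ℝ) ≤ m := by exact_mod_cast hm
  have h4p : 0 < 4 - p := by linarith
  set η := startAccuracy p with hη
  have hη0 : 0 < η := startAccuracy_pos hp hp4
  have hη1 : η ≤ 1 := startAccuracy_le_one hp hp4
  have hr0 := apxRadius_pos hp hp4
  -- The quantity `X` does not control `1/(4 - p)`. But sketches are used only if `k < n ≤ m`, and
  -- `k ≥ η⁻²`; this bounds `1/(4 - p)` polynomially in `m`.
  have hηm : η⁻¹ ≤ m := by
    have h1 := inv_sq_le_sampleCount (m := m) hp hε hc hη0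
    have h2 : (sampleCount m p ε c η : ℝ) ≤ m := by
      exact_mod_cast ((not_le.mp hk).trans_le hnm).le
    refine le_trans (inv_anti₀ (by positivity) ?_) (h1.trans h2)
    nlinarith
  have h1 : (p * (4 - p))⁻¹ ≤ m := by
    refine le_trans (inv_anti₀ hη0 ?_) hηm
    rw [hη, startAccuracy_eq, div_le_iff₀ (by positivity)]
    have := mul_four_sub_le p
    have : 0 < p * (4 - p) := by positivity
    nlinarith
  have h2 : (apxRadius p)⁻¹ ≤ m := by
    refine le_trans (inv_anti₀ hη0 ?_) hηm
    rw [hη, startAccuracy]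
    nlinarith
  have h3 : Real.log (8 * m / apxRadius p) ≤ 8 * m * m := by
    refine (Real.log_le_self (by positivity)).trans ?_
    rw [div_eq_mul_inv]
    exact mul_le_mul_of_nonneg_left h2 (by positivity)
  have h4 := startIterations_add_one_le hm hp hp4
  set X := 2 + (m : ℝ) / (p * ε) with hX
  have hX2 : 2 ≤ X := by rw [hX]; have : 0 ≤ (m : ℝ) / (p * ε) := by positivity
                         linarith
  have hmX : (m : ℝ) ≤ 4 * X := nat_le_four_mul hp hp4 hε hε1 m
  have hl := log_eight_mul_div_ge hm hp hp4
  have h13 : (2 : ℝ) ^ 13 ≤ X ^ 13 := pow_le_pow_left₀ two_pos.le hX2 13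
  calc _ ≤ 16 * (p * (4 - p))⁻¹ * Real.log (8 * m / apxRadius p) := h4
    _ ≤ 16 * m * (8 * m * m) :=
        mul_le_mul (mul_le_mul_of_nonneg_left h1 (by norm_num)) h3 (by linarith) (by positivity)
    _ = 2 ^ 7 * (m : ℝ) ^ 3 := by ring
    _ ≤ 2 ^ 7 * (4 * X) ^ 3 := by gcongr
    _ = 2 ^ 13 * X ^ 3 := by ring
    _ ≤ X ^ 13 * X ^ 3 := mul_le_mul_of_nonneg_right h13 (by positivity)
    _ = X ^ 16 := by ring

theorem one_le_log_exp_mul_div (hn : 0 < n) (hnm : n ≤ m) :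
    Real.log (Real.exp 1 * m / n) = 1 + Real.log m - Real.log n ∧
      1 ≤ Real.log (Real.exp 1 * m / n) := by
  have hn' : (0 : ℝ) < n := by exact_mod_cast hn
  have hm' : (0 : ℝ) < m := by exact_mod_cast hn.trans_le hnm
  have h1 : Real.log (Real.exp 1 * m / n) = 1 + Real.log m - Real.log n := by
    rw [Real.log_div (by positivity) hn'.ne', Real.log_mul (Real.exp_pos 1).ne' hm'.ne',
      Real.log_exp]
  have h2 : Real.log n ≤ Real.log m := Real.log_le_log hn' (by exact_mod_cast hnm)
  exact ⟨h1, by rw [h1]; linarith⟩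

theorem log_nat_le (hn : 0 < n) (hp : 0 < p) (hp4 : p < 4) (hε : 0 < ε) (hε1 : ε < 1) :
    Real.log n ≤ 2 * Real.log (2 + n / (p * ε)) := by
  have hn' : (0 : ℝ) < n := by exact_mod_cast hn
  set Y := 2 + (n : ℝ) / (p * ε) with hY
  have hY2 : 2 + (n : ℝ) / 4 ≤ Y := by
    have : (n : ℝ) / 4 ≤ n / (p * ε) :=
      div_le_div_of_nonneg_left hn'.le (by positivity) (by nlinarith)
    linarith
  have h1 : (n : ℝ) ≤ Y ^ 2 := by
    have h2 : (2 + (n : ℝ) / 4) ^ 2 ≤ Y ^ 2 := pow_le_pow_left₀ (by positivity) hY2 2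
    nlinarith [sq_nonneg ((n : ℝ) / 4 - 2)]
  have := Real.log_le_log hn' h1
  rwa [Real.log_pow, Nat.cast_ofNat] at this

/-- The cost of one computation of leverage scores for the starting weights. -/
theorem min_sampleCount_le (hp : 0 < p) (hp4 : p < 4) (hε : 0 < ε) (hc : 0 < c) :
    ((min n (sampleCount m p ε c (startAccuracy p)) : ℕ) : ℝ)
      ≤ 2 ^ 25 * (48 * (21 + 3 * c) + 2) *
        (Real.sqrt n * (p⁻¹ ^ 2 * (4 - p)⁻¹ ^ 2) * Real.log (2 + m / (p * ε))) := by
  have h4p : 0 < 4 - p := by linarith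
  set η := startAccuracy p with hη
  have hη0 : 0 < η := startAccuracy_pos hp hp4
  have hk := sampleCount_le (m := m) hp hε hc hη0 (startAccuracy_le_one hp hp4)
  have hl := half_le_log_two_add (show 0 ≤ (m : ℝ) / (p * ε) by positivity)
  set l := Real.log (2 + m / (p * ε))
  set k := sampleCount m p ε c η
  set κ := 48 * (21 + 3 * c) + 2 with hκ
  have hκ1 : 1 ≤ κ := by rw [hκ]; linarith
  have hηi : η⁻¹ = 2 ^ 24 * (p⁻¹ ^ 2 * (4 - p)⁻¹ ^ 2) := by
    rw [hη, startAccuracy_eq]; field_simp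
  have hkR : (k : ℝ) ≤ (2 * κ * η⁻¹ * l) ^ 2 := by
    have h1 : κ * l ≤ (2 * κ * l) ^ 2 := by
      have : 1 ≤ 4 * (κ * l) := by nlinarith
      have h2 : 0 < κ * l := by positivity
      nlinarith
    calc (k : ℝ) ≤ κ * (η ^ 2)⁻¹ * l := hk
      _ = (κ * l) * η⁻¹ ^ 2 := by rw [inv_pow]; ring
      _ ≤ (2 * κ * l) ^ 2 * η⁻¹ ^ 2 := mul_le_mul_of_nonneg_right h1 (by positivity)
      _ = _ := by ring
  -- This is `min(n, k) ≤ √(n k)`, where the factor `√n` arises.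
  have hmin : ((min n k : ℕ) : ℝ) ≤ Real.sqrt n * (2 * κ * η⁻¹ * l) := by
    refine le_of_sq_le_sq ?_ (by positivity)
    rw [mul_pow, Real.sq_sqrt (Nat.cast_nonneg n), sq]
    refine mul_le_mul (by exact_mod_cast min_le_left n k) ?_ (by positivity) (by positivity)
    exact le_trans (by exact_mod_cast min_le_right n k) hkR
  refine hmin.trans (le_of_eq ?_)
  rw [hηi]
  ring

theorem log_eight_mul_div_eq (hm : 0 < m) (hp : 0 < p) (hp4 : p < 4) :
    Real.log (8 * m / apxRadius p)
      = 23 * Real.log 2 + Real.log m + 2 * Real.log p⁻¹ + Real.log (4 - p)⁻¹ := by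
  have hm' : (0 : ℝ) < m := by exact_mod_cast hm
  have h4p : 0 < 4 - p := by linarith
  have h1 : 8 * (m : ℝ) / apxRadius p = 2 ^ 23 * m * p⁻¹ ^ 2 * (4 - p)⁻¹ := by
    rw [apxRadius]; field_simp; norm_num
  rw [h1, Real.log_mul (by positivity) (by positivity), Real.log_mul (by positivity)
    (by positivity), Real.log_mul (by positivity) (by positivity), Real.log_pow, Real.log_pow]
  norm_num

/-- The cost of the starting weights, up to the factor `(p (4 - p))⁻¹`. -/
theorem min_mul_log_le (hn : 0 < n) (hnm : n ≤ m) (hp : 0 < p) (hp4 : p < 4)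
    (hε : 0 < ε) (hε1 : ε < 1) (hc : 0 < c) :
    ((min n (sampleCount m p ε c (startAccuracy p)) : ℕ) : ℝ) *
        Real.log (8 * m / apxRadius p)
      ≤ (40 * (2 ^ 25 * (48 * (21 + 3 * c) + 2)) + 64) *
        (Real.sqrt n * (p⁻¹ ^ 2 * (4 - p)⁻¹ ^ 2) * Real.log (Real.exp 1 * m / n) *
          Real.log (2 + n / (p * ε)) * Real.log (2 + m / (p * ε))) := by
  have hm : 0 < m := hn.trans_le hnm
  have hn' : (1 : ℝ) ≤ n := by exact_mod_cast hn
  have h4p : 0 < 4 - p := by linarith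
  have hM := min_sampleCount_le (m := m) (n := n) hp hp4 hε hc
  set M : ℝ := ((min n (sampleCount m p ε c (startAccuracy p)) : ℕ) : ℝ) with hMdef
  have hMn : M ≤ n := by rw [hMdef]; exact_mod_cast min_le_left _ _
  have hM0 : 0 ≤ M := Nat.cast_nonneg _
  obtain ⟨hG, hG1⟩ := one_le_log_exp_mul_div hn hnm
  have hlogn := log_nat_le hn hp hp4 hε hε1
  have hlm := half_le_log_two_add (show 0 ≤ (m : ℝ) / (p * ε) by positivity)
  have hln := half_le_log_two_add (show 0 ≤ (n : ℝ) / (p * ε) by positivity)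
  have hV : Real.log p⁻¹ ≤ Real.log (2 + n / (p * ε)) :=
    Real.log_le_log (by positivity) (inv_le_two_add hn hp hε hε1)
  have hV4 : 1 / 4 ≤ p⁻¹ := by rw [one_div]; exact inv_anti₀ hp hp4.le
  rw [log_eight_mul_div_eq hm hp hp4]
  set D := 2 ^ 25 * (48 * (21 + 3 * c) + 2)
  set G := Real.log (Real.exp 1 * m / n)
  set ln := Real.log (2 + n / (p * ε))
  set lm := Real.log (2 + m / (p * ε))
  set V := p⁻¹
  set U := (4 - p)⁻¹ with hU
  have hU0 : 0 < U := by positivity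
  have hD : 0 < D := by positivity
  set R := Real.sqrt n * (V ^ 2 * U ^ 2) with hR
  have hR0 : 0 < R := by
    have : 0 < Real.sqrt n := Real.sqrt_pos.mpr (by linarith)
    positivity
  have hln0 : 0 < ln := by linarith
  have hlm0 : 0 < lm := by linarith
  have hG0 : 0 < G := by linarith
  have hGl : ln ≤ G * ln := le_mul_of_one_le_left hln0.le hG1
  have hGl' : G ≤ 2 * (G * ln) := by
    have := mul_le_mul_of_nonneg_left hln hG0.le
    linarith
  have hMR : 0 ≤ D * (R * lm) := by positivity
  have hfirst : 23 * Real.log 2 + Real.log m + 2 * Real.log V ≤ 38 * (G * ln) := by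
    have h2 := Real.log_two_lt_d9
    linarith
  have h1 : M * (23 * Real.log 2 + Real.log m + 2 * Real.log V)
      ≤ 38 * D * (R * G * ln * lm) := by
    calc _ ≤ M * (38 * (G * ln)) := mul_le_mul_of_nonneg_left hfirst hM0
      _ ≤ D * (R * lm) * (38 * (G * ln)) := mul_le_mul_of_nonneg_right hM (by positivity)
      _ = _ := by ring
  have h2 : M * Real.log U ≤ (2 * D + 64) * (R * G * ln * lm) := by
    have hpos : 0 ≤ R * G * ln * lm := by positivity
    -- The term `log (1/(4 - p))` is not among the logarithms of the target. If `U ≤ n` it is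
    -- absorbed by `log n`. If `U > n`, the cost is bounded by `n ≤ √n U` and `log U ≤ U`, which
    -- uses up the available `√n U²`.
    rcases le_or_gt U n with hUn | hUn
    · have h3 : Real.log U ≤ 2 * (G * ln) := by
        have := Real.log_le_log hU0 hUn
        linarith
      calc _ ≤ M * (2 * (G * ln)) := mul_le_mul_of_nonneg_left h3 hM0
        _ ≤ D * (R * lm) * (2 * (G * ln)) := mul_le_mul_of_nonneg_right hM (by positivity)
        _ = 2 * D * (R * G * ln * lm) := by ring
        _ ≤ _ := mul_le_mul_of_nonneg_right (by linarith) hpos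
    · have hs : 1 ≤ Real.sqrt n := Real.one_le_sqrt.mpr hn'
      have hsn : Real.sqrt n * Real.sqrt n = n := Real.mul_self_sqrt (by linarith)
      have h3 : (n : ℝ) ≤ Real.sqrt n * U := by
        have h : Real.sqrt n ≤ n := by
          calc Real.sqrt n ≤ Real.sqrt n * Real.sqrt n := le_mul_of_one_le_left (by linarith) hs
            _ = n := hsn
        calc (n : ℝ) = Real.sqrt n * Real.sqrt n := hsn.symm
          _ ≤ Real.sqrt n * U := mul_le_mul_of_nonneg_left (h.trans hUn.le) (by linarith)
      have h4 : Real.log U ≤ U := Real.log_le_self hU0.le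
      have h5 : 0 ≤ Real.log U := Real.log_nonneg (by linarith)
      have h6 : 1 ≤ 16 * V ^ 2 := by
        have := pow_le_pow_left₀ (by norm_num) hV4 2
        linarith
      have h7 : 1 ≤ 4 * (G * ln * lm) := by
        have h := mul_le_mul (mul_le_mul hG1 hln (by norm_num) hG0.le) hlm (by norm_num)
          (mul_nonneg hG0.le hln0.le)
        linarith
      calc M * Real.log U ≤ (Real.sqrt n * U) * U :=
            mul_le_mul (hMn.trans h3) h4 h5 (by positivity)
        _ = Real.sqrt n * U ^ 2 * 1 := by ring
        _ ≤ Real.sqrt n * U ^ 2 * (16 * V ^ 2 * (4 * (G * ln * lm))) := by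
            exact mul_le_mul_of_nonneg_left (one_le_mul_of_one_le_of_one_le h6 h7) (by positivity)
        _ = 64 * (R * G * ln * lm) := by rw [hR]; ring
        _ ≤ _ := mul_le_mul_of_nonneg_right (by linarith) hpos
  linarith

/-- The length of the starting program. -/
theorem length_startProgram_le_homotopySteps (hn : 0 < n) (hnm : n ≤ m) (hp : 0 < p) (hp4 : p < 4)
    (hε : 0 < ε) (hε1 : ε < 1) (hc : 0 < c) :
    ((startProgram m n p (sampleCount m p ε c (startAccuracy p))
        (startIterations m p)).length : ℝ)
      ≤ 96 * (40 * (2 ^ 25 * (48 * (21 + 3 * c) + 2)) + 64) * homotopySteps m n p ε := by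
  have hm : 0 < m := hn.trans_le hnm
  have h4p : 0 < 4 - p := by linarith
  set k := sampleCount m p ε c (startAccuracy p) with hk
  have hk0 : 0 < k := sampleCount_pos hp hε hc (startAccuracy_pos hp hp4)
  have h1 : ((startProgram m n p k (startIterations m p)).length : ℝ)
      ≤ ((startIterations m p + 1 : ℕ) : ℝ) * ((min n k : ℕ) + 5) := by
    exact_mod_cast length_startProgram_le (m := m) (n := n) p k (startIterations m p)
  have hmin : (1 : ℝ) ≤ ((min n k : ℕ) : ℝ) := by
    exact_mod_cast Nat.one_le_iff_ne_zero.mpr (lt_min hn hk0).ne'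
  have h2 := startIterations_add_one_le hm hp hp4
  have h3 := min_mul_log_le hn hnm hp hp4 hε hε1 hc
  have hl := log_eight_mul_div_ge hm hp hp4
  rw [← hk] at h3
  set D := 40 * (2 ^ 25 * (48 * (21 + 3 * c) + 2)) + 64
  calc _ ≤ _ := h1
    _ ≤ (16 * (p * (4 - p))⁻¹ * Real.log (8 * m / apxRadius p)) * (6 * (min n k : ℕ)) :=
        mul_le_mul h2 (by linarith) (by positivity) (by positivity)
    _ = 96 * (p * (4 - p))⁻¹ * ((min n k : ℕ) * Real.log (8 * m / apxRadius p)) := by ring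
    _ ≤ 96 * (p * (4 - p))⁻¹ * _ := mul_le_mul_of_nonneg_left h3 (by positivity)
    _ = _ := by rw [homotopySteps]; field_simp

end Parameters

/-! ### Assembling the two programs. -/

theorem apxSteps_nonneg {m n : ℕ} {p ε : ℝ} (hp : 0 < p) (hp4 : p < 4) (hε : 0 < ε) :
    0 ≤ apxSteps m n p ε := by
  have h4p : 0 < 4 - p := by linarith
  have hlm := half_le_log_two_add (show 0 ≤ (m : ℝ) / (p * ε) by positivity)
  have hln := half_le_log_two_add (show 0 ≤ (n : ℝ) / (p * ε) by positivity)
  rw [apxSteps]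
  positivity

theorem homotopySteps_nonneg {m n : ℕ} {p ε : ℝ} (hn : 0 < n) (hnm : n ≤ m) (hp : 0 < p)
    (hp4 : p < 4) (hε : 0 < ε) : 0 ≤ homotopySteps m n p ε := by
  have h4p : 0 < 4 - p := by linarith
  have hlm := half_le_log_two_add (show 0 ≤ (m : ℝ) / (p * ε) by positivity)
  have hln := half_le_log_two_add (show 0 ≤ (n : ℝ) / (p * ε) by positivity)
  have hG := (one_le_log_exp_mul_div hn hnm).2
  rw [homotopySteps]
  positivity

theorem mainTheorem11 (c : ℝ) (hc : 0 < c) :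
    ∃ C : ℝ, 0 < C ∧
      ∀ (m n : ℕ) (p ε : ℝ), 0 < n → n ≤ m → 0 < p → p < 4 → 0 < ε → ε < 1 →
        -- with an initial weight
        (∃ P : Program m n,
          (P.length : ℝ) ≤ C * apxSteps m n p ε ∧
          P.CheapSteps C ∧
          ∀ A : Matrix (Fin m) (Fin n) ℝ, NonDegenerate A →
            ∀ w₀ : Fin m → ℝ, (∀ i, 0 < w₀ i) →
              ‖w₀⁻¹ * (lewisWeight A p - w₀)‖ ≤ apxRadius p →
              1 - (m : ℝ) ^ (-c) ≤
                P.prob A w₀ {w | IsApxWeightRun A p w₀ ε w ∧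
                  ‖(lewisWeight A p)⁻¹ * (lewisWeight A p - w)‖ ≤ ε}) ∧
        -- without an initial weight
        (∃ P : Program m n,
          (P.length : ℝ) ≤ C * (homotopySteps m n p ε + apxSteps m n p ε) ∧
          P.CheapSteps C ∧
          ∀ A : Matrix (Fin m) (Fin n) ℝ, NonDegenerate A →
            1 - (m : ℝ) ^ (-c) ≤
              P.prob A 0 {w |
                (∃ w₁ : Fin m → ℝ, (∀ i, 0 < w₁ i) ∧
                  ‖w₁⁻¹ * (lewisWeight A p - w₁)‖ ≤ apxRadius p ∧
                  IsApxWeightRun A p w₁ ε w) ∧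
                ‖(lewisWeight A p)⁻¹ * (lewisWeight A p - w)‖ ≤ ε}) := by
  set C₁ := 816 * 256 ^ 2 * (48 * (21 + 3 * c) + 10) with hC₁
  set C₂ := 96 * (40 * (2 ^ 25 * (48 * (21 + 3 * c) + 2)) + 64) with hC₂
  have hC₁0 : 0 < C₁ := by positivity
  have hC₂0 : 0 < C₂ := by positivity
  refine ⟨32 + C₁ + C₂, by positivity, fun m n p ε hn hnm hp hp4 hε hε1 => ?_⟩
  have hm : 0 < m := hn.trans_le hnm
  have hδ : 0 < (4 - p) * ε / 256 := div_pos (mul_pos (by linarith) hε) (by norm_num)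
  set k := sampleCount m p ε c ((4 - p) * ε / 256) with hk
  have hk0 : 0 < k := sampleCount_pos hp hε hc hδ
  have hlen := length_apxProgram_le_apxSteps (m := m) hn hp hp4 hε hε1 hc
  have hfail : ((apxIterations n p ε + 1 : ℕ) : ℝ) * sketchFailure m k ((4 - p) * ε / 256)
      ≤ (m : ℝ) ^ (-c) / 2 :=
    mul_sketchFailure_le hm hp hp4 hε hε1 hc hδ
      (apxIterations_add_one_le_pow hn hnm hp hp4 hε hε1)
  have hmc : 0 ≤ (m : ℝ) ^ (-c) := by positivity
  have hS := apxSteps_nonneg (m := m) (n := n) hp hp4 hε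
  have hH := homotopySteps_nonneg hn hnm hp hp4 hε
  constructor
  · refine ⟨apxProgram m n p ε k, hlen.trans (mul_le_mul_of_nonneg_right (by linarith) hS),
      cheapSteps_of_shortStep hm hnm (shortStep_apxProgram p ε k) (by linarith),
      fun A hA w₀ hw₀ hclose => Hoare.le_prob ?_ hmc⟩
    refine ((hoare_apxProgram hA hp hp4 hε hε1 hw₀ hk0).mono_right fun S hrun => ?_).mono_prob
      (ENNReal.ofReal_le_ofReal (by linarith))
    exact ⟨hrun, hrun.accurate hA hn hp hp4 hε hε1 hw₀ hclose⟩
  · set k' := sampleCount m p ε c (startAccuracy p) with hk'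
    have hk'0 : 0 < k' := sampleCount_pos hp hε hc (startAccuracy_pos hp hp4)
    refine ⟨startProgram m n p k' (startIterations m p) ++ apxProgram m n p ε k, ?_,
      cheapSteps_of_shortStep hm hnm ?_ (by linarith), fun A hA => Hoare.le_prob ?_ hmc⟩
    · have hlen' := length_startProgram_le_homotopySteps hn hnm hp hp4 hε hε1 hc
      rw [List.length_append]
      push_cast
      calc _ ≤ C₂ * homotopySteps m n p ε + C₁ * apxSteps m n p ε := add_le_add hlen' hlen
        _ ≤ _ := by
          rw [mul_add]
          exact add_le_add (mul_le_mul_of_nonneg_right (by linarith) hH)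
            (mul_le_mul_of_nonneg_right (by linarith) hS)
    · intro s hs
      rcases List.mem_append.mp hs with h | h
      · exact shortStep_startProgram p k' _ s h
      · exact shortStep_apxProgram p ε k s h
    · have hfail' : ((startIterations m p + 1 : ℕ) : ℝ) * levFailure m n k' (startAccuracy p)
          ≤ (m : ℝ) ^ (-c) / 2 := by
        rw [levFailure]
        -- Exact leverage scores never fail, so the number of starting steps matters only in the
        -- branch with sketches.
        split_ifs with h
        · rw [mul_zero]; positivity
        · exact mul_sketchFailure_le hm hp hp4 hε hε1 hc (startAccuracy_pos hp hp4)
            (startIterations_add_one_le_pow hn hnm hp hp4 hε hε1 hc h)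
      have h := hoare_startProgram_apxProgram (ε := ε) hA hm hp hp4 hε hε1 hk'0 hk0
        (pow_startIterations_le hm hp hp4)
      intro S _
      refine ((h.mono_right fun S hrun => ?_).mono_prob
        (ENNReal.ofReal_le_ofReal (by linarith))) S trivial
      obtain ⟨w₁, h1, h2, h3⟩ := hrun
      exact ⟨⟨w₁, h1, h2, h3⟩, h3.accurate hA hn hp hp4 hε hε1 h1 h2⟩
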